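/- Let $p(y_1,y_2|x)$ be a two-receiver discrete memoryless broadcast channel with finite alphabets $\mathcal X,\mathcal Y_1,\mathcal Y_2$. A code of length $n$ has an encoder $(m_0,m_1,m_2)\mapsto x^n$ for message sets of sizes $M_0,M_1,M_2$; receiver $1$ estimates $(m_0,m_1)$ from $y_1^n$, receiver $2$ estimates $(m_0,m_2)$ from $y_2^n$. A triple $(R_0,R_1,R_2)$ of nonnegative reals is achievable if for every $\varepsilon>0$ and all large $n$ there is a code with $M_k\ge e^{nR_k}$ ($k=0,1,2$) for which the probability, for independent uniform messages, that some receiver errs is at most $\varepsilon$. The capacity region is the closure of the set of achievable triples. Mutual informations are in nats and take values in $[0,\infty]$. Consider all random variables $T,U,V,W_1,W_2$ (real-valued, with arbitrary distributions), $X\in\mathcal X$, $Y_1\in\mathcal Y_1$, $Y_2\in\mathcal Y_2$ such that $(T,U,V,W_1,W_2)\to X\to(Y_1,Y_2)$ is a Markov chain with $(Y_1,Y_2)$ given $X$ distributed according to $p(y_1,y_2|x)$, such that $T,U,V$ are mutually independent, and such that the following equalities hold: (1) $$I(T;Y_1|W_1)=I(T;Y_2|W_2),$$ $$I(T;Y_1|W_1)=I(T;Y_1|V,W_1)=I(T;Y_1|U,W_1)=I(T;Y_1|U,V,W_1),$$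 $$I(T;Y_2|W_2)=I(T;Y_2|V,W_2)=I(T;Y_2|U,W_2)=I(T;Y_2|U,V,W_2),$$ $$I(U;Y_1|W_1)=I(U;Y_1|V,W_1)=I(U;Y_1|T,W_1)=I(U;Y_1|T,V,W_1),$$ $$I(V;Y_2|W_2)=I(V;Y_2|U,W_2)=I(V;Y_2|T,W_2)=I(V;Y_2|T,U,W_2);$$ (2) for all $A\subseteq\{T,U,V\}$, $B_1\subseteq\{T,U\}$, $B_2\subseteq\{T,V\}$, $$I(B_1;B_2|A,W_1,W_2,Y_1)=I(B_1;B_2|A,W_1,W_2,Y_2),$$ and also, so that this equality keeps its content when both sides are infinite (it is equivalent to it when $I(B_1;B_2|A,W_1,W_2)<\infty$), $$I(B_1;Y_1|A,B_2,W_1,W_2)-I(B_1;Y_1|A,W_1,W_2)=I(B_1;Y_2|A,B_2,W_1,W_2)-I(B_1;Y_2|A,W_1,W_2);$$ (3) for all $A\subseteq\{T,U,V\}$, $$I(W_2;Y_1|A,W_1)=I(W_1;Y_2|A,W_2).$$ Then the union, over all such random variables, of the sets of nonnegative triples $(R_0,R_1,R_2)$ with $$R_0\le\min\{I(T;Y_1|W_1),I(T;Y_2|W_2)\},\qquad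 R_1\le I(U;Y_1|W_1),\qquad R_2\le I(V;Y_2|W_2)$$ contains the capacity region of the channel. Further, the capacity region is still contained in this union if it is restricted to those random variables for which $X$ is a deterministic function of $(T,U,V,W_1,W_2)$ and $T$, $U$, $V$ are each uniformly distributed (on $[0,1]$). -/

import Mathlib

open MeasureTheory ProbabilityTheory
open scoped ENNReal

namespace BroadcastOuter

noncomputable section

/-! ### Conditional mutual information -/

/-- Conditional mutual information `I(A;B|C)` in nats, with values in `[0,∞]`, of random variables
on `(Ω, μ)`: the relative entropy of the joint law of `(C,(A,B))` with respect to the law under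
which `C` has its own distribution and, given `C`, `A` and `B` are independent with their
conditional distributions given `C`. -/
def condMI {Ω α β γ : Type*} [MeasurableSpace Ω]
    [MeasurableSpace α] [StandardBorelSpace α] [Nonempty α]
    [MeasurableSpace β] [StandardBorelSpace β] [Nonempty β]
    [MeasurableSpace γ]
    (μ : Measure Ω) [IsFiniteMeasure μ] (A : Ω → α) (B : Ω → β) (C : Ω → γ) : ℝ≥0∞ :=
  InformationTheory.klDiv (μ.map fun ω => (C ω, (A ω, B ω)))
    (μ.map C ⊗ₘ (condDistrib A C μ ×ₖ condDistrib B C μ))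

/-! ### The discrete memoryless broadcast channel -/

section Channel

variable {𝒳 𝒴₁ 𝒴₂ : Type*} [MeasurableSpace 𝒳] [MeasurableSpace 𝒴₁] [MeasurableSpace 𝒴₂]

/-- A block code of length `n` with `M₀` common messages and `M₁`, `M₂` private messages. Receiver
`k` estimates the common message and its own private message. -/
structure Code (𝒳 𝒴₁ 𝒴₂ : Type*) (n M₀ M₁ M₂ : ℕ) where
  enc : Fin M₀ × Fin M₁ × Fin M₂ → Fin n → 𝒳
  dec₁ : (Fin n → 𝒴₁) → Fin M₀ × Fin M₁
  dec₂ : (Fin n → 𝒴₂) → Fin M₀ × Fin M₂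

/-- The set of output blocks on which some receiver errs when `m` has been sent. -/
def Code.errorSet {n M₀ M₁ M₂ : ℕ} (c : Code 𝒳 𝒴₁ 𝒴₂ n M₀ M₁ M₂)
    (m : Fin M₀ × Fin M₁ × Fin M₂) : Set (Fin n → 𝒴₁ × 𝒴₂) :=
  {y | c.dec₁ (fun i => (y i).1) ≠ (m.1, m.2.1) ∨ c.dec₂ (fun i => (y i).2) ≠ (m.1, m.2.2)}

/-- Average error probability over independent uniform messages, for `n` memoryless uses of the
channel `κ`. -/
def Code.errorProb (κ : Kernel 𝒳 (𝒴₁ × 𝒴₂)) {n M₀ M₁ M₂ : ℕ} (c : Code 𝒳 𝒴₁ 𝒴₂ n M₀ M₁ M₂) : ℝ :=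
  (∑ m : Fin M₀ × Fin M₁ × Fin M₂,
    (Measure.pi fun i => κ (c.enc m i)).real (c.errorSet m)) / ((M₀ : ℝ) * M₁ * M₂)

/-- `(R₀,R₁,R₂)` is achievable (rates in nats per channel use): for every `ε > 0` and every large
block length `n` there is a code with at least `exp (n R_k)` messages of kind `k`, `k = 0, 1, 2`,
and average error probability at most `ε`. -/
def Achievable (κ : Kernel 𝒳 (𝒴₁ × 𝒴₂)) (R : ℝ × ℝ × ℝ) : Prop :=
  0 ≤ R.1 ∧ 0 ≤ R.2.1 ∧ 0 ≤ R.2.2 ∧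
  ∀ ε : ℝ, 0 < ε → ∃ N : ℕ, ∀ n : ℕ, N ≤ n → ∃ (M₀ M₁ M₂ : ℕ) (c : Code 𝒳 𝒴₁ 𝒴₂ n M₀ M₁ M₂),
    Real.exp (n * R.1) ≤ M₀ ∧ Real.exp (n * R.2.1) ≤ M₁ ∧ Real.exp (n * R.2.2) ≤ M₂ ∧
    c.errorProb κ ≤ ε

/-- The capacity region: the closure of the set of achievable rate triples. -/
def capacityRegion (κ : Kernel 𝒳 (𝒴₁ × 𝒴₂)) : Set (ℝ × ℝ × ℝ) :=
  closure {R | Achievable κ R}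

end Channel

/-! ### The outer bound -/

/-- Names of the three independent auxiliary random variables. -/
inductive Label
  | t
  | u
  | v
  deriving DecidableEq

/-- The family `(T, U, V)` indexed by names. -/
def family {Ω : Type*} (T U V : Ω → ℝ) : Label → Ω → ℝ
  | Label.t => T
  | Label.u => U
  | Label.v => V

/-- The subtuple of `(T, U, V)` consisting of the variables named in `A`. -/
def sub {Ω : Type*} (T U V : Ω → ℝ) (A : Finset Label) : Ω → (A → ℝ) :=
  fun ω i => family T U V i ω

section Region

variable {𝒳 𝒴₁ 𝒴₂ : Type*}
  [Fintype 𝒳] [MeasurableSpace 𝒳] [MeasurableSingletonClass 𝒳]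
  [Fintype 𝒴₁] [Nonempty 𝒴₁] [MeasurableSpace 𝒴₁] [MeasurableSingletonClass 𝒴₁]
  [Fintype 𝒴₂] [Nonempty 𝒴₂] [MeasurableSpace 𝒴₂] [MeasurableSingletonClass 𝒴₂]

/-- The conditions on `(T,U,V,W₁,W₂,X,Y₁,Y₂)` in the outer bound for the channel `κ`. -/
structure Admissible (κ : Kernel 𝒳 (𝒴₁ × 𝒴₂)) {Ω : Type} [MeasurableSpace Ω] (μ : Measure Ω)
    [IsFiniteMeasure μ] (T U V W₁ W₂ : Ω → ℝ) (X : Ω → 𝒳) (Y₁ : Ω → 𝒴₁) (Y₂ : Ω → 𝒴₂) : Prop where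
  measurable_T : Measurable T
  measurable_U : Measurable U
  measurable_V : Measurable V
  measurable_W₁ : Measurable W₁
  measurable_W₂ : Measurable W₂
  measurable_X : Measurable X
  measurable_Y₁ : Measurable Y₁
  measurable_Y₂ : Measurable Y₂
  /-- `(T,U,V,W₁,W₂) → X → (Y₁,Y₂)` is a Markov chain whose last transition is the channel. -/
  markov : μ.map (fun ω => (((T ω, U ω, V ω, W₁ ω, W₂ ω), X ω), (Y₁ ω, Y₂ ω))) =
    μ.map (fun ω => ((T ω, U ω, V ω, W₁ ω, W₂ ω), X ω)) ⊗ₘ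
      Kernel.prodMkLeft (ℝ × ℝ × ℝ × ℝ × ℝ) κ
  /-- `T`, `U`, `V` are mutually independent. -/
  indep : iIndepFun (family T U V) μ
  T_Y₁_eq_T_Y₂ : condMI μ T Y₁ W₁ = condMI μ T Y₂ W₂
  T_Y₁_V : condMI μ T Y₁ W₁ = condMI μ T Y₁ (fun ω => (V ω, W₁ ω))
  T_Y₁_U : condMI μ T Y₁ W₁ = condMI μ T Y₁ (fun ω => (U ω, W₁ ω))
  T_Y₁_UV : condMI μ T Y₁ W₁ = condMI μ T Y₁ (fun ω => (U ω, V ω, W₁ ω))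
  T_Y₂_V : condMI μ T Y₂ W₂ = condMI μ T Y₂ (fun ω => (V ω, W₂ ω))
  T_Y₂_U : condMI μ T Y₂ W₂ = condMI μ T Y₂ (fun ω => (U ω, W₂ ω))
  T_Y₂_UV : condMI μ T Y₂ W₂ = condMI μ T Y₂ (fun ω => (U ω, V ω, W₂ ω))
  U_Y₁_V : condMI μ U Y₁ W₁ = condMI μ U Y₁ (fun ω => (V ω, W₁ ω))
  U_Y₁_T : condMI μ U Y₁ W₁ = condMI μ U Y₁ (fun ω => (T ω, W₁ ω))
  U_Y₁_TV : condMI μ U Y₁ W₁ = condMI μ U Y₁ (fun ω => (T ω, V ω, W₁ ω))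
  V_Y₂_U : condMI μ V Y₂ W₂ = condMI μ V Y₂ (fun ω => (U ω, W₂ ω))
  V_Y₂_T : condMI μ V Y₂ W₂ = condMI μ V Y₂ (fun ω => (T ω, W₂ ω))
  V_Y₂_TU : condMI μ V Y₂ W₂ = condMI μ V Y₂ (fun ω => (T ω, U ω, W₂ ω))
  /-- `I(B₁;B₂|A,W₁,W₂,Y₁) = I(B₁;B₂|A,W₁,W₂,Y₂)`, an equality in `[0,∞]`. -/
  sub_sub : ∀ A B₁ B₂ : Finset Label,
    B₁ ⊆ {Label.t, Label.u} → B₂ ⊆ {Label.t, Label.v} →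
    condMI μ (sub T U V B₁) (sub T U V B₂) (fun ω => (sub T U V A ω, W₁ ω, W₂ ω, Y₁ ω)) =
    condMI μ (sub T U V B₁) (sub T U V B₂) (fun ω => (sub T U V A ω, W₁ ω, W₂ ω, Y₂ ω))
  /-- The same equality in a form that keeps its content when both sides of `sub_sub` are infinite.
  By the chain rule, `I(B₁;B₂|A,W,Y) + I(B₁;Y|A,W) = I(B₁;B₂|A,W) + I(B₁;Y|A,B₂,W)`, so for finite
  `I(B₁;B₂|A,W)` it is equivalent to `sub_sub`. All four terms are finite. -/
  sub_sub' : ∀ A B₁ B₂ : Finset Label,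
    B₁ ⊆ {Label.t, Label.u} → B₂ ⊆ {Label.t, Label.v} →
    condMI μ (sub T U V B₁) Y₁ (fun ω => (sub T U V (A ∪ B₂) ω, W₁ ω, W₂ ω)) +
      condMI μ (sub T U V B₁) Y₂ (fun ω => (sub T U V A ω, W₁ ω, W₂ ω)) =
    condMI μ (sub T U V B₁) Y₂ (fun ω => (sub T U V (A ∪ B₂) ω, W₁ ω, W₂ ω)) +
      condMI μ (sub T U V B₁) Y₁ (fun ω => (sub T U V A ω, W₁ ω, W₂ ω))
  /-- `I(W₂;Y₁|A,W₁) = I(W₁;Y₂|A,W₂)`. -/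
  W_Y : ∀ A : Finset Label,
    condMI μ W₂ Y₁ (fun ω => (sub T U V A ω, W₁ ω)) =
    condMI μ W₁ Y₂ (fun ω => (sub T U V A ω, W₂ ω))

/-- The rate constraints given by `(T,U,V,W₁,W₂,Y₁,Y₂)`. -/
def RateBounds {Ω : Type} [MeasurableSpace Ω] (μ : Measure Ω) [IsFiniteMeasure μ]
    (T U V W₁ W₂ : Ω → ℝ) (Y₁ : Ω → 𝒴₁) (Y₂ : Ω → 𝒴₂) (R : ℝ × ℝ × ℝ) : Prop :=
  0 ≤ R.1 ∧ 0 ≤ R.2.1 ∧ 0 ≤ R.2.2 ∧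
  ENNReal.ofReal R.1 ≤ min (condMI μ T Y₁ W₁) (condMI μ T Y₂ W₂) ∧
  ENNReal.ofReal R.2.1 ≤ condMI μ U Y₁ W₁ ∧
  ENNReal.ofReal R.2.2 ≤ condMI μ V Y₂ W₂

/-- The outer region: the union of the rate constraints over all admissible random variables. -/
def outerRegion (κ : Kernel 𝒳 (𝒴₁ × 𝒴₂)) : Set (ℝ × ℝ × ℝ) :=
  {R | ∃ (Ω : Type) (_ : MeasurableSpace Ω) (μ : Measure Ω) (_ : IsProbabilityMeasure μ)
      (T U V W₁ W₂ : Ω → ℝ) (X : Ω → 𝒳) (Y₁ : Ω → 𝒴₁) (Y₂ : Ω → 𝒴₂),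
      Admissible κ μ T U V W₁ W₂ X Y₁ Y₂ ∧ RateBounds μ T U V W₁ W₂ Y₁ Y₂ R}

/-- The same union restricted to the admissible random variables such that `T`, `U`, `V` are
uniformly distributed (on the unit interval) and `X` is a deterministic function of
`(T,U,V,W₁,W₂)`. -/
def restrictedOuterRegion (κ : Kernel 𝒳 (𝒴₁ × 𝒴₂)) : Set (ℝ × ℝ × ℝ) :=
  {R | ∃ (Ω : Type) (_ : MeasurableSpace Ω) (μ : Measure Ω) (_ : IsProbabilityMeasure μ)
      (T U V W₁ W₂ : Ω → ℝ) (X : Ω → 𝒳) (Y₁ : Ω → 𝒴₁) (Y₂ : Ω → 𝒴₂),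
      Admissible κ μ T U V W₁ W₂ X Y₁ Y₂ ∧ RateBounds μ T U V W₁ W₂ Y₁ Y₂ R ∧
      μ.map T = volume.restrict (Set.Icc 0 1) ∧
      μ.map U = volume.restrict (Set.Icc 0 1) ∧
      μ.map V = volume.restrict (Set.Icc 0 1) ∧
      ∃ f : ℝ × ℝ × ℝ × ℝ × ℝ → 𝒳, Measurable f ∧ ∀ ω, X ω = f (T ω, U ω, V ω, W₁ ω, W₂ ω)}

end Region

end

end BroadcastOuter

namespace BroadcastOuter

noncomputable section

/-! ### General properties of conditional mutual information -/

section CondMI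

open InformationTheory

lemma klDiv_map_of_leftInverse {α β : Type*} [MeasurableSpace α] [MeasurableSpace β]
    {f : α → β} {g : β → α} (hf : Measurable f) (hg : Measurable g) (h : ∀ x, g (f x) = x)
    (μ ν : Measure α) [IsFiniteMeasure μ] [IsFiniteMeasure ν] :
    klDiv (μ.map f) (ν.map f) = klDiv μ ν := by
  refine le_antisymm (klDiv_map_le μ ν hf) ?_
  have hgf : g ∘ f = id := funext h
  simpa [Measure.map_map hg hf, hgf] using klDiv_map_le (μ.map f) (ν.map f) hg

lemma map_compProd_of_leftInverse {α α' β : Type*} [MeasurableSpace α] [MeasurableSpace α']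
    [MeasurableSpace β] {f : α → α'} {g : α' → α} (hf : Measurable f) (hg : Measurable g)
    (h : ∀ x, g (f x) = x) (μ : Measure α) [SFinite μ] (κ : Kernel α β) [IsSFiniteKernel κ] :
    (μ ⊗ₘ κ).map (fun p => (f p.1, p.2)) = μ.map f ⊗ₘ κ.comap g hg := by
  ext s hs
  rw [Measure.map_apply (by fun_prop) hs, Measure.compProd_apply (hs.preimage (by fun_prop)),
    Measure.compProd_apply hs, lintegral_map (Kernel.measurable_kernel_prodMk_left hs) hf]
  simp only [Kernel.comap_apply, h]
  rfl

lemma compProd_prod_map_prodAssoc_symm {α β γ : Type*} [MeasurableSpace α]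
    [MeasurableSpace β] [MeasurableSpace γ] (ν : Measure γ) [SFinite ν] (κ : Kernel γ α)
    [IsSFiniteKernel κ] (η : Kernel γ β) [IsSFiniteKernel η] :
    (ν ⊗ₘ (κ ×ₖ η)).map MeasurableEquiv.prodAssoc.symm = (ν ⊗ₘ κ) ⊗ₘ Kernel.prodMkRight α η := by
  have : κ ×ₖ η = κ ⊗ₖ Kernel.prodMkRight α η := by
    ext c s hs
    rw [Kernel.prod_apply, Kernel.compProd_apply hs, Measure.prod_apply hs]
    rfl
  rw [this, Measure.compProd_assoc]

variable {Ω α β δ γ γ' : Type*} [MeasurableSpace Ω]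
  [MeasurableSpace α] [StandardBorelSpace α] [Nonempty α]
  [MeasurableSpace β] [StandardBorelSpace β] [Nonempty β]
  [MeasurableSpace δ] [StandardBorelSpace δ] [Nonempty δ]
  [MeasurableSpace γ] [MeasurableSpace γ']
  {μ : Measure Ω} [IsFiniteMeasure μ] {A : Ω → α} {B : Ω → β} {D : Ω → δ} {C : Ω → γ}

lemma condDistrib_comp_of_leftInverse {f : γ → γ'} {g : γ' → γ} (hf : Measurable f)
    (hg : Measurable g) (h : ∀ x, g (f x) = x) (hA : Measurable A) (hC : Measurable C) :
    condDistrib A (fun ω => f (C ω)) μ =ᵐ[μ.map fun ω => f (C ω)]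
      (condDistrib A C μ).comap g hg := by
  refine condDistrib_ae_eq_of_measure_eq_compProd _ hA.aemeasurable ?_
  have h1 : μ.map (fun ω => f (C ω)) = (μ.map C).map f := (Measure.map_map hf hC).symm
  rw [h1, ← map_compProd_of_leftInverse hf hg h, compProd_map_condDistrib hA.aemeasurable,
    Measure.map_map (by fun_prop) (by fun_prop)]
  rfl

/-- Conditional mutual information does not change if the conditioning variable is relabelled. -/
lemma condMI_comp_of_leftInverse {f : γ → γ'} {g : γ' → γ} (hf : Measurable f)
    (hg : Measurable g) (h : ∀ x, g (f x) = x) (hA : Measurable A) (hB : Measurable B)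
    (hC : Measurable C) :
    condMI μ A B (fun ω => f (C ω)) = condMI μ A B C := by
  have hk : condDistrib A (fun ω => f (C ω)) μ ×ₖ condDistrib B (fun ω => f (C ω)) μ
      =ᵐ[μ.map fun ω => f (C ω)] (condDistrib A C μ ×ₖ condDistrib B C μ).comap g hg := by
    filter_upwards [condDistrib_comp_of_leftInverse (μ := μ) hf hg h hA hC,
      condDistrib_comp_of_leftInverse (μ := μ) hf hg h hB hC] with c h1 h2
    rw [Kernel.prod_apply, h1, h2, Kernel.comap_apply, Kernel.comap_apply, Kernel.comap_apply,
      Kernel.prod_apply]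
  have h1 : μ.map (fun ω => f (C ω)) = (μ.map C).map f := (Measure.map_map hf hC).symm
  have h2 : μ.map (fun ω => (f (C ω), (A ω, B ω)))
      = (μ.map fun ω => (C ω, (A ω, B ω))).map (fun p => (f p.1, p.2)) := by
    rw [Measure.map_map (by fun_prop) (by fun_prop)]
    rfl
  rw [condMI, condMI, Measure.compProd_congr hk, h2, h1, ← map_compProd_of_leftInverse hf hg h]
  exact klDiv_map_of_leftInverse (g := fun p => (g p.1, p.2)) (by fun_prop) (by fun_prop)
    (fun p => by simp [h]) _ _

/-- Conditional mutual information as a relative entropy of two laws with the same marginal law of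
`(C, A)`. -/
lemma condMI_eq_klDiv (hA : Measurable A) (hB : Measurable B) (hC : Measurable C) :
    condMI μ A B C = klDiv (μ.map fun ω => ((C ω, A ω), B ω))
      ((μ.map fun ω => (C ω, A ω)) ⊗ₘ Kernel.prodMkRight α (condDistrib B C μ)) := by
  rw [← compProd_map_condDistrib hA.aemeasurable, ← compProd_prod_map_prodAssoc_symm]
  have h2 : μ.map (fun ω => ((C ω, A ω), B ω))
      = (μ.map fun ω => (C ω, (A ω, B ω))).map MeasurableEquiv.prodAssoc.symm := by
    rw [Measure.map_map (by fun_prop) (by fun_prop)]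
    rfl
  rw [h2, condMI]
  exact (klDiv_map_of_leftInverse (MeasurableEquiv.measurable _)
    (MeasurableEquiv.prodAssoc.measurable) (fun p => by simp) _ _).symm

lemma condDistrib_prodMk_ae_eq (hB : Measurable B) (hD : Measurable D) (hC : Measurable C) :
    condDistrib (fun ω => (D ω, B ω)) C μ =ᵐ[μ.map C]
      condDistrib D C μ ⊗ₖ condDistrib B (fun ω => (C ω, D ω)) μ := by
  refine condDistrib_ae_eq_of_measure_eq_compProd _ (by fun_prop) ?_
  rw [← Measure.compProd_assoc', compProd_map_condDistrib hD.aemeasurable,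
    compProd_map_condDistrib hB.aemeasurable, Measure.map_map (by fun_prop) (by fun_prop)]
  rfl

/-- Chain rule `I(A;D,B|C) = I(A;D|C) + I(A;B|C,D)`. -/
lemma condMI_prodMk (hA : Measurable A) (hB : Measurable B) (hD : Measurable D)
    (hC : Measurable C) :
    condMI μ A (fun ω => (D ω, B ω)) C =
      condMI μ A D C + condMI μ A B (fun ω => (C ω, D ω)) := by
  have hCD : Measurable fun ω => (C ω, D ω) := by fun_prop
  have hfst : (μ.map fun ω => (C ω, A ω)).map Prod.fst = μ.map C := by
    rw [Measure.map_map (by fun_prop) (by fun_prop)]; rfl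
  -- the kernel of `B` given `((C, A), D)` which ignores `A`
  let η : Kernel ((γ × α) × δ) β :=
    (condDistrib B (fun ω => (C ω, D ω)) μ).comap (fun p => (p.1.1, p.2)) (by fun_prop)
  have hk : Kernel.prodMkRight α (condDistrib (fun ω => (D ω, B ω)) C μ)
      =ᵐ[μ.map fun ω => (C ω, A ω)] Kernel.prodMkRight α (condDistrib D C μ) ⊗ₖ η := by
    have := condDistrib_prodMk_ae_eq (μ := μ) hB hD hC
    rw [← hfst] at this
    filter_upwards [ae_of_ae_map (by fun_prop) this] with p hp
    rw [Kernel.prodMkRight_apply, hp]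
    ext s hs
    rw [Kernel.compProd_apply hs, Kernel.compProd_apply hs]
    rfl
  rw [condMI_eq_klDiv hA (by fun_prop) hC, Measure.compProd_congr hk, ← Measure.compProd_assoc']
  have h1 : (μ.map fun ω => ((C ω, A ω), (D ω, B ω)))
      = (μ.map fun ω => (((C ω, A ω), D ω), B ω)).map MeasurableEquiv.prodAssoc := by
    rw [Measure.map_map (by fun_prop) (by fun_prop)]
    rfl
  rw [h1, klDiv_map_of_leftInverse (MeasurableEquiv.prodAssoc.measurable)
    (MeasurableEquiv.prodAssoc.symm.measurable) (fun p => by simp)]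
  rw [← compProd_map_condDistrib hB.aemeasurable, klDiv_compProd_eq_add,
    ← condMI_eq_klDiv hA hD hC]
  congr 1
  rw [compProd_map_condDistrib hB.aemeasurable, condMI_eq_klDiv hA hB hCD]
  let e : (γ × α) × δ → (γ × δ) × α := fun p => ((p.1.1, p.2), p.1.2)
  let e' : (γ × δ) × α → (γ × α) × δ := fun p => ((p.1.1, p.2), p.1.2)
  have he : Measurable e := by fun_prop
  have he' : Measurable e' := by fun_prop
  rw [← klDiv_map_of_leftInverse (f := fun p : ((γ × α) × δ) × β => (e p.1, p.2))
    (g := fun p => (e' p.1, p.2)) (by fun_prop) (by fun_prop) (fun p => rfl),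
    map_compProd_of_leftInverse he he' (fun p => rfl), Measure.map_map (by fun_prop) (by fun_prop),
    Measure.map_map (by fun_prop) (by fun_prop)]
  rfl

lemma condMI_comp_right_of_leftInverse {f : β → δ} {g : δ → β} (hf : Measurable f)
    (hg : Measurable g) (h : ∀ x, g (f x) = x) (hA : Measurable A) (hB : Measurable B)
    (hC : Measurable C) :
    condMI μ A (fun ω => f (B ω)) C = condMI μ A B C := by
  have hk : Kernel.prodMkRight α (condDistrib (fun ω => f (B ω)) C μ)
      =ᵐ[μ.map fun ω => (C ω, A ω)] (Kernel.prodMkRight α (condDistrib B C μ)).map f := by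
    have hfst : (μ.map fun ω => (C ω, A ω)).map Prod.fst = μ.map C := by
      rw [Measure.map_map (by fun_prop) (by fun_prop)]; rfl
    have : condDistrib (f ∘ B) C μ =ᵐ[μ.map C] (condDistrib B C μ).map f :=
      condDistrib_comp C hB.aemeasurable hf
    rw [← hfst] at this
    filter_upwards [ae_of_ae_map (by fun_prop) this] with p hp
    rw [Kernel.prodMkRight_apply, Kernel.map_apply _ hf, Kernel.prodMkRight_apply,
      ← Kernel.map_apply _ hf, ← hp]
    rfl
  rw [condMI_eq_klDiv hA (by fun_prop) hC, condMI_eq_klDiv hA hB hC, Measure.compProd_congr hk,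
    Measure.compProd_map hf]
  have h2 : μ.map (fun ω => ((C ω, A ω), f (B ω)))
      = (μ.map fun ω => ((C ω, A ω), B ω)).map (Prod.map id f) := by
    rw [Measure.map_map (by fun_prop) (by fun_prop)]
    rfl
  rw [h2]
  exact klDiv_map_of_leftInverse (f := Prod.map id f) (g := Prod.map id g) (by fun_prop)
    (by fun_prop)
    (fun p => Prod.ext rfl (h p.2)) _ _

/-- The two expansions of `I(A;B,D|C)` by the chain rule agree. -/
lemma condMI_add_condMI_comm (hA : Measurable A) (hB : Measurable B) (hD : Measurable D)
    (hC : Measurable C) :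
    condMI μ A D C + condMI μ A B (fun ω => (C ω, D ω)) =
      condMI μ A B C + condMI μ A D (fun ω => (C ω, B ω)) := by
  rw [← condMI_prodMk hA hB hD hC, ← condMI_prodMk hA hD hB hC]
  exact (condMI_comp_right_of_leftInverse (B := fun ω => (D ω, B ω)) measurable_swap
    measurable_swap (fun p => rfl) hA (by fun_prop) hC).symm

end CondMI

/-! ### Conditional entropy of a finite-valued random variable -/

section CondEntropy

open InformationTheory

/-- Conditional entropy (in nats) of a finite-valued random variable given a `σ`-algebra. -/
def condEntropy {Ω 𝒴 : Type*} [MeasurableSpace Ω] [Fintype 𝒴] (μ : Measure Ω) (Y : Ω → 𝒴)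
    (m : MeasurableSpace Ω) : ℝ :=
  ∫ ω, ∑ y, Real.negMulLog ((μ⟦Y ⁻¹' {y} | m⟧) ω) ∂μ

variable {Ω α 𝒴 γ : Type*} [MeasurableSpace Ω]
  [Fintype 𝒴] [MeasurableSpace 𝒴] [MeasurableSingletonClass 𝒴]
  [MeasurableSpace γ] {μ : Measure Ω} [IsFiniteMeasure μ] {Y : Ω → 𝒴} {C : Ω → γ}

/-- The logarithm is unbounded, but integrating it against the kernel first gives the terms -t log
t, which are at most 1. -/
lemma integrable_log_kernel_compProd (ν : Measure γ) [IsFiniteMeasure ν] (κ : Kernel γ 𝒴)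
    [IsMarkovKernel κ] :
    Integrable (fun p : γ × 𝒴 => Real.log ((κ p.1).real {p.2})) (ν ⊗ₘ κ) ∧
    ∫ p, Real.log ((κ p.1).real {p.2}) ∂(ν ⊗ₘ κ) =
      -∫ c, ∑ y, Real.negMulLog ((κ c).real {y}) ∂ν := by
  have hmy : ∀ y, Measurable fun c => (κ c).real {y} := fun y =>
    (Kernel.measurable_coe κ (measurableSet_singleton y)).ennreal_toReal
  have hm : Measurable fun p : γ × 𝒴 => Real.log ((κ p.1).real {p.2}) := by
    refine measurable_from_prod_countable_left fun y => ?_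
    exact Real.measurable_log.comp (hmy y)
  have h1 : ∀ c, ∫ y, ‖Real.log ((κ c).real {y})‖ ∂κ c
      = ∑ y, Real.negMulLog ((κ c).real {y}) := by
    intro c
    rw [integral_fintype .of_finite]
    refine Finset.sum_congr rfl fun y _ => ?_
    rw [Real.negMulLog, smul_eq_mul, Real.norm_of_nonpos
      (Real.log_nonpos measureReal_nonneg measureReal_le_one)]
    ring
  have h_int : Integrable (fun p : γ × 𝒴 => Real.log ((κ p.1).real {p.2})) (ν ⊗ₘ κ) := by
    rw [Measure.integrable_compProd_iff hm.aestronglyMeasurable]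
    refine ⟨.of_forall fun c => .of_finite, ?_⟩
    simp only [h1]
    refine integrable_finsetSum _ fun y _ => ?_
    refine Integrable.of_bound
      (Real.continuous_negMulLog.measurable.comp (hmy y)).aestronglyMeasurable 1
      (.of_forall fun c => ?_)
    rw [Real.norm_of_nonneg (Real.negMulLog_nonneg measureReal_nonneg measureReal_le_one)]
    exact (Real.negMulLog_le_one_sub_self measureReal_nonneg).trans
      (by linarith [measureReal_nonneg (μ := κ c) (s := {y})])
  refine ⟨h_int, ?_⟩
  rw [Measure.integral_compProd h_int, ← integral_neg]
  congr 1 with c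
  rw [integral_fintype .of_finite, ← Finset.sum_neg_distrib]
  exact Finset.sum_congr rfl fun y _ => by simp [Real.negMulLog]

variable [Nonempty 𝒴]

lemma condEntropy_comap_eq (hY : Measurable Y) (hC : Measurable C) :
    condEntropy μ Y (MeasurableSpace.comap C inferInstance) =
      ∫ ω, ∑ y, Real.negMulLog ((condDistrib Y C μ (C ω)).real {y}) ∂μ := by
  refine integral_congr_ae ?_
  have h : ∀ y, (fun a => (condDistrib Y C μ (C a)).real {y}) =ᵐ[μ] _ := fun y =>
    condDistrib_ae_eq_condExp (μ := μ) hC hY (measurableSet_singleton y)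
  filter_upwards [ae_all_iff.2 h] with ω hω
  simp [← hω]

lemma integral_log_condDistrib (hY : Measurable Y) (hC : Measurable C) :
    Integrable (fun ω => Real.log ((condDistrib Y C μ (C ω)).real {Y ω})) μ ∧
    ∫ ω, Real.log ((condDistrib Y C μ (C ω)).real {Y ω}) ∂μ =
      -condEntropy μ Y (MeasurableSpace.comap C inferInstance) := by
  have hmy : ∀ y, Measurable fun c => (condDistrib Y C μ c).real {y} := fun y =>
    (Kernel.measurable_coe _ (measurableSet_singleton y)).ennreal_toReal
  have hm : Measurable fun p : γ × 𝒴 => Real.log ((condDistrib Y C μ p.1).real {p.2}) := by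
    refine measurable_from_prod_countable_left fun y => ?_
    exact Real.measurable_log.comp (hmy y)
  obtain ⟨h1, h2⟩ := integrable_log_kernel_compProd (μ.map C) (condDistrib Y C μ)
  rw [compProd_map_condDistrib hY.aemeasurable] at h1 h2
  refine ⟨h1.comp_measurable (by fun_prop), ?_⟩
  rw [integral_map (by fun_prop) hm.aestronglyMeasurable] at h2
  rw [condEntropy_comap_eq hY hC, h2, integral_map hC.aemeasurable]
  refine Measurable.aestronglyMeasurable ?_
  exact Finset.measurable_sum _ fun y _ => Real.continuous_negMulLog.measurable.comp (hmy y)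

variable [MeasurableSpace α] [StandardBorelSpace α] [Nonempty α] {A : Ω → α}

/-- For finite-valued `Y`, `I(A;Y|C)` is finite and equals `H(Y|C) - H(Y|C,A)`. -/
lemma condMI_eq_condEntropy_sub (hA : Measurable A) (hY : Measurable Y) (hC : Measurable C) :
    condMI μ A Y C ≠ ⊤ ∧ (condMI μ A Y C).toReal =
      condEntropy μ Y (MeasurableSpace.comap C inferInstance) -
      condEntropy μ Y (MeasurableSpace.comap (fun ω => (C ω, A ω)) inferInstance) := by
  have hCA : Measurable fun ω => (C ω, A ω) := by fun_prop
  set κ := condDistrib Y C μ with hκ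
  set η := condDistrib Y (fun ω => (C ω, A ω)) μ with hη
  set ν := μ.map fun ω => (C ω, A ω) with hν
  set P := μ.map fun ω => ((C ω, A ω), Y ω) with hP
  have hPη : P = ν ⊗ₘ η := (compProd_map_condDistrib hY.aemeasurable).symm
  set Q := ν ⊗ₘ Kernel.prodMkRight α κ with hQ
  have hmκ : ∀ y, Measurable fun p : γ × α => κ p.1 {y} := fun y =>
    (Kernel.measurable_coe _ (measurableSet_singleton y)).comp measurable_fst
  have hmη : ∀ y, Measurable fun p : γ × α => η p {y} := fun y =>
    Kernel.measurable_coe _ (measurableSet_singleton y)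
  let ρ : (γ × α) × 𝒴 → ℝ≥0∞ := fun p => η p.1 {p.2} / κ p.1.1 {p.2}
  have hρ : Measurable ρ := by
    refine measurable_from_prod_countable_left fun y => ?_
    exact (hmη y).div (hmκ y)
  -- A letter of probability zero given `C` has probability zero given `(C, A)`. This makes `ρ` a
  -- density even though division by zero is allowed in it.
  have hzero : ∀ y, ∀ᵐ p ∂ν, κ p.1 {y} = 0 → η p {y} = 0 := by
    intro y
    let s : Set γ := {c | κ c {y} = 0}
    have hs : MeasurableSet s :=
      Kernel.measurable_coe κ (measurableSet_singleton y) (measurableSet_singleton 0)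
    have h0 : μ (C ⁻¹' s ∩ Y ⁻¹' {y}) = 0 := by
      rw [← setLIntegral_preimage_condDistrib hC hY.aemeasurable (measurableSet_singleton y) hs]
      rw [setLIntegral_congr_fun (g := fun _ => 0) (hC hs) (fun ω hω => hω)]
      simp
    have h1 : ∫⁻ p in Prod.fst ⁻¹' s, η p {y} ∂ν = 0 := by
      rw [hν, setLIntegral_map (measurable_fst hs) (hmη y) hCA, ← h0]
      exact setLIntegral_preimage_condDistrib hCA hY.aemeasurable (measurableSet_singleton y)
        (measurable_fst hs)
    rw [lintegral_eq_zero_iff (hmη y)] at h1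
    exact (ae_restrict_iff' (measurable_fst hs)).1 h1
  have hPQ : P = Q.withDensity ρ := by
    ext s hs
    rw [withDensity_apply _ hs, hPη, Measure.compProd_apply hs, ← lintegral_indicator hs,
      Measure.lintegral_compProd (hρ.indicator hs)]
    refine lintegral_congr_ae ?_
    filter_upwards [ae_all_iff.2 hzero] with p hp
    rw [lintegral_fintype, ← lintegral_indicator_one (hs.preimage measurable_prodMk_left),
      lintegral_fintype]
    refine Finset.sum_congr rfl fun y _ => ?_
    by_cases hy : (p, y) ∈ s
    · simp only [Set.indicator, Set.mem_preimage, hy, if_true, Pi.one_apply, one_mul, ρ,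
        Kernel.prodMkRight_apply]
      by_cases hk : κ p.1 {y} = 0
      · simp [hk, hp y hk]
      · rw [ENNReal.div_mul_cancel hk (measure_ne_top _ _)]
    · simp [Set.indicator, hy]
  have hac : P ≪ Q := hPQ ▸ withDensity_absolutelyContinuous _ _
  have hpos : ∀ᵐ p ∂P, η p.1 {p.2} ≠ 0 := by
    rw [hPη]
    have hm : Measurable fun p : (γ × α) × 𝒴 => η p.1 {p.2} :=
      measurable_from_prod_countable_left fun y => hmη y
    refine (Measure.ae_compProd_iff (p := fun p => η p.1 {p.2} ≠ 0)
      (hm (measurableSet_singleton 0).compl)).2 (.of_forall fun p => ?_)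
    rw [ae_iff_of_countable]
    intro y hy
    exact hy
  have hpos' : ∀ᵐ p ∂P, κ p.1.1 {p.2} ≠ 0 := by
    have : ∀ᵐ p ∂P, ∀ y, κ p.1.1 {y} = 0 → η p.1 {y} = 0 := by
      have h := ae_all_iff.2 hzero
      have hfst : ν = P.map Prod.fst := by
        rw [hP, Measure.map_map (by fun_prop) (by fun_prop)]; rfl
      rw [hfst] at h
      exact ae_of_ae_map (by fun_prop) h
    filter_upwards [this, hpos] with p h1 h2 h3 using h2 (h1 _ h3)
  -- Almost surely under `P` both probabilities of the observed letter are positive, so the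
  -- logarithm of the quotient splits into two terms that are separately integrable.
  have hllr : llr P Q =ᵐ[P] fun p =>
      Real.log ((η p.1).real {p.2}) - Real.log ((κ p.1.1).real {p.2}) := by
    have h := hac (Measure.rnDeriv_withDensity Q hρ)
    rw [← hPQ] at h
    filter_upwards [h, hpos, hpos'] with p h1 h2 h3
    rw [llr, h1, ENNReal.toReal_div, Real.log_div]
    · rfl
    · exact (ENNReal.toReal_pos h2 (measure_ne_top _ _)).ne'
    · exact (ENNReal.toReal_pos h3 (measure_ne_top _ _)).ne'
  have hmap : Measurable fun ω => ((C ω, A ω), Y ω) := by fun_prop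
  have hmr : Measurable fun p : (γ × α) × 𝒴 =>
      Real.log ((η p.1).real {p.2}) - Real.log ((κ p.1.1).real {p.2}) := by
    refine measurable_from_prod_countable_left fun y => ?_
    exact (Real.measurable_log.comp (hmη y).ennreal_toReal).sub
      (Real.measurable_log.comp (hmκ y).ennreal_toReal)
  obtain ⟨i1, e1⟩ := integral_log_condDistrib (μ := μ) hY hC
  obtain ⟨i2, e2⟩ := integral_log_condDistrib (μ := μ) hY hCA
  have h_int : Integrable (llr P Q) P := by
    rw [integrable_congr hllr, hP, integrable_map_measure hmr.aestronglyMeasurable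
      hmap.aemeasurable]
    exact i2.sub i1
  rw [condMI_eq_klDiv hA hY hC]
  refine ⟨klDiv_ne_top hac h_int, ?_⟩
  rw [toReal_klDiv_of_measure_eq hac, integral_congr_ae hllr, hP,
    integral_map hmap.aemeasurable hmr.aestronglyMeasurable]
  · change ∫ ω, (Real.log ((η (C ω, A ω)).real {Y ω}) - Real.log ((κ (C ω)).real {Y ω})) ∂μ = _
    rw [integral_sub i2 i1, e1, e2]
    ring
  · rw [hPη, Measure.compProd_apply_univ, Measure.compProd_apply_univ]

end CondEntropy

/-! ### The outer bound in terms of conditional entropies -/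

instance instFintypeLabel : Fintype Label :=
  ⟨{Label.t, Label.u, Label.v}, fun x => by cases x <;> simp⟩

/-- Which of `W₁`, `W₂` are observed. -/
inductive Side
  | one
  | two
  | both
  deriving DecidableEq

instance instFintypeSide : Fintype Side :=
  ⟨{Side.one, Side.two, Side.both}, fun x => by cases x <;> simp⟩

/-- The equations of the outer bound, for `H₁ A s = H(Y₁ | A, W_s)` and `H₂ A s = H(Y₂ | A, W_s)`,
where `c₀`, `c₁`, `c₂` are the values of `I(T;Y₁|W₁)`, `I(U;Y₁|W₁)`, `I(V;Y₂|W₂)`. -/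
structure EntropyEquations (H₁ H₂ : Finset Label → Side → ℝ) (c₀ c₁ c₂ : ℝ) : Prop where
  t_one : ∀ A, Label.t ∉ A → H₁ A .one - H₁ (insert Label.t A) .one = c₀
  t_two : ∀ A, Label.t ∉ A → H₂ A .two - H₂ (insert Label.t A) .two = c₀
  u_one : ∀ A, Label.u ∉ A → H₁ A .one - H₁ (insert Label.u A) .one = c₁
  v_two : ∀ A, Label.v ∉ A → H₂ A .two - H₂ (insert Label.v A) .two = c₂
  sides : ∀ A, H₁ A .one - H₁ A .both = H₂ A .two - H₂ A .both
  sub_sub : ∀ A B₁ B₂ : Finset Label,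
    B₁ ⊆ {Label.t, Label.u} → B₂ ⊆ {Label.t, Label.v} →
    (H₁ (A ∪ B₂) .both - H₁ (A ∪ B₂ ∪ B₁) .both) + (H₂ A .both - H₂ (A ∪ B₁) .both) =
    (H₂ (A ∪ B₂) .both - H₂ (A ∪ B₂ ∪ B₁) .both) + (H₁ A .both - H₁ (A ∪ B₁) .both)

/-! ### The σ-algebras of the views. -/

section SigmaAlgebras

variable {Ω : Type*} {T U V : Ω → ℝ}

/-- The `σ`-algebra generated by the variables named in `A`. -/
abbrev labelSigma (T U V : Ω → ℝ) (A : Finset Label) : MeasurableSpace Ω :=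
  ⨆ i ∈ A, MeasurableSpace.comap (family T U V i) inferInstance

/-- The `σ`-algebra generated by the variables named in `A` and the observed ones of `W₁`, `W₂`. -/
abbrev viewSigma (T U V W₁ W₂ : Ω → ℝ) (A : Finset Label) : Side → MeasurableSpace Ω
  | .one => labelSigma T U V A ⊔ MeasurableSpace.comap W₁ inferInstance
  | .two => labelSigma T U V A ⊔ MeasurableSpace.comap W₂ inferInstance
  | .both => labelSigma T U V A ⊔
      (MeasurableSpace.comap W₁ inferInstance ⊔ MeasurableSpace.comap W₂ inferInstance)

lemma comap_pair {α β : Type*} [MeasurableSpace α] [MeasurableSpace β] (f : Ω → α) (g : Ω → β) :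
    MeasurableSpace.comap (fun ω => (f ω, g ω)) inferInstance =
      MeasurableSpace.comap f inferInstance ⊔ MeasurableSpace.comap g inferInstance :=
  MeasurableSpace.comap_prodMk f g

lemma comap_sub (A : Finset Label) :
    MeasurableSpace.comap (sub T U V A) inferInstance = labelSigma T U V A := by
  rw [labelSigma, MeasurableSpace.pi, MeasurableSpace.comap_iSup, iSup_subtype]
  simp only [MeasurableSpace.comap_comp]
  rfl

lemma labelSigma_union (A B : Finset Label) :
    labelSigma T U V (A ∪ B) = labelSigma T U V A ⊔ labelSigma T U V B :=
  Finset.iSup_union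

lemma labelSigma_insert (i : Label) (A : Finset Label) :
    labelSigma T U V (insert i A) =
      MeasurableSpace.comap (family T U V i) inferInstance ⊔ labelSigma T U V A :=
  Finset.iSup_insert _ _ _

lemma labelSigma_empty : labelSigma T U V ∅ = ⊥ := by simp [labelSigma]

lemma comap_sub_pair (W₁ W₂ : Ω → ℝ) (A : Finset Label) :
    MeasurableSpace.comap (fun ω => (sub T U V A ω, W₁ ω, W₂ ω)) inferInstance =
      viewSigma T U V W₁ W₂ A .both := by
  rw [comap_pair, comap_pair, comap_sub]

end SigmaAlgebras

/-- Entropies depend on the conditioning variables only through the σ-algebra they generate. Stating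
this with arbitrary `m`, `m'` makes the order and nesting of the tuples irrelevant. -/
lemma condMI_toReal_eq {Ω α γ 𝒴 : Type*} {m m' : MeasurableSpace Ω} [MeasurableSpace Ω]
    {μ : Measure Ω} [IsFiniteMeasure μ] [Fintype 𝒴] [Nonempty 𝒴] [MeasurableSpace 𝒴]
    [MeasurableSingletonClass 𝒴] [MeasurableSpace α] [StandardBorelSpace α] [Nonempty α]
    [MeasurableSpace γ] {A : Ω → α} {Y : Ω → 𝒴} {C : Ω → γ} (hA : Measurable A)
    (hY : Measurable Y) (hC : Measurable C)
    (hm : MeasurableSpace.comap C inferInstance = m)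
    (hm' : MeasurableSpace.comap C inferInstance ⊔ MeasurableSpace.comap A inferInstance = m') :
    condMI μ A Y C ≠ ⊤ ∧ (condMI μ A Y C).toReal = condEntropy μ Y m - condEntropy μ Y m' := by
  obtain ⟨h1, h2⟩ := condMI_eq_condEntropy_sub (μ := μ) hA hY hC
  refine ⟨h1, ?_⟩
  rw [h2, hm, ← hm', ← comap_pair]

lemma measurable_sub {Ω : Type*} [MeasurableSpace Ω] {T U V : Ω → ℝ} (hT : Measurable T)
    (hU : Measurable U) (hV : Measurable V) (A : Finset Label) : Measurable (sub T U V A) := by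
  refine measurable_pi_lambda _ fun i => ?_
  rcases i with ⟨i, hi⟩
  cases i <;> assumption

section Family

variable {Ω 𝒴 : Type*} [MeasurableSpace Ω] {μ : Measure Ω} [IsFiniteMeasure μ] [Fintype 𝒴]
  [Nonempty 𝒴] [MeasurableSpace 𝒴] [MeasurableSingletonClass 𝒴] {T U V W : Ω → ℝ} {Y : Ω → 𝒴}
  {h : Finset Label → ℝ} {c : ℝ} {i : Label}

lemma measurable_family (hT : Measurable T) (hU : Measurable U) (hV : Measurable V) (i : Label) :
    Measurable (family T U V i) := by
  cases i <;> assumption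

lemma eq_ofReal_of_toReal_eq {x : ℝ≥0∞} {c : ℝ} (hx : x ≠ ⊤ ∧ x.toReal = c) :
    x = ENNReal.ofReal c := by
  rw [← hx.2, ENNReal.ofReal_toReal hx.1]

/-- The entropy drop caused by the variable `i` is the same for every `A` not containing it, so all
conditionings by other auxiliary variables give one value. The next three lemmas are the cases of
zero, one and two such variables. -/
lemma condMI_family_eq {γ : Type*} [MeasurableSpace γ] {C : Ω → γ} {A : Finset Label}
    (hF : ∀ i, Measurable (family T U V i)) (hY : Measurable Y) (hC : Measurable C)
    (hh : ∀ A, condEntropy μ Y (labelSigma T U V A ⊔ MeasurableSpace.comap W inferInstance) = h A)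
    (hc : ∀ A, i ∉ A → h A - h (insert i A) = c) (hi : i ∉ A)
    (hm : MeasurableSpace.comap C inferInstance =
      labelSigma T U V A ⊔ MeasurableSpace.comap W inferInstance) :
    condMI μ (family T U V i) Y C = ENNReal.ofReal c := by
  rw [← hc A hi, ← hh, ← hh]
  refine eq_ofReal_of_toReal_eq (condMI_toReal_eq (hF i) hY hC hm ?_)
  rw [hm, labelSigma_insert]
  ac_rfl

lemma condMI_family_eq₀ (hF : ∀ i, Measurable (family T U V i)) (hW : Measurable W)
    (hY : Measurable Y)
    (hh : ∀ A, condEntropy μ Y (labelSigma T U V A ⊔ MeasurableSpace.comap W inferInstance) = h A)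
    (hc : ∀ A, i ∉ A → h A - h (insert i A) = c) :
    condMI μ (family T U V i) Y W = ENNReal.ofReal c :=
  condMI_family_eq (A := ∅) hF hY hW hh hc (by simp) (by rw [labelSigma_empty, bot_sup_eq])

lemma condMI_family_eq₁ (hF : ∀ i, Measurable (family T U V i)) (hW : Measurable W)
    (hY : Measurable Y)
    (hh : ∀ A, condEntropy μ Y (labelSigma T U V A ⊔ MeasurableSpace.comap W inferInstance) = h A)
    (hc : ∀ A, i ∉ A → h A - h (insert i A) = c) (j : Label) (hij : i ≠ j) :
    condMI μ (family T U V i) Y (fun ω => (family T U V j ω, W ω)) = ENNReal.ofReal c :=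
  condMI_family_eq (A := {j}) hF hY ((hF j).prodMk hW) hh hc (by simpa using hij)
    (by rw [comap_pair, ← insert_empty_eq, labelSigma_insert, labelSigma_empty, sup_bot_eq])

lemma condMI_family_eq₂ (hF : ∀ i, Measurable (family T U V i)) (hW : Measurable W)
    (hY : Measurable Y)
    (hh : ∀ A, condEntropy μ Y (labelSigma T U V A ⊔ MeasurableSpace.comap W inferInstance) = h A)
    (hc : ∀ A, i ∉ A → h A - h (insert i A) = c) (j k : Label) (hij : i ≠ j) (hik : i ≠ k) :
    condMI μ (family T U V i) Y (fun ω => (family T U V j ω, family T U V k ω, W ω)) =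
      ENNReal.ofReal c :=
  condMI_family_eq (A := {j, k}) hF hY ((hF j).prodMk ((hF k).prodMk hW)) hh hc
    (by simp [hij, hik])
    (by rw [comap_pair, comap_pair, labelSigma_insert, ← insert_empty_eq, labelSigma_insert,
          labelSigma_empty, sup_bot_eq, sup_assoc])

end Family

/-! ### Conditioning on both `W₁` and `W₂`. -/

section BothSides

variable {Ω 𝒴 𝒴' : Type*} [MeasurableSpace Ω] {μ : Measure Ω} [IsFiniteMeasure μ]
  [Fintype 𝒴] [Nonempty 𝒴] [MeasurableSpace 𝒴] [MeasurableSingletonClass 𝒴]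
  [Fintype 𝒴'] [Nonempty 𝒴'] [MeasurableSpace 𝒴'] [MeasurableSingletonClass 𝒴']
  {T U V W₁ W₂ : Ω → ℝ} {Y : Ω → 𝒴} {Y' : Ω → 𝒴'} {h : Finset Label → ℝ}

lemma condMI_sub_toReal (hs : ∀ A, Measurable (sub T U V A)) (hW₁ : Measurable W₁)
    (hW₂ : Measurable W₂) (hY : Measurable Y)
    (hh : ∀ A, condEntropy μ Y (viewSigma T U V W₁ W₂ A .both) = h A) (A B : Finset Label) :
    condMI μ (sub T U V B) Y (fun ω => (sub T U V A ω, W₁ ω, W₂ ω)) ≠ ⊤ ∧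
      (condMI μ (sub T U V B) Y (fun ω => (sub T U V A ω, W₁ ω, W₂ ω))).toReal =
        h A - h (A ∪ B) := by
  rw [← hh, ← hh]
  refine condMI_toReal_eq (hs B) hY ((hs A).prodMk (hW₁.prodMk hW₂)) (comap_sub_pair _ _ A) ?_
  rw [comap_sub_pair, comap_sub]
  simp only [viewSigma, labelSigma_union]
  ac_rfl

lemma condMI_sub_prodMk_eq (hs : ∀ A, Measurable (sub T U V A)) (hW₁ : Measurable W₁)
    (hW₂ : Measurable W₂) (hY : Measurable Y) (A B B' : Finset Label) :
    condMI μ (sub T U V B) Y (fun ω => ((sub T U V A ω, W₁ ω, W₂ ω), sub T U V B' ω)) =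
      condMI μ (sub T U V B) Y (fun ω => (sub T U V (A ∪ B') ω, W₁ ω, W₂ ω)) := by
  rw [eq_ofReal_of_toReal_eq (condMI_sub_toReal hs hW₁ hW₂ hY (fun A => rfl) (A ∪ B') B)]
  refine eq_ofReal_of_toReal_eq (condMI_toReal_eq (hs B) hY
    (((hs A).prodMk (hW₁.prodMk hW₂)).prodMk (hs B')) ?_ ?_)
  all_goals
    rw [comap_pair (fun ω => (sub T U V A ω, W₁ ω, W₂ ω)), comap_sub_pair]
    simp only [viewSigma, labelSigma_union, comap_sub]
    ac_rfl

/-- The chain rule for `I(B;B',Y|A,W₁,W₂)`. -/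
lemma condMI_sub_chain (hs : ∀ A, Measurable (sub T U V A)) (hW₁ : Measurable W₁)
    (hW₂ : Measurable W₂) (hY : Measurable Y) (A B B' : Finset Label) :
    condMI μ (sub T U V B) Y (fun ω => (sub T U V A ω, W₁ ω, W₂ ω)) +
      condMI μ (sub T U V B) (sub T U V B') (fun ω => (sub T U V A ω, W₁ ω, W₂ ω, Y ω)) =
    condMI μ (sub T U V B) (sub T U V B') (fun ω => (sub T U V A ω, W₁ ω, W₂ ω)) +
      condMI μ (sub T U V B) Y (fun ω => (sub T U V (A ∪ B') ω, W₁ ω, W₂ ω)) := by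
  have hC : Measurable fun ω => (sub T U V A ω, W₁ ω, W₂ ω) := (hs A).prodMk (hW₁.prodMk hW₂)
  have r : condMI μ (sub T U V B) (sub T U V B') (fun ω => (sub T U V A ω, W₁ ω, W₂ ω, Y ω)) =
      condMI μ (sub T U V B) (sub T U V B') (fun ω => ((sub T U V A ω, W₁ ω, W₂ ω), Y ω)) :=
    condMI_comp_of_leftInverse (C := fun ω => ((sub T U V A ω, W₁ ω, W₂ ω), Y ω))
      (f := fun p => (p.1.1, p.1.2.1, p.1.2.2, p.2))
      (g := fun p => ((p.1, p.2.1, p.2.2.1), p.2.2.2)) (by fun_prop) (by fun_prop)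
      (fun _ => rfl) (hs _) (hs _) (hC.prodMk hY)
  rw [r, ← condMI_sub_prodMk_eq hs hW₁ hW₂ hY]
  exact condMI_add_condMI_comm (hs B) (hs B') hY hC

/-- The equality of the conditional mutual informations given `Y` and given `Y'` follows from the
equality of differences, also where they are infinite. -/
lemma condMI_sub_sub_eq (hs : ∀ A, Measurable (sub T U V A)) (hW₁ : Measurable W₁)
    (hW₂ : Measurable W₂) (hY : Measurable Y) (hY' : Measurable Y') (A B B' : Finset Label)
    (q : condMI μ (sub T U V B) Y (fun ω => (sub T U V (A ∪ B') ω, W₁ ω, W₂ ω)) +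
        condMI μ (sub T U V B) Y' (fun ω => (sub T U V A ω, W₁ ω, W₂ ω)) =
      condMI μ (sub T U V B) Y' (fun ω => (sub T U V (A ∪ B') ω, W₁ ω, W₂ ω)) +
        condMI μ (sub T U V B) Y (fun ω => (sub T U V A ω, W₁ ω, W₂ ω))) :
    condMI μ (sub T U V B) (sub T U V B') (fun ω => (sub T U V A ω, W₁ ω, W₂ ω, Y ω)) =
      condMI μ (sub T U V B) (sub T U V B') (fun ω => (sub T U V A ω, W₁ ω, W₂ ω, Y' ω)) := by
  have q1 := condMI_sub_chain (μ := μ) hs hW₁ hW₂ hY A B B'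
  have q2 := condMI_sub_chain (μ := μ) hs hW₁ hW₂ hY' A B B'
  have n1 := (condMI_sub_toReal (μ := μ) hs hW₁ hW₂ hY (fun A => rfl) A B).1
  have n2 := (condMI_sub_toReal (μ := μ) hs hW₁ hW₂ hY' (fun A => rfl) A B).1
  -- The finite sum I(B;Y|A,W₁,W₂) + I(B;Y'|A,W₁,W₂) is added to both sides and cancelled at the
  -- end. The term I(B;B'|A,W₁,W₂), possibly infinite, is never subtracted.
  refine (ENNReal.add_right_inj (ENNReal.add_ne_top.2 ⟨n1, n2⟩)).1 ?_
  rw [add_right_comm, q1, add_assoc, q, add_comm (condMI μ _ Y _) (condMI μ _ Y' _),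
    add_right_comm, q2]
  ac_rfl

end BothSides

section OuterBound

variable {𝒳 𝒴₁ 𝒴₂ : Type*}
  [MeasurableSpace 𝒳]
  [Fintype 𝒴₁] [Nonempty 𝒴₁] [MeasurableSpace 𝒴₁] [MeasurableSingletonClass 𝒴₁]
  [Fintype 𝒴₂] [Nonempty 𝒴₂] [MeasurableSpace 𝒴₂] [MeasurableSingletonClass 𝒴₂]

/-- If the conditional entropies of `Y₁` and `Y₂` satisfy the entropy equations, the random
variables are admissible and allow the rates `c₀`, `c₁`, `c₂`. -/
lemma admissible_of_entropyEquations {κ : Kernel 𝒳 (𝒴₁ × 𝒴₂)} {Ω : Type} [MeasurableSpace Ω]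
    {μ : Measure Ω} [IsProbabilityMeasure μ] {T U V W₁ W₂ : Ω → ℝ} {X : Ω → 𝒳} {Y₁ : Ω → 𝒴₁}
    {Y₂ : Ω → 𝒴₂} (hT : Measurable T) (hU : Measurable U) (hV : Measurable V)
    (hW₁ : Measurable W₁) (hW₂ : Measurable W₂) (hX : Measurable X) (hY₁ : Measurable Y₁)
    (hY₂ : Measurable Y₂)
    (hmarkov : μ.map (fun ω => (((T ω, U ω, V ω, W₁ ω, W₂ ω), X ω), (Y₁ ω, Y₂ ω))) =
      μ.map (fun ω => ((T ω, U ω, V ω, W₁ ω, W₂ ω), X ω)) ⊗ₘ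
        Kernel.prodMkLeft (ℝ × ℝ × ℝ × ℝ × ℝ) κ)
    (hindep : iIndepFun (family T U V) μ) {H₁ H₂ : Finset Label → Side → ℝ} {c₀ c₁ c₂ : ℝ}
    (hH₁ : ∀ A s, condEntropy μ Y₁ (viewSigma T U V W₁ W₂ A s) = H₁ A s)
    (hH₂ : ∀ A s, condEntropy μ Y₂ (viewSigma T U V W₁ W₂ A s) = H₂ A s)
    (h : EntropyEquations H₁ H₂ c₀ c₁ c₂) :
    Admissible κ μ T U V W₁ W₂ X Y₁ Y₂ ∧ ∀ R : ℝ × ℝ × ℝ, 0 ≤ R.1 → 0 ≤ R.2.1 → 0 ≤ R.2.2 →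
      R.1 ≤ c₀ → R.2.1 ≤ c₁ → R.2.2 ≤ c₂ → RateBounds μ T U V W₁ W₂ Y₁ Y₂ R := by
  have hF := measurable_family hT hU hV
  have hs := measurable_sub hT hU hV
  have both1 := condMI_sub_toReal (μ := μ) hs hW₁ hW₂ hY₁ (fun A => hH₁ A .both)
  have both2 := condMI_sub_toReal (μ := μ) hs hW₁ hW₂ hY₂ (fun A => hH₂ A .both)
  have hsub' : ∀ A B₁ B₂ : Finset Label,
      B₁ ⊆ {Label.t, Label.u} → B₂ ⊆ {Label.t, Label.v} →
      condMI μ (sub T U V B₁) Y₁ (fun ω => (sub T U V (A ∪ B₂) ω, W₁ ω, W₂ ω)) +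
        condMI μ (sub T U V B₁) Y₂ (fun ω => (sub T U V A ω, W₁ ω, W₂ ω)) =
      condMI μ (sub T U V B₁) Y₂ (fun ω => (sub T U V (A ∪ B₂) ω, W₁ ω, W₂ ω)) +
        condMI μ (sub T U V B₁) Y₁ (fun ω => (sub T U V A ω, W₁ ω, W₂ ω)) := by
    intro A B₁ B₂ h1 h2
    rw [← ENNReal.toReal_eq_toReal_iff'
      (ENNReal.add_ne_top.2 ⟨(both1 _ _).1, (both2 _ _).1⟩)
      (ENNReal.add_ne_top.2 ⟨(both2 _ _).1, (both1 _ _).1⟩),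
      ENNReal.toReal_add (both1 _ _).1 (both2 _ _).1,
      ENNReal.toReal_add (both2 _ _).1 (both1 _ _).1, (both1 _ _).2, (both1 _ _).2, (both2 _ _).2,
      (both2 _ _).2]
    exact h.sub_sub A B₁ B₂ h1 h2
  have hone := fun A => hH₁ A .one
  have htwo := fun A => hH₂ A .two
  have cT1 : condMI μ T Y₁ W₁ = _ := condMI_family_eq₀ hF hW₁ hY₁ hone h.t_one
  have cT2 : condMI μ T Y₂ W₂ = _ := condMI_family_eq₀ hF hW₂ hY₂ htwo h.t_two
  have cU1 : condMI μ U Y₁ W₁ = _ := condMI_family_eq₀ hF hW₁ hY₁ hone h.u_one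
  have cV2 : condMI μ V Y₂ W₂ = _ := condMI_family_eq₀ hF hW₂ hY₂ htwo h.v_two
  have T1 := condMI_family_eq₁ hF hW₁ hY₁ hone h.t_one
  have T2 := condMI_family_eq₁ hF hW₂ hY₂ htwo h.t_two
  have U1 := condMI_family_eq₁ hF hW₁ hY₁ hone h.u_one
  have V2 := condMI_family_eq₁ hF hW₂ hY₂ htwo h.v_two
  refine ⟨⟨hT, hU, hV, hW₁, hW₂, hX, hY₁, hY₂, hmarkov, hindep, cT1.trans cT2.symm,
    cT1.trans (T1 .v (by simp)).symm, cT1.trans (T1 .u (by simp)).symm,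
    cT1.trans (condMI_family_eq₂ hF hW₁ hY₁ hone h.t_one .u .v (by simp) (by simp)).symm,
    cT2.trans (T2 .v (by simp)).symm, cT2.trans (T2 .u (by simp)).symm,
    cT2.trans (condMI_family_eq₂ hF hW₂ hY₂ htwo h.t_two .u .v (by simp) (by simp)).symm,
    cU1.trans (U1 .v (by simp)).symm, cU1.trans (U1 .t (by simp)).symm,
    cU1.trans (condMI_family_eq₂ hF hW₁ hY₁ hone h.u_one .t .v (by simp) (by simp)).symm,
    cV2.trans (V2 .u (by simp)).symm, cV2.trans (V2 .t (by simp)).symm,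
    cV2.trans (condMI_family_eq₂ hF hW₂ hY₂ htwo h.v_two .t .u (by simp) (by simp)).symm,
    fun A B₁ B₂ h1 h2 => condMI_sub_sub_eq hs hW₁ hW₂ hY₁ hY₂ A B₁ B₂ (hsub' A B₁ B₂ h1 h2),
    hsub', ?_⟩, ?_⟩
  · intro A
    have w1 := condMI_toReal_eq (μ := μ) hW₂ hY₁ (C := fun ω => (sub T U V A ω, W₁ ω))
      (by fun_prop) (m := viewSigma T U V W₁ W₂ A .one) (m' := viewSigma T U V W₁ W₂ A .both)
      (by rw [comap_pair, comap_sub])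
      (by rw [comap_pair, comap_sub, sup_assoc])
    have w2 := condMI_toReal_eq (μ := μ) hW₁ hY₂ (C := fun ω => (sub T U V A ω, W₂ ω))
      (by fun_prop) (m := viewSigma T U V W₁ W₂ A .two) (m' := viewSigma T U V W₁ W₂ A .both)
      (by rw [comap_pair, comap_sub])
      (by
        rw [comap_pair, comap_sub, sup_assoc]
        exact congrArg _ (sup_comm _ _))
    rw [eq_ofReal_of_toReal_eq w1, eq_ofReal_of_toReal_eq w2, hH₁, hH₁, hH₂, hH₂, h.sides A]
  · intro R h0 h1 h2 hc0 hc1 hc2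
    refine ⟨h0, h1, h2, ?_, ?_, ?_⟩
    · rw [cT1, cT2, min_self]
      exact ENNReal.ofReal_le_ofReal hc0
    · rw [cU1]
      exact ENNReal.ofReal_le_ofReal hc1
    · rw [cV2]
      exact ENNReal.ofReal_le_ofReal hc2

end OuterBound

/-! ### Secret sharing by one-time pads

A family `e` of elements of a group `E`, one for every set of observed variables and an additional
one for the whole set, is distributed to `T`, `U`, `V`, `W₁`, `W₂` in such a way that the element
belonging to a set of variables can be computed from these variables, while any variables reveal
nothing about the elements which do not belong to subsets of them. -/

/-- Sets of observed variables: some of `T`, `U`, `V` and at least one of `W₁`, `W₂`. -/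
abbrev Idx := Finset Label × Side

/-- The set of variables to which a secret belongs; `none` is an additional secret which belongs
to all of them. -/
def owners (o : Option Idx) : Idx := o.getD (Finset.univ, .both)

/-- The secrets that can be computed from the variables in `S`. -/
def Visible (S : Idx) (o : Option Idx) : Prop :=
  (owners o).1 ⊆ S.1 ∧ ((owners o).2 = S.2 ∨ S.2 = .both)

section Pads

variable {E : Type*} [AddCommGroup E]

/-- The shares of `W₁`. -/
def share₁ (e : Option Idx → E) (p : Label → Option Idx → E) (r : Option Idx → E) :
    Option Idx → E := fun o =>
  if (owners o).2 = .two then 0 else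
    e o + ∑ i ∈ (owners o).1, p i o + if (owners o).2 = .both then r o else 0

/-- The shares of `W₂`. -/
def share₂ (e : Option Idx → E) (p : Label → Option Idx → E) (r : Option Idx → E) :
    Option Idx → E := fun o =>
  if (owners o).2 = .two then e o + ∑ i ∈ (owners o).1, p i o else r o

/-- What is seen by the variables in `S`. -/
def view (S : Idx) (e : Option Idx → E) (x : (Label → ℝ × (Option Idx → E)) × (Option Idx → E)) :
    (Label → ℝ) × (Option Idx → E) × (Option Idx → E) :=
  (fun i => if i ∈ S.1 then (x.1 i).1 else 0,
    if S.2 = .two then 0 else share₁ e (fun i => (x.1 i).2) x.2,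
    if S.2 = .one then 0 else share₂ e (fun i => (x.1 i).2) x.2)

/-- Families of secrets that agree on those visible to `S` lead to the same view up to a translation
of the pads which `S` does not know. -/
lemma exists_view_eq_view_add (S : Idx) (e e' : Option Idx → E)
    (h : ∀ o, Visible S o → e o = e' o) :
    ∃ (d : Label → Option Idx → E) (d' : Option Idx → E), (∀ i ∈ S.1, d i = 0) ∧
      ∀ x, view S e x = view S e' (fun i => ((x.1 i).1, (x.1 i).2 + d i), x.2 + d') := by
  classical
  have hex : ∀ o : Option Idx, ∃ i, ¬ (owners o).1 ⊆ S.1 → i ∈ (owners o).1 ∧ i ∉ S.1 := by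
    intro o
    by_cases ho : (owners o).1 ⊆ S.1
    · exact ⟨.t, fun hn => absurd ho hn⟩
    · obtain ⟨i, hi⟩ := Finset.not_subset.1 ho
      exact ⟨i, fun _ => hi⟩
  choose c hc using hex
  -- If some owner of the secret `o` is missing from `S`, the pad of one such owner absorbs the
  -- difference of the two secrets.
  let d : Label → Option Idx → E := fun i o =>
    if ¬ (owners o).1 ⊆ S.1 ∧ i = c o then e o - e' o else 0
  -- Among the invisible secrets whose labels all lie in `S`, only one kind affects the view: a
  -- secret split between `W₁` and `W₂` when `W₂` is unseen. Its mask `r` absorbs the difference. In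
  -- the other cases the share that is seen does not involve the secret.
  let d' : Option Idx → E := fun o =>
    if (owners o).1 ⊆ S.1 ∧ (owners o).2 = .both ∧ S.2 = .one then e o - e' o else 0
  have hsum : ∀ o, ∑ i ∈ (owners o).1, d i o =
      if (owners o).1 ⊆ S.1 then 0 else e o - e' o := by
    intro o
    by_cases ho : (owners o).1 ⊆ S.1
    · simp [d, ho]
    · simp [d, ho, (hc o ho).1]
  refine ⟨d, d', fun i hi => ?_, fun x => ?_⟩
  · funext o
    by_cases ho : (owners o).1 ⊆ S.1
    · simp [d, ho]
    · have : i ≠ c o := fun hic => (hc o ho).2 (hic ▸ hi)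
      simp [d, this]
  · have h1 : S.2 ≠ .two → ∀ o, share₁ e (fun i => (x.1 i).2) x.2 o =
        share₁ e' (fun i => (x.1 i).2 + d i) (x.2 + d') o := by
      intro hS o
      simp only [share₁, Pi.add_apply, Finset.sum_add_distrib, hsum]
      by_cases ho : (owners o).1 ⊆ S.1
      · rcases hs : (owners o).2 with _ | _ | _
        · rcases hS2 : S.2 with _ | _ | _
          · simp [ho, h o ⟨ho, .inl (hs.trans hS2.symm)⟩]
          · exact absurd hS2 hS
          · simp [ho, h o ⟨ho, .inr hS2⟩]
        · simp
        · rcases hS2 : S.2 with _ | _ | _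
          · simp only [ho, hs, hS2, d', if_true, and_self, reduceCtorEq, if_false]
            abel
          · exact absurd hS2 hS
          · simp [ho, hS2, d', h o ⟨ho, .inr hS2⟩]
      · rcases hs : (owners o).2 with _ | _ | _
        · simp only [ho, reduceCtorEq, if_false]; abel
        · simp
        · simp only [ho, d', reduceCtorEq, if_false, if_true, false_and]; abel
    have h2 : S.2 ≠ .one → ∀ o, share₂ e (fun i => (x.1 i).2) x.2 o =
        share₂ e' (fun i => (x.1 i).2 + d i) (x.2 + d') o := by
      intro hS o
      simp only [share₂, Pi.add_apply, Finset.sum_add_distrib, hsum]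
      have hd' : d' o = 0 := by simp [d', hS]
      by_cases ho : (owners o).1 ⊆ S.1
      · by_cases hs : (owners o).2 = .two
        · rcases hS2 : S.2 with _ | _ | _
          · exact absurd hS2 hS
          · simp [ho, hs, h o ⟨ho, .inl (hs.trans hS2.symm)⟩]
          · simp [ho, hs, h o ⟨ho, .inr hS2⟩]
        · simp [hs, hd']
      · by_cases hs : (owners o).2 = .two
        · simp only [ho, hs, if_false, if_true]; abel
        · simp [hs, hd']
    simp only [view]
    refine Prod.ext rfl (Prod.ext ?_ ?_)
    · by_cases hS : S.2 = .two
      · simp [hS]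
      · simpa only [hS, if_false] using funext (h1 hS)
    · by_cases hS : S.2 = .one
      · simp [hS]
      · simpa only [hS, if_false] using funext (h2 hS)

variable [MeasurableSpace E] [MeasurableAdd₂ E]

lemma measurable_view (S : Idx) : Measurable fun z : (Option Idx → E) ×
    ((Label → ℝ × (Option Idx → E)) × (Option Idx → E)) => view S z.1 z.2 := by
  refine Measurable.prodMk (measurable_pi_lambda _ fun i => ?_) (Measurable.prodMk ?_ ?_)
  · split_ifs <;> fun_prop
  · split_ifs
    · fun_prop
    · refine measurable_pi_lambda _ fun o => ?_
      simp only [share₁]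
      split_ifs <;> fun_prop
  · split_ifs
    · fun_prop
    · refine measurable_pi_lambda _ fun o => ?_
      simp only [share₂]
      split_ifs <;> fun_prop

/-- If the pads are independent and uniformly distributed, the law of the view of `S` depends only
on the secrets visible to `S`. -/
lemma map_view_eq (ν : Measure ℝ) [IsProbabilityMeasure ν] (m : Measure E)
    [IsProbabilityMeasure m] [m.IsAddLeftInvariant] {φ : ℝ → Option Idx → E} (hφ : Measurable φ)
    (hν : ν.map φ = Measure.pi fun _ => m) (S : Idx) (e e' : Option Idx → E)
    (h : ∀ o, Visible S o → e o = e' o) :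
    ((Measure.pi fun _ : Label => ν).prod (Measure.pi fun _ : Option Idx => m)).map
        (fun y => view S e (fun i => (y.1 i, φ (y.1 i)), y.2)) =
      ((Measure.pi fun _ : Label => ν).prod (Measure.pi fun _ : Option Idx => m)).map
        (fun y => view S e' (fun i => (y.1 i, φ (y.1 i)), y.2)) := by
  classical
  obtain ⟨d, d', hd, hview⟩ := exists_view_eq_view_add S e e' h
  set M := Measure.pi fun _ : Option Idx => m with hM
  -- The pad `φ t` is a function of `t`, so it can be shifted independently only after `t` itself
  -- has been erased. This is done exactly for the labels that `S` does not see, and for the others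
  -- `d i = 0`.
  let q : Label → ℝ → ℝ × (Option Idx → E) := fun i t => (if i ∈ S.1 then t else 0, φ t)
  have hq : ∀ i, Measurable (q i) := by
    intro i
    refine Measurable.prodMk ?_ hφ
    split_ifs <;> fun_prop
  let ρ : Label → Measure (ℝ × (Option Idx → E)) := fun i => ν.map (q i)
  have hρ : ∀ i, IsProbabilityMeasure (ρ i) := fun i =>
    Measure.isProbabilityMeasure_map (hq i).aemeasurable
  have hQ : MeasurePreserving (fun y : (Label → ℝ) × (Option Idx → E) =>
      ((fun i => q i (y.1 i)), y.2)) ((Measure.pi fun _ : Label => ν).prod M)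
      ((Measure.pi ρ).prod M) := by
    exact (measurePreserving_pi (fun _ => ν) ρ fun i => ⟨hq i, rfl⟩).prod (.id M)
  have hshift : ∀ i, MeasurePreserving
      (fun x : ℝ × (Option Idx → E) => (x.1, x.2 + d i)) (ρ i) (ρ i) := by
    intro i
    refine ⟨by fun_prop, ?_⟩
    by_cases hi : i ∈ S.1
    · simp [hd i hi]
    · have hρi : ρ i = M.map (fun g => ((0 : ℝ), g)) := by
        rw [← hν, Measure.map_map (by fun_prop) hφ]
        simp only [ρ, q, hi, if_false]
        rfl
      rw [hρi, Measure.map_map (by fun_prop) (by fun_prop)]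
      conv_rhs => rw [← map_add_right_eq_self M (d i), Measure.map_map (by fun_prop) (by fun_prop)]
      rfl
  have hS : MeasurePreserving (fun x : (Label → ℝ × (Option Idx → E)) × (Option Idx → E) =>
      ((fun i => ((x.1 i).1, (x.1 i).2 + d i)), x.2 + d')) ((Measure.pi ρ).prod M)
      ((Measure.pi ρ).prod M) :=
    (measurePreserving_pi ρ ρ hshift).prod (measurePreserving_add_right M d')
  have hvm : ∀ e : Option Idx → E, Measurable (view S e) := fun e =>
    (measurable_view S).comp measurable_prodMk_left
  have key : ∀ e : Option Idx → E,
      ((Measure.pi fun _ : Label => ν).prod M).map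
        (fun y => view S e (fun i => (y.1 i, φ (y.1 i)), y.2)) =
      ((Measure.pi ρ).prod M).map (view S e) := by
    intro e
    rw [← hQ.map_eq, Measure.map_map (hvm e) hQ.measurable]
    congr 1
    funext y
    simp only [view, Function.comp, q]
    congr 1
    funext i
    split_ifs <;> rfl
  rw [key, key]
  conv_rhs => rw [← hS.map_eq, Measure.map_map (hvm e') hS.measurable]
  congr 1
  funext x
  exact hview x

end Pads

/-! ### Profiles -/

section Profile

/-- The channel input together with, for each set `S` of observed variables, the conditional
probabilities of the output letters given these variables. -/
abbrev ProfileSpace (N a b : ℕ) := Fin N × (Idx → (Fin a ⊕ Fin b) → unitInterval)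

variable {N a b : ℕ} [NeZero N]

open Classical in
/-- Forget what is not determined by the variables in `S`. -/
def mask (S : Idx) (k : ProfileSpace N a b) : ProfileSpace N a b :=
  (if Visible S none then k.1 else 0, fun S' => if Visible S (some S') then k.2 S' else 0)

/-- Which coordinates are kept depends only on `S`, not on the point. Continuity makes the relations
of `IsProfile` stable under weak limits. -/
lemma continuous_mask (S : Idx) : Continuous (mask S : ProfileSpace N a b → _) := by
  unfold mask
  refine Continuous.prodMk ?_ (continuous_pi fun S' => ?_)
  · split_ifs <;> fun_prop
  · split_ifs <;> fun_prop

/-- `P` is a profile of the channel with output probabilities `q`: the coordinates of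
`ProfileSpace` are conditional probabilities of the output letters. -/
def IsProfile (q : Fin N → (Fin a ⊕ Fin b) → ℝ) (P : Measure (ProfileSpace N a b)) : Prop :=
  ∀ (S : Idx) (j : Fin a ⊕ Fin b) (g : BoundedContinuousFunction (ProfileSpace N a b) ℝ),
    ∫ k, q k.1 j * g (mask S k) ∂P = ∫ k, (k.2 S j : ℝ) * g (mask S k) ∂P

/-- Conditional entropy of the first output given the variables in `S`. -/
def profileEntropy₁ (P : Measure (ProfileSpace N a b)) (A : Finset Label) (s : Side) : ℝ :=
  ∫ k, ∑ y : Fin a, Real.negMulLog (k.2 (A, s) (Sum.inl y)) ∂P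

/-- Conditional entropy of the second output given the variables in `S`. -/
def profileEntropy₂ (P : Measure (ProfileSpace N a b)) (A : Finset Label) (s : Side) : ℝ :=
  ∫ k, ∑ y : Fin b, Real.negMulLog (k.2 (A, s) (Sum.inr y)) ∂P

/-- The two sides integrate against the images under `mask S` of two finite measures with densities
relative to `P`. They agree on bounded continuous functions, so the measures are equal, and
measurable test functions are allowed. -/
lemma IsProfile.integral_eq {q : Fin N → (Fin a ⊕ Fin b) → ℝ} {P : Measure (ProfileSpace N a b)}
    [IsProbabilityMeasure P] (h : IsProfile q P) (hq : ∀ x j, 0 ≤ q x j) (S : Idx)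
    (j : Fin a ⊕ Fin b) {L : ProfileSpace N a b → ℝ} (hL : Measurable L) :
    ∫ k, q k.1 j * L (mask S k) ∂P = ∫ k, (k.2 S j : ℝ) * L (mask S k) ∂P := by
  have hmask : Measurable (mask S : ProfileSpace N a b → _) := (continuous_mask S).measurable
  let f₁ : ProfileSpace N a b → NNReal := fun k => (q k.1 j).toNNReal
  let f₂ : ProfileSpace N a b → NNReal := fun k => (k.2 S j : ℝ).toNNReal
  have hm₁ : Measurable f₁ :=
    ((Measurable.of_discrete (f := fun x : Fin N => q x j)).comp measurable_fst).real_toNNReal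
  have hm₂ : Measurable f₂ := by
    refine Measurable.real_toNNReal ?_
    fun_prop
  have hv₁ : ∀ k, (f₁ k : ℝ) = q k.1 j := fun k => Real.coe_toNNReal _ (hq _ _)
  have hv₂ : ∀ k, (f₂ k : ℝ) = k.2 S j := fun k => Real.coe_toNNReal _ (k.2 S j).2.1
  have hfin₁ : IsFiniteMeasure (P.withDensity fun k => (f₁ k : ℝ≥0∞)) := by
    refine isFiniteMeasure_withDensity (ne_of_lt ?_)
    refine lt_of_le_of_lt (lintegral_mono (g := fun _ => ((∑ x, (q x j).toNNReal : NNReal) : ℝ≥0∞))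
      fun k => ?_) (by simp)
    exact ENNReal.coe_le_coe.2
      (Finset.single_le_sum (f := fun x => (q x j).toNNReal) (fun _ _ => zero_le)
        (Finset.mem_univ k.1))
  have hfin₂ : IsFiniteMeasure (P.withDensity fun k => (f₂ k : ℝ≥0∞)) := by
    refine isFiniteMeasure_withDensity (ne_of_lt ?_)
    refine lt_of_le_of_lt (lintegral_mono (g := fun _ => (1 : ℝ≥0∞)) fun k => ?_) (by simp)
    refine ENNReal.coe_le_one_iff.2 ?_
    exact Real.toNNReal_le_one.2 (k.2 S j).2.2
  have heq : (P.withDensity fun k => (f₁ k : ℝ≥0∞)).map (mask S) =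
      (P.withDensity fun k => (f₂ k : ℝ≥0∞)).map (mask S) := by
    refine ext_of_forall_integral_eq_of_IsFiniteMeasure fun g => ?_
    rw [integral_map hmask.aemeasurable g.continuous.aestronglyMeasurable,
      integral_map hmask.aemeasurable g.continuous.aestronglyMeasurable,
      integral_withDensity_eq_integral_smul hm₁, integral_withDensity_eq_integral_smul hm₂]
    simp only [NNReal.smul_def, hv₁, hv₂, smul_eq_mul]
    exact h S j g
  have h2 := congrArg (fun m => ∫ k, L k ∂m) heq
  rw [integral_map hmask.aemeasurable hL.aestronglyMeasurable,
      integral_map hmask.aemeasurable hL.aestronglyMeasurable,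
      integral_withDensity_eq_integral_smul hm₁, integral_withDensity_eq_integral_smul hm₂] at h2
  simpa only [NNReal.smul_def, hv₁, hv₂, smul_eq_mul] using h2

end Profile

/-! ### Realization of profiles by real-valued random variables -/

section Encoding

lemma not_countable_unitAddCircle : ¬ Countable (AddCircle (1 : ℝ)) := by
  intro h
  have := (AddCircle.equivIco (1 : ℝ) 0).symm.injective.countable
  have h1 : (Set.Ico (0 : ℝ) (0 + 1)).Countable := this
  have h2 := h1.measure_zero volume
  simp at h2

/-- Every standard Borel space can be encoded in the circle. -/
lemma exists_encoding (α : Type*) [MeasurableSpace α] [StandardBorelSpace α] [Nonempty α] :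
    ∃ (f : α → AddCircle (1 : ℝ)) (g : AddCircle (1 : ℝ) → α), Measurable f ∧ Measurable g ∧
      ∀ x, g (f x) = x := by
  let i : ℝ ≃ᵐ AddCircle (1 : ℝ) := PolishSpace.measurableEquivOfNotCountable
    (Set.not_countable_univ_iff.2 (by infer_instance) ∘ Set.countable_univ_iff.2)
    not_countable_unitAddCircle
  have h := measurableEmbedding_embeddingReal α
  refine ⟨fun x => i (embeddingReal α x), fun y => h.invFun (i.symm y),
    i.measurable.comp h.measurable, h.measurable_invFun.comp i.symm.measurable, fun x => ?_⟩
  simp [h.leftInverse_invFun x]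

/-- A measurable function of a uniformly distributed real number can have any law. -/
lemma exists_map_uniform_eq {α : Type*} [MeasurableSpace α] [StandardBorelSpace α] [Nonempty α]
    (m : Measure α) [IsProbabilityMeasure m] :
    ∃ φ : ℝ → α, Measurable φ ∧ (volume.restrict (Set.Icc (0 : ℝ) 1)).map φ = m := by
  obtain ⟨f, hf, hfm⟩ := m.exists_measurable_map_eq
  have hp : Measurable (Set.projIcc (0 : ℝ) 1 zero_le_one) := continuous_projIcc.measurable
  refine ⟨fun t => f (Set.projIcc 0 1 zero_le_one t), hf.comp hp, ?_⟩
  have h := unitInterval.measurePreserving_coe.map_eq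
  rw [← hfm]
  change (volume.restrict unitInterval).map _ = _
  have hg : Measurable fun t => f (Set.projIcc 0 1 zero_le_one t) := hf.comp hp
  rw [← h, Measure.map_map hg measurable_subtype_coe]
  congr 1
  funext t
  simp [Set.projIcc_val]

end Encoding

/-! ### Conditional probabilities given a view. -/

section Realization

lemma condEntropy_eq_of_setIntegral {Ω 𝒴 : Type*} {m mΩ : MeasurableSpace Ω} [Fintype 𝒴]
    [MeasurableSpace 𝒴] [MeasurableSingletonClass 𝒴] {μ : Measure Ω} [IsProbabilityMeasure μ]
    {Y : Ω → 𝒴} (hY : Measurable Y) (hm : m ≤ mΩ) {z : 𝒴 → Ω → ℝ}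
    (hz : ∀ y, Measurable[m] (z y)) (hz0 : ∀ y ω, 0 ≤ z y ω) (hz1 : ∀ y ω, z y ω ≤ 1)
    (h : ∀ y (s : Set Ω), MeasurableSet[m] s → ∫ ω in s, z y ω ∂μ = μ.real (s ∩ Y ⁻¹' {y})) :
    condEntropy μ Y m = ∫ ω, ∑ y, Real.negMulLog (z y ω) ∂μ := by
  have hae : ∀ y, z y =ᵐ[μ] μ⟦Y ⁻¹' {y} | m⟧ := by
    intro y
    have h_int : Integrable (z y) μ :=
      Integrable.of_bound ((hz y).mono hm le_rfl).aestronglyMeasurable 1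
        (.of_forall fun ω => by rw [Real.norm_of_nonneg (hz0 y ω)]; exact hz1 y ω)
    have hYy : MeasurableSet (Y ⁻¹' {y}) := hY (measurableSet_singleton y)
    refine ae_eq_condExp_of_forall_setIntegral_eq hm ((integrable_const _).indicator hYy)
      (fun s _ _ => h_int.integrableOn) (fun s hs _ => ?_)
      (hz y).stronglyMeasurable.aestronglyMeasurable
    rw [h y s hs, integral_indicator hYy, integral_const, measureReal_restrict_apply_univ,
      measureReal_def, measureReal_def, Measure.restrict_apply hYy, Set.inter_comm]
    simp
  refine integral_congr_ae ?_
  filter_upwards [ae_all_iff.2 hae] with ω hω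
  simp only [← hω]

lemma setIntegral_prod_fst {α β : Type*} [MeasurableSpace α] [MeasurableSpace β] (μ : Measure α)
    (ν : Measure β) [IsProbabilityMeasure μ] [IsProbabilityMeasure ν] {f : α → ℝ}
    (hf : Integrable f μ) {s : Set (α × β)} (hs : MeasurableSet s) :
    ∫ z in s, f z.1 ∂(μ.prod ν) = ∫ x, f x * ν.real (Prod.mk x ⁻¹' s) ∂μ := by
  rw [← integral_indicator hs, integral_prod _ ((hf.comp_fst ν).indicator hs)]
  congr 1 with x
  have : ∀ y, s.indicator (fun z : α × β => f z.1) (x, y) =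
      (Prod.mk x ⁻¹' s).indicator (fun _ => f x) y := fun y => rfl
  simp only [this]
  rw [integral_indicator_const _ (hs.preimage measurable_prodMk_left), smul_eq_mul, mul_comm]

variable {N a b : ℕ} [NeZero N]

/-- Given the profile point `k`, the probability that the view of `S` falls into `D` depends only on
`mask S k`, because the pads hide everything else. It is therefore an admissible test function for
the profile relation. -/
lemma IsProfile.setIntegral_view_eq {q : Fin N → (Fin a ⊕ Fin b) → ℝ}
    {P : Measure (ProfileSpace N a b)} [IsProbabilityMeasure P] (hP : IsProfile q P)
    (hq : ∀ x j, 0 ≤ q x j) {E : Type*} [AddCommGroup E] [MeasurableSpace E] [MeasurableAdd₂ E]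
    (ν : Measure ℝ) [IsProbabilityMeasure ν] (m : Measure E) [IsProbabilityMeasure m]
    [m.IsAddLeftInvariant] {φ : ℝ → Option Idx → E} (hφ : Measurable φ)
    (hν : ν.map φ = Measure.pi fun _ => m) {enc : ProfileSpace N a b → Option Idx → E}
    (henc : Measurable enc) (S : Idx)
    (hmask : ∀ k o, Visible S o → enc (mask S k) o = enc k o) (j : Fin a ⊕ Fin b)
    {D : Set ((Label → ℝ) × (Option Idx → E) × (Option Idx → E))} (hD : MeasurableSet D) :
    ∫ z in {z | view S (enc z.1) (fun i => (z.2.1 i, φ (z.2.1 i)), z.2.2) ∈ D}, q z.1.1 j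
      ∂(P.prod ((Measure.pi fun _ : Label => ν).prod (Measure.pi fun _ : Option Idx => m))) =
    ∫ z in {z | view S (enc z.1) (fun i => (z.2.1 i, φ (z.2.1 i)), z.2.2) ∈ D}, (z.1.2 S j : ℝ)
      ∂(P.prod ((Measure.pi fun _ : Label => ν).prod (Measure.pi fun _ : Option Idx => m))) := by
  set M := (Measure.pi fun _ : Label => ν).prod (Measure.pi fun _ : Option Idx => m) with hM
  have hv : Measurable fun z : ProfileSpace N a b × ((Label → ℝ) × (Option Idx → E)) =>
      view S (enc z.1) (fun i => (z.2.1 i, φ (z.2.1 i)), z.2.2) := by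
    refine (measurable_view S).comp (Measurable.prodMk (by fun_prop) (Measurable.prodMk ?_ ?_))
    · exact measurable_pi_lambda _ fun i => by fun_prop
    · fun_prop
  have hvk : ∀ k, Measurable fun y : (Label → ℝ) × (Option Idx → E) =>
      view S (enc k) (fun i => (y.1 i, φ (y.1 i)), y.2) := fun k => hv.comp measurable_prodMk_left
  have hT := hv hD
  let L : ProfileSpace N a b → ℝ := fun k =>
    M.real {y | view S (enc k) (fun i => (y.1 i, φ (y.1 i)), y.2) ∈ D}
  have hL : Measurable L := (measurable_measure_prodMk_left hT).ennreal_toReal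
  have hLmask : ∀ k, L (mask S k) = L k := by
    intro k
    have h := map_view_eq ν m hφ hν S (enc (mask S k)) (enc k) (fun o ho => hmask k o ho)
    have h2 := congrArg (fun μ => μ.real D) h
    rw [map_measureReal_apply (hvk _) hD, map_measureReal_apply (hvk _) hD] at h2
    exact h2
  have hq_int : Integrable (fun k : ProfileSpace N a b => q k.1 j) P := by
    refine Integrable.of_bound ((Measurable.of_discrete (f := fun x : Fin N => q x j)).comp
      measurable_fst).aestronglyMeasurable (∑ x, q x j) (.of_forall fun k => ?_)
    rw [Real.norm_of_nonneg (hq _ _)]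
    exact Finset.single_le_sum (f := fun x => q x j) (fun _ _ => hq _ _) (Finset.mem_univ _)
  have hz_int : Integrable (fun k : ProfileSpace N a b => (k.2 S j : ℝ)) P := by
    refine Integrable.of_bound (Measurable.aestronglyMeasurable (by fun_prop)) 1
      (.of_forall fun k => ?_)
    rw [Real.norm_of_nonneg (k.2 S j).2.1]
    exact (k.2 S j).2.2
  have h1 := setIntegral_prod_fst P M hq_int hT
  have h2 := setIntegral_prod_fst P M hz_int hT
  refine h1.trans (Eq.trans ?_ h2.symm)
  have h3 := hP.integral_eq hq S j hL
  simp only [hLmask] at h3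
  exact h3

end Realization

section Realization

variable {𝒳 𝒴₁ 𝒴₂ : Type*}
  [MeasurableSpace 𝒳]
  [Fintype 𝒴₁] [Nonempty 𝒴₁] [MeasurableSpace 𝒴₁] [MeasurableSingletonClass 𝒴₁]
  [Fintype 𝒴₂] [Nonempty 𝒴₂] [MeasurableSpace 𝒴₂] [MeasurableSingletonClass 𝒴₂]
  {N a b : ℕ} [NeZero N]

/-- The probabilities of the letters of both outputs, for numbered alphabets. -/
def outputProb (κ : Kernel 𝒳 (𝒴₁ × 𝒴₂)) (eX : Fin N ≃ 𝒳) (e₁ : Fin a ≃ 𝒴₁) (e₂ : Fin b ≃ 𝒴₂)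
    (x : Fin N) : (Fin a ⊕ Fin b) → ℝ
  | .inl y => (κ (eX x)).real {p | p.1 = e₁ y}
  | .inr y => (κ (eX x)).real {p | p.2 = e₂ y}

lemma condEntropy_equiv_comp {Ω 𝒴 𝒴' : Type*} {m mΩ : MeasurableSpace Ω} [Fintype 𝒴] [Fintype 𝒴']
    (μ : Measure Ω) (Y : Ω → 𝒴) (e : 𝒴 ≃ 𝒴') :
    condEntropy μ (fun ω => e (Y ω)) m = condEntropy μ Y m := by
  refine integral_congr_ae (.of_forall fun ω => ?_)
  simp only
  rw [← Equiv.sum_comp e]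
  refine Finset.sum_congr rfl fun y _ => ?_
  have : (fun ω => e (Y ω)) ⁻¹' {e y} = Y ⁻¹' {y} := by
    ext ω
    simp
  rw [this]

/-- A transition that depends on `x` only through `g x` remains a transition kernel after the rest
of `x` is forgotten. This yields the Markov chain through the channel input. -/
lemma map_compProd_prodMk {α β γ δ : Type*} [MeasurableSpace α] [MeasurableSpace β]
    [MeasurableSpace γ] [MeasurableSpace δ] (μ : Measure α) [SFinite μ] (κ : Kernel α β)
    [IsSFiniteKernel κ] (η : Kernel γ δ) [IsSFiniteKernel η] {g : α → γ} {h : β → δ}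
    (hg : Measurable g) (hh : Measurable h) (hη : ∀ x, (κ x).map h = η (g x)) :
    (μ ⊗ₘ κ).map (fun p => (g p.1, h p.2)) = μ.map g ⊗ₘ η := by
  ext s hs
  rw [Measure.map_apply (by fun_prop) hs, Measure.compProd_apply (hs.preimage (by fun_prop)),
    Measure.compProd_apply hs, lintegral_map (Kernel.measurable_kernel_prodMk_left hs) hg]
  refine lintegral_congr fun x => ?_
  rw [← hη, Measure.map_apply hh (hs.preimage measurable_prodMk_left)]
  rfl

/-- One pad for every secret. -/
abbrev PadSpace := Option Idx → AddCircle (1 : ℝ)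

/-- The sample space, without the outputs of the channel, on which a profile is realized. -/
abbrev RealizationSpace (N a b : ℕ) := ProfileSpace N a b × ((Label → ℝ) × PadSpace)

/-- A profile whose entropies satisfy the entropy equations is realized by admissible random
variables. -/
theorem mem_restrictedOuterRegion_of_isProfile (κ : Kernel 𝒳 (𝒴₁ × 𝒴₂)) [IsMarkovKernel κ]
    (eX : Fin N ≃ 𝒳) (e₁ : Fin a ≃ 𝒴₁) (e₂ : Fin b ≃ 𝒴₂) (P : Measure (ProfileSpace N a b))
    [IsProbabilityMeasure P] (hP : IsProfile (outputProb κ eX e₁ e₂) P) {c₀ c₁ c₂ : ℝ}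
    (hE : EntropyEquations (profileEntropy₁ P) (profileEntropy₂ P) c₀ c₁ c₂) (R : ℝ × ℝ × ℝ)
    (hR₀ : 0 ≤ R.1) (hR₁ : 0 ≤ R.2.1) (hR₂ : 0 ≤ R.2.2)
    (h₀ : R.1 ≤ c₀) (h₁ : R.2.1 ≤ c₁) (h₂ : R.2.2 ≤ c₂) :
    R ∈ restrictedOuterRegion κ := by
  classical
  let m : Measure (AddCircle (1 : ℝ)) := AddCircle.haarAddCircle
  let ν : Measure ℝ := volume.restrict (Set.Icc (0 : ℝ) 1)
  have hνp : IsProbabilityMeasure ν := ⟨by simp [ν]⟩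
  -- A single uniform number supplies independent Haar-distributed pads for all secrets at once.
  obtain ⟨φ, hφ, hνφ⟩ := exists_map_uniform_eq (Measure.pi fun _ : Option Idx => m)
  obtain ⟨encX, decX, hencX, hdecX, hX⟩ := exists_encoding (Fin N)
  obtain ⟨encZ, decZ, hencZ, hdecZ, hZ⟩ := exists_encoding ((Fin a ⊕ Fin b) → unitInterval)
  let enc : ProfileSpace N a b → PadSpace := fun k o => o.elim (encX k.1) (fun S => encZ (k.2 S))
  have henc : Measurable enc := by
    refine measurable_pi_lambda _ fun o => ?_
    rcases o with _ | S
    · exact hencX.comp measurable_fst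
    · exact hencZ.comp ((measurable_pi_apply S).comp measurable_snd)
  have hmask : ∀ S k o, Visible S o → enc (mask S k) o = enc k o := by
    intro S k o ho
    rcases o with _ | S' <;> simp [enc, mask, ho]
  let base : Measure (RealizationSpace N a b) :=
    P.prod ((Measure.pi fun _ : Label => ν).prod (Measure.pi fun _ : Option Idx => m))
  have hmp : IsProbabilityMeasure m :=
    inferInstanceAs (IsProbabilityMeasure AddCircle.haarAddCircle)
  have hbase : IsProbabilityMeasure base :=
    inferInstanceAs (IsProbabilityMeasure
      (P.prod ((Measure.pi fun _ : Label => ν).prod (Measure.pi fun _ : Option Idx => m))))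
  have hbase_fin : IsFiniteMeasure base := inferInstance
  have hbase_sigma : SigmaFinite base := inferInstance
  have hbase_sfin : SFinite base := inferInstance
  -- The outputs are drawn by the channel from the input coordinate alone, independently of pads and
  -- shares.
  let κ' : Kernel (RealizationSpace N a b) (Fin a × Fin b) :=
    (κ.map (Prod.map e₁.symm e₂.symm)).comap (fun z => eX z.1.1)
      (Measurable.of_discrete.comp (measurable_fst.comp measurable_fst))
  have hpm : Measurable (Prod.map e₁.symm e₂.symm) := Measurable.of_discrete
  have hκ' : IsMarkovKernel κ' := by
    have := Kernel.IsMarkovKernel.map κ hpm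
    infer_instance
  let μ : Measure (RealizationSpace N a b × (Fin a × Fin b)) := base ⊗ₘ κ'
  -- the random variables
  let F : Label → RealizationSpace N a b × (Fin a × Fin b) → ℝ := fun i ω => ω.1.2.1 i
  let pads : RealizationSpace N a b → Label → PadSpace := fun z i => φ (z.2.1 i)
  let V₁ : RealizationSpace N a b → PadSpace := fun z => share₁ (enc z.1) (pads z) z.2.2
  let V₂ : RealizationSpace N a b → PadSpace := fun z => share₂ (enc z.1) (pads z) z.2.2
  let emb : PadSpace → ℝ := embeddingReal PadSpace
  have hemb : MeasurableEmbedding emb := measurableEmbedding_embeddingReal PadSpace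
  let ν' : RealizationSpace N a b → (Label → ℝ × PadSpace) × PadSpace :=
    fun z => (fun i => (z.2.1 i, φ (z.2.1 i)), z.2.2)
  have hν' : Measurable ν' := by
    refine Measurable.prodMk (measurable_pi_lambda _ fun i => ?_) (by fun_prop)
    exact Measurable.prodMk (by fun_prop) (by fun_prop)
  have hview : ∀ S, Measurable fun z : RealizationSpace N a b => view S (enc z.1) (ν' z) := fun S =>
    (measurable_view S).comp (Measurable.prodMk (henc.comp measurable_fst) hν')
  have hV₁ : Measurable V₁ := (hview (∅, .one)).snd.fst
  have hV₂ : Measurable V₂ := (hview (∅, .two)).snd.snd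
  let W₁ : RealizationSpace N a b × (Fin a × Fin b) → ℝ := fun ω => emb (V₁ ω.1)
  let W₂ : RealizationSpace N a b × (Fin a × Fin b) → ℝ := fun ω => emb (V₂ ω.1)
  let X : RealizationSpace N a b × (Fin a × Fin b) → 𝒳 := fun ω => eX ω.1.1.1
  let Y₁ : RealizationSpace N a b × (Fin a × Fin b) → 𝒴₁ := fun ω => e₁ ω.2.1
  let Y₂ : RealizationSpace N a b × (Fin a × Fin b) → 𝒴₂ := fun ω => e₂ ω.2.2
  have hF : ∀ i, Measurable (F i) := fun i =>
    (measurable_pi_apply i).comp (measurable_fst.comp (measurable_snd.comp measurable_fst))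
  have hW₁ : Measurable W₁ := hemb.measurable.comp (hV₁.comp measurable_fst)
  have hW₂ : Measurable W₂ := hemb.measurable.comp (hV₂.comp measurable_fst)
  have hXm : Measurable X := Measurable.of_discrete.comp
    (measurable_fst.comp (measurable_fst.comp measurable_fst))
  have hY₁ : Measurable Y₁ := Measurable.of_discrete.comp (measurable_fst.comp measurable_snd)
  have hY₂ : Measurable Y₂ := Measurable.of_discrete.comp (measurable_snd.comp measurable_snd)
  have hfst : μ.map Prod.fst = base := Measure.fst_compProd base κ'
  have hmarkov : μ.map (fun ω => (((F .t ω, F .u ω, F .v ω, W₁ ω, W₂ ω), X ω), (Y₁ ω, Y₂ ω))) =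
      μ.map (fun ω => ((F .t ω, F .u ω, F .v ω, W₁ ω, W₂ ω), X ω)) ⊗ₘ
        Kernel.prodMkLeft (ℝ × ℝ × ℝ × ℝ × ℝ) κ := by
    let g : RealizationSpace N a b → (ℝ × ℝ × ℝ × ℝ × ℝ) × 𝒳 := fun z =>
      ((z.2.1 .t, z.2.1 .u, z.2.1 .v, emb (V₁ z), emb (V₂ z)), eX z.1.1)
    have hemb' := hemb.measurable
    have hg : Measurable g := by
      refine Measurable.prodMk ?_ (Measurable.of_discrete.comp (measurable_fst.comp measurable_fst))
      fun_prop
    have h1 : μ.map (fun ω => ((F .t ω, F .u ω, F .v ω, W₁ ω, W₂ ω), X ω)) = base.map g := by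
      rw [← hfst, Measure.map_map hg measurable_fst]
      rfl
    rw [h1]
    refine map_compProd_prodMk base κ' (Kernel.prodMkLeft (ℝ × ℝ × ℝ × ℝ × ℝ) κ) hg
      (h := Prod.map e₁ e₂) Measurable.of_discrete fun z => ?_
    rw [Kernel.prodMkLeft_apply, Kernel.comap_apply, Kernel.map_apply _ hpm,
      Measure.map_map Measurable.of_discrete hpm]
    convert Measure.map_id
    funext ⟨y, y'⟩
    simp
  have hlaw : μ.map (fun ω i => F i ω) = Measure.pi fun _ : Label => ν := by
    have h1 : μ.map (fun ω i => F i ω) = ((base.map Prod.snd).map Prod.fst) := by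
      rw [← hfst, Measure.map_map (by fun_prop) (by fun_prop),
        Measure.map_map (by fun_prop) (by fun_prop)]
      rfl
    rw [h1]
    have h2 : base.map Prod.snd = _ := Measure.snd_prod
    rw [h2]
    exact Measure.fst_prod
  have hlaw1 : ∀ i, μ.map (F i) = ν := by
    intro i
    have h1 : μ.map (F i) = (μ.map (fun ω i => F i ω)).map (Function.eval i) := by
      rw [Measure.map_map (by fun_prop) (measurable_pi_lambda _ hF)]
      rfl
    rw [h1, hlaw]
    exact (measurePreserving_eval (fun _ : Label => ν) i).map_eq
  have hfam : family (F .t) (F .u) (F .v) = F := by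
    funext i
    cases i <;> rfl
  have hindep : iIndepFun (family (F .t) (F .u) (F .v)) μ := by
    rw [hfam, iIndepFun_iff_map_fun_eq_pi_map fun i => (hF i).aemeasurable, hlaw]
    simp only [hlaw1]
  have hμp : IsProbabilityMeasure μ := inferInstanceAs (IsProbabilityMeasure (base ⊗ₘ κ'))
  -- The coordinate `S` of the profile point integrates over events of the view like a conditional
  -- probability of the output event `t`.
  have hcond : ∀ (S : Idx) (j : Fin a ⊕ Fin b) (t : Set (Fin a × Fin b)),
      (∀ z, (κ' z).real t = outputProb κ eX e₁ e₂ z.1.1 j) →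
      ∀ D, MeasurableSet D →
      ∫ ω in {ω | view S (enc ω.1.1) (ν' ω.1) ∈ D}, (ω.1.1.2 S j : ℝ) ∂μ =
        μ.real ({ω | view S (enc ω.1.1) (ν' ω.1) ∈ D} ∩ Prod.snd ⁻¹' t) := by
    intro S j t ht D hD
    have hq : ∀ x j, 0 ≤ outputProb κ eX e₁ e₂ x j := by
      rintro x (y | y) <;> exact measureReal_nonneg
    have h1 := hP.setIntegral_view_eq hq ν m hφ hνφ henc S (hmask S) j hD
    have hDm : MeasurableSet {z : RealizationSpace N a b | view S (enc z.1) (ν' z) ∈ D} :=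
      hview S hD
    have h2 : ∫ ω in {ω | view S (enc ω.1.1) (ν' ω.1) ∈ D}, (ω.1.1.2 S j : ℝ) ∂μ =
        ∫ z in {z : RealizationSpace N a b | view S (enc z.1) (ν' z) ∈ D},
          (z.1.2 S j : ℝ) ∂base := by
      rw [← hfst, setIntegral_map hDm _ measurable_fst.aemeasurable]
      · rfl
      · exact Measurable.aestronglyMeasurable (by fun_prop)
    rw [h2]
    refine h1.symm.trans ?_
    have h3 : {ω : RealizationSpace N a b × (Fin a × Fin b) | view S (enc ω.1.1) (ν' ω.1) ∈ D} ∩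
        Prod.snd ⁻¹' t =
        {z : RealizationSpace N a b | view S (enc z.1) (ν' z) ∈ D} ×ˢ t := rfl
    rw [h3, measureReal_def, Measure.compProd_apply_prod hDm (MeasurableSet.of_discrete),
      ← integral_toReal]
    · exact setIntegral_congr_fun hDm fun z _ => (ht z).symm
    · exact (Kernel.measurable_coe κ' MeasurableSet.of_discrete).aemeasurable
    · exact .of_forall fun z => measure_lt_top _ _
  -- With `hdec` below, this identifies the conditional probabilities: every event of the observed
  -- σ-algebra has the form `view ∈ D`, and the profile coordinate is measurable for that σ-algebra.
  -- The reverse inclusion is not required.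
  have hσ : ∀ A s, viewSigma (F .t) (F .u) (F .v) W₁ W₂ A s ≤
      MeasurableSpace.comap
        (fun ω : RealizationSpace N a b × (Fin a × Fin b) => view (A, s) (enc ω.1.1) (ν' ω.1))
        inferInstance := by
    intro A s
    have hlab : labelSigma (F .t) (F .u) (F .v) A ≤ MeasurableSpace.comap
        (fun ω : RealizationSpace N a b × (Fin a × Fin b) => view (A, s) (enc ω.1.1) (ν' ω.1))
          inferInstance := by
      refine iSup₂_le fun i hi => ?_
      rw [hfam, ← measurable_iff_comap_le]
      have : F i = (fun x : (Label → ℝ) × PadSpace × PadSpace => x.1 i) ∘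
          fun ω : RealizationSpace N a b × (Fin a × Fin b) => view (A, s) (enc ω.1.1) (ν' ω.1) := by
        funext ω
        simp [view, hi, F, ν']
      rw [this]
      exact Measurable.comp (by fun_prop) (comap_measurable _)
    have hone : s ≠ .two → MeasurableSpace.comap W₁ inferInstance ≤ MeasurableSpace.comap
        (fun ω : RealizationSpace N a b × (Fin a × Fin b) => view (A, s) (enc ω.1.1) (ν' ω.1))
          inferInstance := by
      intro hs
      rw [← measurable_iff_comap_le]
      have : W₁ = (fun x : (Label → ℝ) × PadSpace × PadSpace => emb x.2.1) ∘
          fun ω : RealizationSpace N a b × (Fin a × Fin b) => view (A, s) (enc ω.1.1) (ν' ω.1) := by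
        funext ω
        simp [view, hs, W₁, V₁, ν', pads]
      rw [this]
      exact Measurable.comp (hemb.measurable.comp (by fun_prop)) (comap_measurable _)
    have htwo : s ≠ .one → MeasurableSpace.comap W₂ inferInstance ≤ MeasurableSpace.comap
        (fun ω : RealizationSpace N a b × (Fin a × Fin b) => view (A, s) (enc ω.1.1) (ν' ω.1))
          inferInstance := by
      intro hs
      rw [← measurable_iff_comap_le]
      have : W₂ = (fun x : (Label → ℝ) × PadSpace × PadSpace => emb x.2.2) ∘
          fun ω : RealizationSpace N a b × (Fin a × Fin b) => view (A, s) (enc ω.1.1) (ν' ω.1) := by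
        funext ω
        simp [view, hs, W₂, V₂, ν', pads]
      rw [this]
      exact Measurable.comp (hemb.measurable.comp (by fun_prop)) (comap_measurable _)
    rcases s with _ | _ | _
    · exact sup_le hlab (hone (by simp))
    · exact sup_le hlab (htwo (by simp))
    · exact sup_le hlab (sup_le (hone (by simp)) (htwo (by simp)))
  -- The owners of a secret subtract their pads from the share in `W₁` or `W₂`. If both sides are
  -- owners, the mask stored in `W₂` is subtracted as well.
  have hdec : ∀ A s, Measurable[viewSigma (F .t) (F .u) (F .v) W₁ W₂ A s]
      fun ω : RealizationSpace N a b × (Fin a × Fin b) => ω.1.1.2 (A, s) := by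
    intro A s
    have hFA : ∀ i ∈ A, labelSigma (F .t) (F .u) (F .v) A ≤
        viewSigma (F .t) (F .u) (F .v) W₁ W₂ A s →
        Measurable[viewSigma (F .t) (F .u) (F .v) W₁ W₂ A s]
        fun ω : RealizationSpace N a b × (Fin a × Fin b) => φ (F i ω) (some (A, s)) := by
      intro i hi hle
      refine ((measurable_pi_apply _).comp hφ).comp (measurable_iff_comap_le.2 ?_)
      refine le_trans ?_ hle
      rw [labelSigma, hfam]
      exact le_iSup₂_of_le i hi le_rfl
    have hinv : ∀ (W : RealizationSpace N a b × (Fin a × Fin b) → ℝ)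
        (U : RealizationSpace N a b → PadSpace), (∀ ω, W ω = emb (U ω.1)) →
        MeasurableSpace.comap W inferInstance ≤ viewSigma (F .t) (F .u) (F .v) W₁ W₂ A s →
        Measurable[viewSigma (F .t) (F .u) (F .v) W₁ W₂ A s]
        fun ω : RealizationSpace N a b × (Fin a × Fin b) => U ω.1 (some (A, s)) := by
      intro W U hWU hle
      have : (fun ω : RealizationSpace N a b × (Fin a × Fin b) => U ω.1 (some (A, s))) =
          (fun x => hemb.invFun x (some (A, s))) ∘ W := by
        funext ω
        simp [hWU, hemb.leftInverse_invFun (U ω.1)]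
      rw [this]
      exact ((measurable_pi_apply _).comp hemb.measurable_invFun).comp
        (measurable_iff_comap_le.2 hle)
    have hdecode : ∀ (f : RealizationSpace N a b × (Fin a × Fin b) → AddCircle (1 : ℝ)),
        (∀ ω, f ω = encZ (ω.1.1.2 (A, s))) →
        Measurable[viewSigma (F .t) (F .u) (F .v) W₁ W₂ A s] f →
        Measurable[viewSigma (F .t) (F .u) (F .v) W₁ W₂ A s]
          fun ω : RealizationSpace N a b × (Fin a × Fin b) => ω.1.1.2 (A, s) := by
      intro f hf hfm
      have : (fun ω : RealizationSpace N a b × (Fin a × Fin b) => ω.1.1.2 (A, s)) = decZ ∘ f := by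
        funext ω
        simp [hf, hZ]
      rw [this]
      exact hdecZ.comp hfm
    rcases s with _ | _ | _
    · refine hdecode (fun ω => V₁ ω.1 (some (A, .one)) - ∑ i ∈ A, φ (F i ω) (some (A, .one)))
        (fun ω => ?_) ?_
      · simp [V₁, share₁, owners, pads, F, enc]
      · exact (hinv W₁ V₁ (fun _ => rfl) le_sup_right).sub
          (Finset.measurable_fun_sum _ fun i hi => hFA i hi le_sup_left)
    · refine hdecode (fun ω => V₂ ω.1 (some (A, .two)) - ∑ i ∈ A, φ (F i ω) (some (A, .two)))
        (fun ω => ?_) ?_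
      · simp [V₂, share₂, owners, pads, F, enc]
      · exact (hinv W₂ V₂ (fun _ => rfl) le_sup_right).sub
          (Finset.measurable_fun_sum _ fun i hi => hFA i hi le_sup_left)
    · refine hdecode (fun ω => V₁ ω.1 (some (A, .both)) - ∑ i ∈ A, φ (F i ω) (some (A, .both)) -
        V₂ ω.1 (some (A, .both))) (fun ω => ?_) ?_
      · simp [V₁, V₂, share₁, share₂, owners, pads, F, enc]
        abel
      · exact ((hinv W₁ V₁ (fun _ => rfl) (le_sup_of_le_right le_sup_left)).sub
          (Finset.measurable_fun_sum _ fun i hi => hFA i hi le_sup_left)).sub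
          (hinv W₂ V₂ (fun _ => rfl) (le_sup_of_le_right le_sup_right))
  have hle : ∀ A s, viewSigma (F .t) (F .u) (F .v) W₁ W₂ A s ≤
      (inferInstance : MeasurableSpace (RealizationSpace N a b × (Fin a × Fin b))) := fun A s =>
    (hσ A s).trans ((hview (A, s)).comp measurable_fst).comap_le
  have hκt : ∀ (z : RealizationSpace N a b) (t : Set (Fin a × Fin b)),
      (κ' z).real t = (κ (eX z.1.1)).real (Prod.map e₁.symm e₂.symm ⁻¹' t) := by
    intro z t
    simp only [κ', Kernel.comap_apply, Kernel.map_apply _ hpm]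
    exact map_measureReal_apply hpm MeasurableSet.of_discrete
  have hPfst : μ.map (fun ω => ω.1.1) = P := by
    have h1 : base.map Prod.fst = P := Measure.fst_prod
    rw [← h1, ← hfst, Measure.map_map measurable_fst measurable_fst]
    rfl
  have hentropy : ∀ {𝒴 : Type} [Fintype 𝒴] [MeasurableSpace 𝒴] [MeasurableSingletonClass 𝒴]
      (g : 𝒴 → Fin a ⊕ Fin b) (Y : Fin a × Fin b → 𝒴),
      (∀ y x, (κ (eX x)).real (Prod.map e₁.symm e₂.symm ⁻¹' (Y ⁻¹' {y})) =
        outputProb κ eX e₁ e₂ x (g y)) →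
      ∀ A s, condEntropy μ (fun ω => Y ω.2) (viewSigma (F .t) (F .u) (F .v) W₁ W₂ A s) =
        ∫ k, ∑ y, Real.negMulLog (k.2 (A, s) (g y)) ∂P := by
    intro 𝒴 _ _ _ g Y hY A s
    have hYm : Measurable fun ω : RealizationSpace N a b × (Fin a × Fin b) => Y ω.2 :=
      Measurable.of_discrete.comp measurable_snd
    rw [condEntropy_eq_of_setIntegral (z := fun y ω => (ω.1.1.2 (A, s) (g y) : ℝ))
      hYm (hle A s)]
    · rw [← hPfst, integral_map (by fun_prop)]
      refine Measurable.aestronglyMeasurable ?_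
      exact Finset.measurable_fun_sum _ fun y _ =>
        Real.continuous_negMulLog.measurable.comp (by fun_prop)
    · intro y
      exact measurable_subtype_coe.comp ((measurable_pi_apply (g y)).comp (hdec A s))
    · exact fun y ω => (ω.1.1.2 (A, s) (g y)).2.1
    · exact fun y ω => (ω.1.1.2 (A, s) (g y)).2.2
    · intro y t ht
      obtain ⟨D, hD, rfl⟩ := hσ A s t ht
      exact hcond (A, s) (g y) (Y ⁻¹' {y}) (fun z => (hκt z _).trans (hY y z.1.1)) D hD
  have hH₁ : ∀ A s, condEntropy μ Y₁ (viewSigma (F .t) (F .u) (F .v) W₁ W₂ A s) =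
      profileEntropy₁ P A s := by
    intro A s
    refine (condEntropy_equiv_comp μ _ e₁).trans
      (hentropy Sum.inl (fun p => p.1) (fun y x => ?_) A s)
    simp only [outputProb]
    congr 1
    ext p
    simp [Equiv.symm_apply_eq]
  have hH₂ : ∀ A s, condEntropy μ Y₂ (viewSigma (F .t) (F .u) (F .v) W₁ W₂ A s) =
      profileEntropy₂ P A s := by
    intro A s
    refine (condEntropy_equiv_comp μ _ e₂).trans
      (hentropy Sum.inr (fun p => p.2) (fun y x => ?_) A s)
    simp only [outputProb]
    congr 1
    ext p
    simp [Equiv.symm_apply_eq]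
  obtain ⟨hadm, hrate⟩ := admissible_of_entropyEquations (κ := κ) (hF .t) (hF .u) (hF .v) hW₁ hW₂
    hXm hY₁ hY₂ hmarkov hindep hH₁ hH₂ hE
  have hinv := hemb.measurable_invFun
  refine ⟨RealizationSpace N a b × (Fin a × Fin b), inferInstance, μ, hμp, F .t, F .u, F .v, W₁, W₂,
    X, Y₁, Y₂, hadm, hrate R hR₀ hR₁ hR₂ h₀ h₁ h₂, hlaw1 _, hlaw1 _, hlaw1 _,
    -- The secret `none` is the encoded input. All of T, U, V, W₁, W₂ are needed to remove its pads
    -- and its mask.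
    fun p => eX (decX (hemb.invFun p.2.2.2.1 none -
      (φ p.1 none + (φ p.2.1 none + φ p.2.2.1 none)) - hemb.invFun p.2.2.2.2 none)),
    Measurable.of_discrete.comp (hdecX.comp ?_), fun ω => ?_⟩
  · have hφn : Measurable fun t => φ t none := (measurable_pi_apply none).comp hφ
    have hin : Measurable fun t => hemb.invFun t none := (measurable_pi_apply none).comp hinv
    fun_prop
  · have hsum : ∀ f : Label → AddCircle (1 : ℝ), ∑ i, f i = f .t + (f .u + f .v) := by
      intro f
      change ∑ i ∈ {Label.t, Label.u, Label.v}, f i = _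
      simp
    have hsecret : V₁ ω.1 none - (φ (F .t ω) none + (φ (F .u ω) none + φ (F .v ω) none)) -
        V₂ ω.1 none = encX ω.1.1.1 := by
      simp only [V₁, V₂, share₁, share₂, owners, pads, F, enc, Option.getD_none, hsum,
        Option.elim_none, reduceCtorEq, if_false, if_true]
      abel
    simp only [W₁, W₂, X, hemb.leftInverse_invFun (V₁ ω.1), hemb.leftInverse_invFun (V₂ ω.1),
      hsecret, hX]

end Realization

/-! ### Entropies on a finite probability space -/

section FiniteEntropy

open Classical in
/-- On a finite set with weights `w`, the weight of the points which agree with `ω` in the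
coordinates in `S`. -/
def agreeMass {Ω I α : Type*} [Fintype Ω] (w : Ω → ℝ) (c : Ω → I → α) (S : Set I) (ω : Ω) : ℝ :=
  ∑ ω' with (∀ i ∈ S, c ω' i = c ω i), w ω'

/-- The joint entropy of the coordinates in `S`. -/
def jointEntropy {Ω I α : Type*} [Fintype Ω] (w : Ω → ℝ) (c : Ω → I → α) (S : Set I) : ℝ :=
  ∑ ω, w ω * -Real.log (agreeMass w c S ω)

open Classical in
/-- The conditional probability of `f = b` given the coordinates in `S`. -/
def condProb {Ω I α β : Type*} [Fintype Ω] (w : Ω → ℝ) (c : Ω → I → α) (S : Set I) (f : Ω → β)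
    (b : β) (ω : Ω) : ℝ :=
  (∑ ω' with (∀ i ∈ S, c ω' i = c ω i), if f ω' = b then w ω' else 0) / agreeMass w c S ω

variable {Ω I α β : Type*} [Fintype Ω] {w : Ω → ℝ} {c : Ω → I → α} {S S' : Set I}

lemma agreeMass_congr {ω ω' : Ω} (h : ∀ i ∈ S, c ω' i = c ω i) :
    agreeMass w c S ω' = agreeMass w c S ω := by
  unfold agreeMass
  congr 1
  ext ω''
  simp only [Finset.mem_filter, Finset.mem_univ, true_and]
  exact ⟨fun h' i hi => (h' i hi).trans (h i hi), fun h' i hi => (h' i hi).trans (h i hi).symm⟩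

lemma condProb_congr {f : Ω → β} {b : β} {ω ω' : Ω} (h : ∀ i ∈ S, c ω' i = c ω i) :
    condProb w c S f b ω' = condProb w c S f b ω := by
  unfold condProb
  rw [agreeMass_congr h]
  congr 2
  ext ω''
  simp only [Finset.mem_filter, Finset.mem_univ, true_and]
  exact ⟨fun h' i hi => (h' i hi).trans (h i hi), fun h' i hi => (h' i hi).trans (h i hi).symm⟩

lemma le_agreeMass (hw : ∀ ω, 0 ≤ w ω) (ω : Ω) : w ω ≤ agreeMass w c S ω :=
  Finset.single_le_sum (f := w) (fun ω _ => hw ω) (by simp)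

lemma agreeMass_nonneg (hw : ∀ ω, 0 ≤ w ω) (ω : Ω) : 0 ≤ agreeMass w c S ω :=
  (hw ω).trans (le_agreeMass hw ω)

lemma agreeMass_pos (hw : ∀ ω, 0 ≤ w ω) {ω : Ω} (h : w ω ≠ 0) : 0 < agreeMass w c S ω :=
  ((hw ω).lt_of_ne' h).trans_le (le_agreeMass hw ω)

lemma agreeMass_anti (hw : ∀ ω, 0 ≤ w ω) (h : S ⊆ S') (ω : Ω) :
    agreeMass w c S' ω ≤ agreeMass w c S ω := by
  refine Finset.sum_le_sum_of_subset_of_nonneg (fun ω' h' => ?_) fun _ _ _ => hw _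
  simp only [Finset.mem_filter, Finset.mem_univ, true_and] at h' ⊢
  exact fun i hi => h' i (h hi)

lemma jointEntropy_mono (hw : ∀ ω, 0 ≤ w ω) (h : S ⊆ S') :
    jointEntropy w c S ≤ jointEntropy w c S' := by
  refine Finset.sum_le_sum fun ω _ => ?_
  by_cases hω : w ω = 0
  · simp [hω]
  · have := Real.log_le_log (agreeMass_pos hw hω) (agreeMass_anti (w := w) (c := c) hw h ω)
    exact mul_le_mul_of_nonneg_left (neg_le_neg this) (hw ω)

lemma condProb_nonneg (hw : ∀ ω, 0 ≤ w ω) (f : Ω → β) (b : β) (ω : Ω) :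
    0 ≤ condProb w c S f b ω := by
  refine div_nonneg (Finset.sum_nonneg fun ω' _ => ?_) (agreeMass_nonneg hw ω)
  split_ifs
  exacts [hw _, le_rfl]

lemma condProb_le_one (hw : ∀ ω, 0 ≤ w ω) (f : Ω → β) (b : β) (ω : Ω) :
    condProb w c S f b ω ≤ 1 := by
  refine div_le_one_of_le₀ (Finset.sum_le_sum fun ω' _ => ?_) (agreeMass_nonneg hw ω)
  split_ifs
  exacts [le_rfl, hw _]

lemma sum_condProb (hw : ∀ ω, 0 ≤ w ω) [Fintype β] (f : Ω → β) {ω : Ω} (h : w ω ≠ 0) :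
    ∑ b, condProb w c S f b ω = 1 := by
  classical
  unfold condProb
  rw [← Finset.sum_div, Finset.sum_comm]
  have : ∀ ω' : Ω, ∑ b, (if f ω' = b then w ω' else 0) = w ω' := fun ω' => by simp
  simp only [this]
  exact div_self (agreeMass_pos hw h).ne'

open Classical in
/-- Averaging a function of the coordinates in `S` over the event `f = b`. -/
lemma sum_indicator_mul_eq (hw : ∀ ω, 0 ≤ w ω) (f : Ω → β) (b : β) {G : Ω → ℝ}
    (hG : ∀ ω ω', (∀ i ∈ S, c ω' i = c ω i) → G ω' = G ω) :
    ∑ ω, w ω * ((if f ω = b then 1 else 0) * G ω) = ∑ ω, w ω * (condProb w c S f b ω * G ω) := by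
  -- The conditional probability is expanded into a double sum over pairs that agree on `S`.
  -- Exchanging the summations lets the normalising mass cancel.
  have h1 : ∀ ω, w ω * (condProb w c S f b ω * G ω) =
      ∑ ω', if (∀ i ∈ S, c ω' i = c ω i) then
        (w ω' * (if f ω' = b then 1 else 0) * G ω') * (w ω / agreeMass w c S ω') else 0 := by
    intro ω
    unfold condProb
    conv_rhs => rw [← Finset.sum_filter]
    rw [Finset.sum_div, Finset.sum_mul, Finset.mul_sum]
    refine Finset.sum_congr rfl fun ω' h' => ?_
    simp only [Finset.mem_filter, Finset.mem_univ, true_and] at h'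
    rw [agreeMass_congr h', hG ω ω' h']
    split_ifs <;> ring
  simp only [h1]
  rw [Finset.sum_comm]
  refine Finset.sum_congr rfl fun ω' _ => ?_
  rw [← Finset.sum_filter, ← Finset.mul_sum, ← Finset.sum_div]
  have h2 : ∑ ω with (∀ i ∈ S, c ω' i = c ω i), w ω = agreeMass w c S ω' := by
    unfold agreeMass
    congr 1
    ext ω
    simp only [Finset.mem_filter, Finset.mem_univ, true_and, eq_comm]
  rw [h2]
  by_cases hω : w ω' = 0
  · simp [hω]
  · rw [div_self (agreeMass_pos hw hω).ne']
    ring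

/-- Chain rule: the increase of the joint entropy when the coordinates in `L`, which are equivalent
to `f`, are adjoined. -/
lemma jointEntropy_union_sub (hw : ∀ ω, 0 ≤ w ω) [Fintype β] {L : Set I} (f : Ω → β)
    (hL : ∀ ω ω', (∀ i ∈ L, c ω' i = c ω i) ↔ f ω' = f ω) :
    jointEntropy w c (S ∪ L) - jointEntropy w c S =
      ∑ ω, w ω * ∑ b, Real.negMulLog (condProb w c S f b ω) := by
  classical
  have hmass : ∀ ω, condProb w c S f (f ω) ω = agreeMass w c (S ∪ L) ω / agreeMass w c S ω := by
    intro ω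
    unfold condProb
    congr 1
    rw [← Finset.sum_filter, Finset.filter_filter, agreeMass]
    congr 1
    ext ω'
    simp only [Finset.mem_filter, Finset.mem_univ, true_and, ← hL, Set.mem_union, or_imp,
      forall_and]
  have h1 : jointEntropy w c (S ∪ L) - jointEntropy w c S =
      ∑ ω, w ω * ∑ b, (if f ω = b then 1 else 0) * -Real.log (condProb w c S f b ω) := by
    rw [jointEntropy, jointEntropy, ← Finset.sum_sub_distrib]
    refine Finset.sum_congr rfl fun ω _ => ?_
    by_cases hω : w ω = 0
    · simp [hω]
    · simp only [ite_mul, one_mul, zero_mul, Finset.sum_ite_eq, Finset.mem_univ, if_true, hmass]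
      rw [Real.log_div (agreeMass_pos hw hω).ne' (agreeMass_pos hw hω).ne']
      ring
  rw [h1]
  simp only [Finset.mul_sum]
  rw [Finset.sum_comm]
  conv_rhs => rw [Finset.sum_comm]
  refine Finset.sum_congr rfl fun b _ => ?_
  rw [sum_indicator_mul_eq hw f b (G := fun ω => -Real.log (condProb w c S f b ω))
    fun ω ω' h => by rw [condProb_congr h]]
  refine Finset.sum_congr rfl fun ω _ => ?_
  rw [Real.negMulLog]
  ring

/-- Gibbs' inequality. -/
lemma sum_negMulLog_le [Fintype β] {p q : β → ℝ} (hp : ∀ b, 0 ≤ p b) (hp1 : ∑ b, p b = 1)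
    (hq : ∀ b, 0 < q b) (hq1 : ∑ b, q b ≤ 1) :
    ∑ b, Real.negMulLog (p b) ≤ ∑ b, p b * -Real.log (q b) := by
  have h : ∀ b, Real.negMulLog (p b) - p b * -Real.log (q b) ≤ q b - p b := by
    intro b
    rcases (hp b).eq_or_lt with h0 | h0
    · simp [← h0, (hq b).le]
    · have h1 := Real.log_le_sub_one_of_pos (div_pos (hq b) h0)
      rw [Real.log_div (hq b).ne' h0.ne'] at h1
      have h2 := mul_le_mul_of_nonneg_left h1 h0.le
      rw [Real.negMulLog]
      have h3 : p b * (q b / p b - 1) = q b - p b := by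
        field_simp
      linarith
  have := Finset.sum_le_sum fun b (_ : b ∈ Finset.univ) => h b
  rw [Finset.sum_sub_distrib, Finset.sum_sub_distrib] at this
  linarith

/-- Gibbs' inequality against the uniform distribution. -/
lemma jointEntropy_union_sub_le_log_card (hw : ∀ ω, 0 ≤ w ω) (hw1 : ∑ ω, w ω = 1)
    [Fintype β] [Nonempty β] {L : Set I} (f : Ω → β)
    (hL : ∀ ω ω', (∀ i ∈ L, c ω' i = c ω i) ↔ f ω' = f ω) :
    jointEntropy w c (S ∪ L) - jointEntropy w c S ≤ Real.log (Fintype.card β) := by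
  have hn : (0 : ℝ) < Fintype.card β := by exact_mod_cast Fintype.card_pos
  rw [jointEntropy_union_sub hw f hL]
  calc _ ≤ ∑ ω, w ω * Real.log (Fintype.card β) := by
        refine Finset.sum_le_sum fun ω _ => ?_
        by_cases hω : w ω = 0
        · simp [hω]
        refine mul_le_mul_of_nonneg_left ?_ (hw ω)
        refine (sum_negMulLog_le (q := fun _ => (Fintype.card β : ℝ)⁻¹)
          (fun b => condProb_nonneg hw f b ω) (sum_condProb hw f hω) (fun _ => inv_pos.2 hn)
          ?_).trans ?_
        · simp [hn.ne']
        · rw [← Finset.sum_mul, sum_condProb hw f hω]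
          simp
    _ = _ := by rw [← Finset.sum_mul, hw1, one_mul]

open Classical in
/-- **Fano's inequality**: if `d`, a function of the coordinates in `S`, differs from `f` with
probability at most `ε`, the conditional entropy of `f` is at most `log 2 + ε log |β|`. -/
lemma jointEntropy_union_sub_le_fano (hw : ∀ ω, 0 ≤ w ω) (hw1 : ∑ ω, w ω = 1)
    [Fintype β] [Nonempty β] {L : Set I} (f d : Ω → β)
    (hL : ∀ ω ω', (∀ i ∈ L, c ω' i = c ω i) ↔ f ω' = f ω)
    (hd : ∀ ω ω', (∀ i ∈ S, c ω' i = c ω i) → d ω' = d ω) {ε : ℝ}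
    (hε : ∑ ω, (if f ω = d ω then 0 else w ω) ≤ ε) :
    jointEntropy w c (S ∪ L) - jointEntropy w c S ≤
      Real.log 2 + ε * Real.log (Fintype.card β) := by
  obtain ⟨n, hn_def⟩ : ∃ n : ℝ, n = Fintype.card β := ⟨_, rfl⟩
  rw [← hn_def]
  have hn1 : (1 : ℝ) ≤ n := by
    rw [hn_def, Nat.one_le_cast]
    exact Fintype.card_pos
  have hn : 0 < n := by linarith
  have hlogn : 0 ≤ Real.log n := Real.log_nonneg hn1
  -- The comparison distribution in Gibbs' inequality is half a point mass at the guess and half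
  -- uniform. It costs at most log 2 where the guess is right and log 2 + log n where it is wrong.
  let q : Ω → β → ℝ := fun ω b => (if b = d ω then 1 / 2 else 0) + 1 / (2 * n)
  have hq : ∀ ω b, 0 < q ω b := by
    intro ω b
    have : 0 < 1 / (2 * n) := by positivity
    simp only [q]
    split_ifs <;> linarith
  have hlog : ∀ ω b, -Real.log (q ω b) ≤ Real.log 2 + (if b = d ω then 0 else 1) * Real.log n := by
    intro ω b
    have hpos : 0 < 1 / (2 * n) := by positivity
    by_cases hb : b = d ω
    · have : Real.log (1 / 2) ≤ Real.log (q ω b) := by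
        refine Real.log_le_log (by norm_num) ?_
        simp only [q, hb, if_true]
        linarith
      rw [one_div, Real.log_inv] at this
      simp only [hb, if_true, zero_mul, add_zero]
      rw [hb] at this
      linarith
    · simp only [q, hb, if_false, zero_add, one_mul, one_div]
      rw [Real.log_inv, neg_neg, Real.log_mul (by norm_num) hn.ne']
  rw [jointEntropy_union_sub hw f hL]
  have hbound : ∀ ω, w ω * ∑ b, Real.negMulLog (condProb w c S f b ω) ≤
      w ω * Real.log 2 + (∑ b, w ω * (condProb w c S f b ω * if b = d ω then 0 else 1)) *
        Real.log n := by
    intro ω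
    by_cases hω : w ω = 0
    · simp [hω]
    have h1 := sum_negMulLog_le (fun b => condProb_nonneg (c := c) (S := S) hw f b ω)
      (sum_condProb hw f hω) (hq ω) (by
        simp only [q, Finset.sum_add_distrib, Finset.sum_ite_eq', Finset.mem_univ, if_true,
          Finset.sum_const, Finset.card_univ, nsmul_eq_mul, ← hn_def]
        rw [mul_one_div, mul_comm 2 n, ← div_div, div_self hn.ne']
        norm_num)
    have h2 : ∑ b, condProb w c S f b ω * -Real.log (q ω b) ≤
        ∑ b, condProb w c S f b ω * (Real.log 2 + (if b = d ω then 0 else 1) * Real.log n) :=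
      Finset.sum_le_sum fun b _ =>
        mul_le_mul_of_nonneg_left (hlog ω b) (condProb_nonneg hw f b ω)
    have h3 : ∑ b, condProb w c S f b ω * (Real.log 2 + (if b = d ω then 0 else 1) * Real.log n) =
        Real.log 2 + (∑ b, condProb w c S f b ω * if b = d ω then 0 else 1) * Real.log n := by
      simp only [mul_add, Finset.sum_add_distrib, ← Finset.sum_mul, sum_condProb hw f hω, one_mul,
        ← mul_assoc]
    calc _ ≤ w ω * (Real.log 2 +
          (∑ b, condProb w c S f b ω * if b = d ω then 0 else 1) * Real.log n) :=
          mul_le_mul_of_nonneg_left (h1.trans (h2.trans h3.le)) (hw ω)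
      _ = _ := by rw [← Finset.mul_sum]; ring
  -- The guess is a function of the coordinates in `S`, so the conditional probability of `f = b`
  -- may be replaced by its indicator.
  have herr : ∑ ω, ∑ b, w ω * (condProb w c S f b ω * if b = d ω then 0 else 1) =
      ∑ ω, (if f ω = d ω then 0 else w ω) := by
    rw [Finset.sum_comm]
    have : ∀ b, ∑ ω, w ω * (condProb w c S f b ω * if b = d ω then 0 else 1) =
        ∑ ω, w ω * ((if f ω = b then 1 else 0) * if b = d ω then 0 else 1) := fun b =>
      (sum_indicator_mul_eq hw f b (G := fun ω => if b = d ω then 0 else 1)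
        fun ω ω' h => by rw [hd ω ω' h]).symm
    simp only [this]
    rw [Finset.sum_comm]
    refine Finset.sum_congr rfl fun ω _ => ?_
    rw [Finset.sum_eq_single (f ω) (fun b _ hb => by simp [hb.symm]) (by simp)]
    simp
  calc _ ≤ ∑ ω, (w ω * Real.log 2 +
        (∑ b, w ω * (condProb w c S f b ω * if b = d ω then 0 else 1)) * Real.log n) :=
        Finset.sum_le_sum fun ω _ => hbound ω
    _ = Real.log 2 + (∑ ω, (if f ω = d ω then 0 else w ω)) * Real.log n := by
        rw [Finset.sum_add_distrib, ← Finset.sum_mul, ← Finset.sum_mul, hw1, one_mul, herr]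
    _ ≤ _ := by gcongr

end FiniteEntropy

/-! ### The law of a random variable on a finite weighted set -/

/-- The law of `f` on a finite set with weights `w`. -/
def finiteLaw {Ω E : Type*} [Fintype Ω] [MeasurableSpace E] (w : Ω → ℝ) (f : Ω → E) : Measure E :=
  ∑ ω, ENNReal.ofReal (w ω) • Measure.dirac (f ω)

lemma integral_finiteLaw {Ω E : Type*} [Fintype Ω] [MeasurableSpace E] [MeasurableSingletonClass E]
    {w : Ω → ℝ} (hw : ∀ ω, 0 ≤ w ω) (f : Ω → E) (g : E → ℝ) :
    ∫ e, g e ∂finiteLaw w f = ∑ ω, w ω * g (f ω) := by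
  unfold finiteLaw
  rw [integral_finsetSum_measure fun ω _ =>
    (integrable_dirac (by simp)).smul_measure ENNReal.ofReal_ne_top]
  refine Finset.sum_congr rfl fun ω _ => ?_
  rw [integral_smul_measure, integral_dirac, ENNReal.toReal_ofReal (hw ω), smul_eq_mul]

lemma isProbabilityMeasure_finiteLaw {Ω E : Type*} [Fintype Ω] [MeasurableSpace E]
    {w : Ω → ℝ} (hw : ∀ ω, 0 ≤ w ω) (hw1 : ∑ ω, w ω = 1) (f : Ω → E) :
    IsProbabilityMeasure (finiteLaw w f) := by
  refine ⟨?_⟩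
  simp only [finiteLaw, Measure.coe_finsetSum, Finset.sum_apply, Measure.smul_apply,
    measure_univ, smul_eq_mul, mul_one]
  rw [← ENNReal.ofReal_sum_of_nonneg fun ω _ => hw ω, hw1, ENNReal.ofReal_one]

/-! ### Product distributions -/

/-- Under a product distribution, the coordinate `y i` is independent of the other coordinates. -/
lemma sum_prod_mul_eq {ι B : Type*} [Fintype ι] [DecidableEq ι] [Fintype B] {q : ι → B → ℝ} (i : ι)
    (hq : ∑ b, q i b = 1) (φ : B → ℝ) {F : (ι → B) → ℝ}
    (hF : ∀ y b, F (Function.update y i b) = F y) :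
    ∑ y : ι → B, (∏ j, q j (y j)) * (φ (y i) * F y) =
      (∑ b, q i b * φ b) * ∑ y : ι → B, (∏ j, q j (y j)) * F y := by
  have hprod : ∀ y : ι → B, ∏ j, q j (y j) = q i (y i) * ∏ j ∈ {i}ᶜ, q j (y j) := fun y =>
    Fintype.prod_eq_mul_prod_compl i fun j => q j (y j)
  have hcompl : ∀ (y : ι → B) (b : B),
      ∏ j ∈ {i}ᶜ, q j (Function.update y i b j) = ∏ j ∈ {i}ᶜ, q j (y j) := fun y b =>
    Finset.prod_congr rfl fun j hj => by
      rw [Function.update_of_ne (by simpa using hj)]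
  -- The second component is an independent copy of `y i`. Exchanging it with `y i` preserves the
  -- total weight and leaves `F` unchanged.
  let σ : (ι → B) × B → (ι → B) × B := fun p => (Function.update p.1 i p.2, p.1 i)
  have hσ : Function.Involutive σ := fun p => by simp [σ]
  calc _ = ∑ p : (ι → B) × B, ((∏ j, q j (p.1 j)) * (φ (p.1 i) * F p.1)) * q i p.2 := by
        rw [Fintype.sum_prod_type]
        refine Finset.sum_congr rfl fun y _ => ?_
        simp only
        rw [← Finset.mul_sum, hq, mul_one]
    _ = ∑ p : (ι → B) × B, (q i p.2 * φ p.2) * ((∏ j, q j (p.1 j)) * F p.1) := by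
        rw [← Equiv.sum_comp hσ.toPerm]
        refine Finset.sum_congr rfl fun p _ => ?_
        simp only [Function.Involutive.coe_toPerm, σ, hprod, hcompl, hF, Function.update_self]
        ring
    _ = _ := by
        rw [Fintype.sum_prod_type, Finset.sum_comm, Finset.sum_mul_sum]

lemma sum_prod_eq_one {ι B : Type*} [Fintype ι] [DecidableEq ι] [Fintype B] {q : ι → B → ℝ}
    (hq : ∀ i, ∑ b, q i b = 1) : ∑ y : ι → B, ∏ j, q j (y j) = 1 := by
  rw [← Fintype.piFinset_univ, ← Finset.prod_univ_sum]
  simp [hq]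

/-! ### The random variables of a code -/

/-- The messages and the outputs of a block code. -/
abbrev CodeSpace (𝒴₁ 𝒴₂ : Type*) (n M₀ M₁ M₂ : ℕ) :=
  (Fin M₀ × Fin M₁ × Fin M₂) × (Fin n → 𝒴₁ × 𝒴₂)

/-- The number of the message with a given name. -/
def message {M₀ M₁ M₂ : ℕ} (m : Fin M₀ × Fin M₁ × Fin M₂) : Label → ℕ
  | .t => m.1
  | .u => m.2.1
  | .v => m.2.2

/-- The messages and the letters of both output blocks, as one family. -/
def codeCoord {𝒴₁ 𝒴₂ : Type*} {n M₀ M₁ M₂ : ℕ} (ω : CodeSpace 𝒴₁ 𝒴₂ n M₀ M₁ M₂) :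
    Label ⊕ (Fin n ⊕ Fin n) → ℕ ⊕ (𝒴₁ ⊕ 𝒴₂)
  | .inl l => .inl (message ω.1 l)
  | .inr (.inl j) => .inr (.inl (ω.2 j).1)
  | .inr (.inr j) => .inr (.inr (ω.2 j).2)

/-- The messages in `A`, the first `p` letters of the first output, and the letters of the second
output from position `q` on. -/
def coords (n : ℕ) (A : Finset Label) (p q : ℕ) : Set (Label ⊕ (Fin n ⊕ Fin n)) :=
  {x | Sum.elim
    (fun l => l ∈ A) (Sum.elim (fun j : Fin n => (j : ℕ) < p) (fun j : Fin n => q ≤ (j : ℕ))) x}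

section Coords

variable {𝒴₁ 𝒴₂ : Type*} {n M₀ M₁ M₂ : ℕ}

lemma agree_coords_iff {A : Finset Label} {p q : ℕ} {ω ω' : CodeSpace 𝒴₁ 𝒴₂ n M₀ M₁ M₂} :
    (∀ x ∈ coords n A p q, codeCoord ω' x = codeCoord ω x) ↔
      (∀ l ∈ A, message ω'.1 l = message ω.1 l) ∧
        (∀ j : Fin n, (j : ℕ) < p → (ω'.2 j).1 = (ω.2 j).1) ∧
          ∀ j : Fin n, q ≤ (j : ℕ) → (ω'.2 j).2 = (ω.2 j).2 := by
  simp [coords, codeCoord, Sum.forall]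

lemma coords_mono {A A' : Finset Label} {p p' q q' : ℕ} (hA : A ⊆ A') (hp : p ≤ p') (hq : q' ≤ q) :
    coords n A p q ⊆ coords n A' p' q' := by
  rintro (l | j | j) h
  · exact hA h
  · exact lt_of_lt_of_le h hp
  · exact hq.trans h

lemma coords_union_left (A : Finset Label) (i : Fin n) (q : ℕ) :
    coords n A i q ∪ {.inr (.inl i)} = coords n A (i + 1) q := by
  ext (l | j | j) <;> simp [coords, Fin.ext_iff]
  omega

lemma coords_union_right (A : Finset Label) (p : ℕ) (i : Fin n) :
    coords n A p (i + 1) ∪ {.inr (.inr i)} = coords n A p i := by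
  ext (l | j | j) <;> simp [coords, Fin.ext_iff]
  omega

lemma coords_union_labels (A B : Finset Label) (p q : ℕ) :
    coords n A p q ∪ Sum.inl '' (B : Set Label) = coords n (A ∪ B) p q := by
  ext (l | j | j) <;> simp [coords]

end Coords

/-! ### The profile of a code -/

section CodeProfile

variable {𝒳 𝒴₁ 𝒴₂ : Type*} {N a b n M₀ M₁ M₂ : ℕ}

/-- What is observed up to time `i`: the messages in `S.1`, with the past of the first output, the
future of the second output, or both. -/
def observed (n : ℕ) (S : Idx) (i : Fin n) : Set (Label ⊕ (Fin n ⊕ Fin n)) :=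
  coords n S.1 (if S.2 = .two then 0 else i) (if S.2 = .one then n else i + 1)

lemma observed_subset {S S' : Idx} (h : Visible S (some S')) (i : Fin n) :
    observed n S' i ⊆ observed n S i := by
  obtain ⟨h1, h2⟩ := h
  refine coords_mono h1 ?_ ?_
  · simp only [owners, Option.getD_some] at h2 ⊢
    rcases h2 with h2 | h2
    · rw [h2]
    · have h3 : ¬ S.2 = .two := by simp [h2]
      rw [if_neg h3]
      split_ifs <;> simp
  · simp only [owners, Option.getD_some] at h2 ⊢
    rcases h2 with h2 | h2
    · rw [h2]
    · rw [h2]; split_ifs <;> simp_all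

/-- The past ends at `i - 1` and the future begins at `i + 1`, so the letter pair at time `i` is
never observed. Bounds `0` and `n` mean that nothing is seen of the respective output. -/
lemma agree_observed_update {S : Idx} {i : Fin n} (m : Fin M₀ × Fin M₁ × Fin M₂)
    (y : Fin n → 𝒴₁ × 𝒴₂) (p : 𝒴₁ × 𝒴₂) :
    ∀ x ∈ observed n S i, codeCoord (m, Function.update y i p) x = codeCoord (m, y) x := by
  unfold observed
  rw [agree_coords_iff]
  refine ⟨fun _ _ => rfl, fun j hj => ?_, fun j hj => ?_⟩
  · have : j ≠ i := by rintro rfl; split_ifs at hj <;> simp at hj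
    simp [Function.update_of_ne this]
  · have : j ≠ i := by
      rintro rfl
      have := j.2
      split_ifs at hj <;> omega
    simp [Function.update_of_ne this]

variable [MeasurableSpace 𝒳] [MeasurableSpace 𝒴₁] [MeasurableSpace 𝒴₂]

/-- The joint probability mass function of the messages and the output blocks. -/
def Code.weight (κ : Kernel 𝒳 (𝒴₁ × 𝒴₂)) (C : Code 𝒳 𝒴₁ 𝒴₂ n M₀ M₁ M₂)
    (ω : CodeSpace 𝒴₁ 𝒴₂ n M₀ M₁ M₂) : ℝ :=
  (∏ i, (κ (C.enc ω.1 i)).real {ω.2 i}) / ((M₀ : ℝ) * M₁ * M₂)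

variable (κ : Kernel 𝒳 (𝒴₁ × 𝒴₂)) (C : Code 𝒳 𝒴₁ 𝒴₂ n M₀ M₁ M₂)

lemma Code.weight_nonneg (ω : CodeSpace 𝒴₁ 𝒴₂ n M₀ M₁ M₂) : 0 ≤ C.weight κ ω :=
  div_nonneg (Finset.prod_nonneg fun _ _ => measureReal_nonneg) (by positivity)

variable [Fintype 𝒴₁] [Fintype 𝒴₂]

lemma sum_measureReal_letter [MeasurableSingletonClass 𝒴₁] [MeasurableSingletonClass 𝒴₂]
    [IsMarkovKernel κ] (x : 𝒳) : ∑ p, (κ x).real {p} = 1 := by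
  rw [sum_measureReal_singleton]
  simp

lemma Code.sum_weight_fst [MeasurableSingletonClass 𝒴₁] [MeasurableSingletonClass 𝒴₂]
    [IsMarkovKernel κ] (m : Fin M₀ × Fin M₁ × Fin M₂) :
    ∑ y, C.weight κ (m, y) = 1 / ((M₀ : ℝ) * M₁ * M₂) := by
  simp only [Code.weight]
  rw [← Finset.sum_div,
    sum_prod_eq_one (q := fun i p => (κ (C.enc m i)).real {p}) fun i => sum_measureReal_letter κ _]

lemma Code.sum_weight [MeasurableSingletonClass 𝒴₁] [MeasurableSingletonClass 𝒴₂] [IsMarkovKernel κ]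
    [NeZero M₀] [NeZero M₁] [NeZero M₂] : ∑ ω, C.weight κ ω = 1 := by
  rw [Fintype.sum_prod_type]
  simp only [Code.sum_weight_fst]
  have h0 := NeZero.ne M₀
  have h1 := NeZero.ne M₁
  have h2 := NeZero.ne M₂
  simp
  field_simp

open Classical in
/-- The channel law of a letter is its conditional law given the input, also when the rest of the
observation is given. -/
lemma Code.sum_weight_mul_measureReal [MeasurableSingletonClass 𝒴₁] [MeasurableSingletonClass 𝒴₂]
    [IsMarkovKernel κ] {β : Type*} (S : Idx) (i : Fin n) (f : 𝒴₁ × 𝒴₂ → β) (c : β)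
    {G : CodeSpace 𝒴₁ 𝒴₂ n M₀ M₁ M₂ → ℝ}
    (hG : ∀ ω ω', (∀ x ∈ observed n S i, codeCoord ω' x = codeCoord ω x) → G ω' = G ω) :
    ∑ ω, C.weight κ ω * ((κ (C.enc ω.1 i)).real {p | f p = c} * G ω) =
      ∑ ω, C.weight κ ω *
        (condProb (C.weight κ) codeCoord (observed n S i) (fun ω => f (ω.2 i)) c ω * G ω) := by
  rw [← sum_indicator_mul_eq (C.weight_nonneg κ) _ _ hG]
  refine (Fintype.sum_prod_type _).trans (Eq.trans ?_ (Fintype.sum_prod_type _).symm)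
  refine Finset.sum_congr rfl fun m _ => ?_
  -- Given the messages, the channel draws the letter at time `i` independently of the other
  -- letters, and `G` does not depend on it.
  have h := sum_prod_mul_eq (q := fun j p => (κ (C.enc m j)).real {p}) i
    (sum_measureReal_letter κ _) (fun p => if f p = c then (1 : ℝ) else 0) (F := fun y => G (m, y))
    fun y p => hG _ _ (agree_observed_update m y p)
  have h2 : ∑ p : 𝒴₁ × 𝒴₂, (κ (C.enc m i)).real {p} * (if f p = c then (1 : ℝ) else 0) =
      (κ (C.enc m i)).real {p | f p = c} := by
    simp only [mul_ite, mul_one, mul_zero]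
    rw [← Finset.sum_filter, sum_measureReal_singleton]
    simp
  rw [h2] at h
  simp only [Code.weight, div_mul_eq_mul_div]
  rw [← Finset.sum_div, ← Finset.sum_div, h, Finset.mul_sum]
  congr 1
  refine Finset.sum_congr rfl fun y _ => ?_
  ring

/-- The conditional probability of the letters at time `i`, given the observation `S`. -/
def Code.letterProb (e₁ : Fin a ≃ 𝒴₁) (e₂ : Fin b ≃ 𝒴₂) (i : Fin n)
    (ω : CodeSpace 𝒴₁ 𝒴₂ n M₀ M₁ M₂) (S : Idx) : (Fin a ⊕ Fin b) → ℝ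
  | .inl y => condProb (C.weight κ) codeCoord (observed n S i) (fun ω => (ω.2 i).1) (e₁ y) ω
  | .inr y => condProb (C.weight κ) codeCoord (observed n S i) (fun ω => (ω.2 i).2) (e₂ y) ω

lemma Code.letterProb_mem (e₁ : Fin a ≃ 𝒴₁) (e₂ : Fin b ≃ 𝒴₂) (i : Fin n)
    (ω : CodeSpace 𝒴₁ 𝒴₂ n M₀ M₁ M₂) (S : Idx) (j : Fin a ⊕ Fin b) :
    C.letterProb κ e₁ e₂ i ω S j ∈ unitInterval := by
  cases j
  · exact ⟨condProb_nonneg (C.weight_nonneg κ) _ _ _, condProb_le_one (C.weight_nonneg κ) _ _ _⟩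
  · exact ⟨condProb_nonneg (C.weight_nonneg κ) _ _ _, condProb_le_one (C.weight_nonneg κ) _ _ _⟩

lemma Code.letterProb_congr (e₁ : Fin a ≃ 𝒴₁) (e₂ : Fin b ≃ 𝒴₂) {i : Fin n}
    {ω ω' : CodeSpace 𝒴₁ 𝒴₂ n M₀ M₁ M₂} {S : Idx}
    (h : ∀ x ∈ observed n S i, codeCoord ω' x = codeCoord ω x) :
    C.letterProb κ e₁ e₂ i ω' S = C.letterProb κ e₁ e₂ i ω S := by
  funext j
  cases j
  · exact condProb_congr h
  · exact condProb_congr h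

/-- The input at time `i` together with the conditional probabilities of the letters at time `i`,
given each of the observations. -/
def Code.profilePoint (eX : Fin N ≃ 𝒳) (e₁ : Fin a ≃ 𝒴₁) (e₂ : Fin b ≃ 𝒴₂)
    (z : Fin n × CodeSpace 𝒴₁ 𝒴₂ n M₀ M₁ M₂) : ProfileSpace N a b :=
  (eX.symm (C.enc z.2.1 z.1),
    fun S j => ⟨C.letterProb κ e₁ e₂ z.1 z.2 S j, C.letterProb_mem κ e₁ e₂ z.1 z.2 S j⟩)

/-- The law of `Code.profilePoint` at a uniformly distributed time. -/
def Code.profile (eX : Fin N ≃ 𝒳) (e₁ : Fin a ≃ 𝒴₁) (e₂ : Fin b ≃ 𝒴₂) :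
    Measure (ProfileSpace N a b) :=
  finiteLaw (fun z : Fin n × CodeSpace 𝒴₁ 𝒴₂ n M₀ M₁ M₂ => C.weight κ z.2 / n)
    (C.profilePoint κ eX e₁ e₂)

lemma Code.isProbabilityMeasure_profile [MeasurableSingletonClass 𝒴₁] [MeasurableSingletonClass 𝒴₂]
    [IsMarkovKernel κ] [NeZero n] [NeZero M₀] [NeZero M₁] [NeZero M₂]
    (eX : Fin N ≃ 𝒳) (e₁ : Fin a ≃ 𝒴₁) (e₂ : Fin b ≃ 𝒴₂) :
    IsProbabilityMeasure (C.profile κ eX e₁ e₂) := by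
  refine isProbabilityMeasure_finiteLaw
    (fun z => div_nonneg (C.weight_nonneg κ _) (Nat.cast_nonneg n)) ?_ _
  rw [Fintype.sum_prod_type]
  simp only
  rw [← Finset.sum_div, C.sum_weight κ]
  have := NeZero.ne n
  simp [this]

lemma Code.integral_profile (eX : Fin N ≃ 𝒳) (e₁ : Fin a ≃ 𝒴₁) (e₂ : Fin b ≃ 𝒴₂)
    (g : ProfileSpace N a b → ℝ) :
    ∫ k, g k ∂C.profile κ eX e₁ e₂ =
      (∑ i, ∑ ω, C.weight κ ω * g (C.profilePoint κ eX e₁ e₂ (i, ω))) / n := by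
  rw [Code.profile, integral_finiteLaw
    (fun z => div_nonneg (C.weight_nonneg κ _) (Nat.cast_nonneg n)), Fintype.sum_prod_type,
    Finset.sum_div]
  refine Finset.sum_congr rfl fun i _ => ?_
  rw [Finset.sum_div]
  refine Finset.sum_congr rfl fun ω _ => ?_
  ring

/-- What `mask S` keeps is a function of the observation: the coordinates of smaller views obviously
are, and the input is kept only if all messages are seen, which determine it through the encoder. -/
lemma Code.mask_profilePoint_congr [NeZero N] (eX : Fin N ≃ 𝒳) (e₁ : Fin a ≃ 𝒴₁) (e₂ : Fin b ≃ 𝒴₂)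
    {S : Idx} {i : Fin n} {ω ω' : CodeSpace 𝒴₁ 𝒴₂ n M₀ M₁ M₂}
    (h : ∀ x ∈ observed n S i, codeCoord ω' x = codeCoord ω x) :
    mask S (C.profilePoint κ eX e₁ e₂ (i, ω')) = mask S (C.profilePoint κ eX e₁ e₂ (i, ω)) := by
  refine Prod.ext ?_ (funext fun S' => ?_)
  · simp only [mask, Code.profilePoint]
    split_ifs with hS
    · have hm : ω'.1 = ω.1 := by
        have h1 := (agree_coords_iff.1 h).1
        have h2 : ∀ l, message ω'.1 l = message ω.1 l := fun l => h1 l (hS.1 (Finset.mem_univ l))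
        exact Prod.ext (Fin.ext (h2 .t)) (Prod.ext (Fin.ext (h2 .u)) (Fin.ext (h2 .v)))
      rw [hm]
    · rfl
  · simp only [mask, Code.profilePoint]
    split_ifs with hS
    · funext j
      have := C.letterProb_congr κ e₁ e₂ fun x hx => h x (observed_subset hS i hx)
      exact Subtype.ext (congrFun this j)
    · rfl

lemma Code.isProfile_profile [MeasurableSingletonClass 𝒴₁] [MeasurableSingletonClass 𝒴₂]
    [IsMarkovKernel κ] [NeZero N] (eX : Fin N ≃ 𝒳) (e₁ : Fin a ≃ 𝒴₁) (e₂ : Fin b ≃ 𝒴₂) :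
    IsProfile (outputProb κ eX e₁ e₂) (C.profile κ eX e₁ e₂) := by
  intro S j g
  rw [C.integral_profile κ eX e₁ e₂ (fun k => outputProb κ eX e₁ e₂ k.1 j * g (mask S k)),
    C.integral_profile κ eX e₁ e₂ (fun k => (k.2 S j : ℝ) * g (mask S k))]
  congr 1
  refine Finset.sum_congr rfl fun i _ => ?_
  have hG : ∀ ω ω' : CodeSpace 𝒴₁ 𝒴₂ n M₀ M₁ M₂,
      (∀ x ∈ observed n S i, codeCoord ω' x = codeCoord ω x) →
      g (mask S (C.profilePoint κ eX e₁ e₂ (i, ω'))) =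
        g (mask S (C.profilePoint κ eX e₁ e₂ (i, ω))) := fun ω ω' h => by
    rw [C.mask_profilePoint_congr κ eX e₁ e₂ h]
  cases j with
  | inl y =>
    have := C.sum_weight_mul_measureReal κ S i Prod.fst (e₁ y) hG
    simpa [outputProb, Code.profilePoint, Code.letterProb] using this
  | inr y =>
    have := C.sum_weight_mul_measureReal κ S i Prod.snd (e₂ y) hG
    simpa [outputProb, Code.profilePoint, Code.letterProb] using this

/-- The joint entropy of the messages in `A`, the first `p` letters of the first output and the
letters of the second output from position `q` on. -/
def Code.entropy (A : Finset Label) (p q : ℕ) : ℝ :=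
  jointEntropy (C.weight κ) codeCoord (coords n A p q)

lemma Code.profileEntropy₁_profile (eX : Fin N ≃ 𝒳) (e₁ : Fin a ≃ 𝒴₁) (e₂ : Fin b ≃ 𝒴₂)
    (A : Finset Label) (s : Side) :
    profileEntropy₁ (C.profile κ eX e₁ e₂) A s = (∑ i : Fin n,
      (jointEntropy (C.weight κ) codeCoord (observed n (A, s) i ∪ {.inr (.inl i)}) -
        jointEntropy (C.weight κ) codeCoord (observed n (A, s) i))) / n := by
  rw [profileEntropy₁, Code.integral_profile]
  congr 1
  refine Finset.sum_congr rfl fun i _ => ?_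
  rw [jointEntropy_union_sub (C.weight_nonneg κ) (fun ω => (ω.2 i).1)
    fun ω ω' => by simp [codeCoord]]
  refine Finset.sum_congr rfl fun ω _ => ?_
  rw [← Equiv.sum_comp e₁]
  rfl

lemma Code.profileEntropy₂_profile (eX : Fin N ≃ 𝒳) (e₁ : Fin a ≃ 𝒴₁) (e₂ : Fin b ≃ 𝒴₂)
    (A : Finset Label) (s : Side) :
    profileEntropy₂ (C.profile κ eX e₁ e₂) A s = (∑ i : Fin n,
      (jointEntropy (C.weight κ) codeCoord (observed n (A, s) i ∪ {.inr (.inr i)}) -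
        jointEntropy (C.weight κ) codeCoord (observed n (A, s) i))) / n := by
  rw [profileEntropy₂, Code.integral_profile]
  congr 1
  refine Finset.sum_congr rfl fun i _ => ?_
  rw [jointEntropy_union_sub (C.weight_nonneg κ) (fun ω => (ω.2 i).2)
    fun ω ω' => by simp [codeCoord]]
  refine Finset.sum_congr rfl fun ω _ => ?_
  rw [← Equiv.sum_comp e₂]
  rfl

/-- Chain rule over time. The value is H(Y₁ⁿ|A)/n, since in `Code.entropy` the arguments `n n` stand
for the whole first output, `0 0` for the whole second output and `0 n` for none. -/
lemma Code.profileEntropy₁_one (eX : Fin N ≃ 𝒳) (e₁ : Fin a ≃ 𝒴₁) (e₂ : Fin b ≃ 𝒴₂)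
    (A : Finset Label) :
    profileEntropy₁ (C.profile κ eX e₁ e₂) A .one =
      (C.entropy κ A n n - C.entropy κ A 0 n) / n := by
  rw [Code.profileEntropy₁_profile]
  simp only [observed, reduceCtorEq, if_false, if_true, coords_union_left]
  exact congrArg (· / (n : ℝ)) ((Fin.sum_univ_eq_sum_range (fun i =>
    C.entropy κ A (i + 1) n - C.entropy κ A i n) n).trans
      (Finset.sum_range_sub (fun i => C.entropy κ A i n) n))

lemma Code.profileEntropy₂_two (eX : Fin N ≃ 𝒳) (e₁ : Fin a ≃ 𝒴₁) (e₂ : Fin b ≃ 𝒴₂)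
    (A : Finset Label) :
    profileEntropy₂ (C.profile κ eX e₁ e₂) A .two =
      (C.entropy κ A 0 0 - C.entropy κ A 0 n) / n := by
  rw [Code.profileEntropy₂_profile]
  simp only [observed, reduceCtorEq, if_false, if_true, coords_union_right]
  exact congrArg (· / (n : ℝ)) ((Fin.sum_univ_eq_sum_range (fun i =>
    C.entropy κ A 0 i - C.entropy κ A 0 (i + 1)) n).trans (Finset.sum_range_sub' _ n))

/-- This is the Csiszár sum identity. Both terms condition on the same observation, which cancels,
and what remains is the change of H(A, Y₁ before i, Y₂ from i on) as i advances by one, a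
telescoping sum. -/
lemma Code.profileEntropy_both (eX : Fin N ≃ 𝒳) (e₁ : Fin a ≃ 𝒴₁) (e₂ : Fin b ≃ 𝒴₂)
    (A : Finset Label) :
    profileEntropy₁ (C.profile κ eX e₁ e₂) A .both -
        profileEntropy₂ (C.profile κ eX e₁ e₂) A .both =
      (C.entropy κ A n n - C.entropy κ A 0 0) / n := by
  rw [Code.profileEntropy₁_profile, Code.profileEntropy₂_profile, ← sub_div,
    ← Finset.sum_sub_distrib]
  simp only [observed, reduceCtorEq, if_false, coords_union_left, coords_union_right,
    sub_sub_sub_cancel_right]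
  exact congrArg (· / (n : ℝ)) ((Fin.sum_univ_eq_sum_range (fun i =>
    C.entropy κ A (i + 1) (i + 1) - C.entropy κ A i i) n).trans
      (Finset.sum_range_sub (fun i => C.entropy κ A i i) n))

end CodeProfile

/-! ### Entropies of a code -/

section CodeEntropy

variable {𝒳 𝒴₁ 𝒴₂ : Type*} {n M₀ M₁ M₂ : ℕ}

/-- The number of messages with a given name. -/
def messageCount (M₀ M₁ M₂ : ℕ) : Label → ℕ
  | .t => M₀
  | .u => M₁
  | .v => M₂

open Classical in
lemma card_message_eq (A : Finset Label) (m : Fin M₀ × Fin M₁ × Fin M₂) :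
    (Finset.univ.filter fun m' : Fin M₀ × Fin M₁ × Fin M₂ =>
      ∀ l ∈ A, message m' l = message m l).card =
      ∏ l, if l ∈ A then 1 else messageCount M₀ M₁ M₂ l := by
  have hfin : ∀ {M : ℕ} (P : Prop) [Decidable P] (k : Fin M)
      [DecidablePred fun k' : Fin M => P → (k' : ℕ) = k],
      (Finset.univ.filter fun k' : Fin M => P → (k' : ℕ) = k).card = if P then 1 else M := by
    intro M P _ k _
    by_cases h : P
    · simp only [h, true_imp_iff, if_true]
      rw [Finset.card_eq_one]
      exact ⟨k, by ext; simp [Fin.ext_iff]⟩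
    · simp [h]
  have hset : (Finset.univ.filter fun m' : Fin M₀ × Fin M₁ × Fin M₂ =>
      ∀ l ∈ A, message m' l = message m l) =
      (Finset.univ.filter fun k : Fin M₀ => Label.t ∈ A → (k : ℕ) = m.1) ×ˢ
        ((Finset.univ.filter fun k : Fin M₁ => Label.u ∈ A → (k : ℕ) = m.2.1) ×ˢ
          (Finset.univ.filter fun k : Fin M₂ => Label.v ∈ A → (k : ℕ) = m.2.2)) := by
    ext m'
    simp only [Finset.mem_filter, Finset.mem_univ, true_and, Finset.mem_product]
    constructor
    · exact fun h => ⟨h .t, h .u, h .v⟩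
    · rintro ⟨h1, h2, h3⟩ (_ | _ | _)
      exacts [h1, h2, h3]
  rw [hset, Finset.card_product, Finset.card_product, hfin, hfin, hfin]
  have huniv : (Finset.univ : Finset Label) = {.t, .u, .v} := by
    ext (_ | _ | _) <;> simp
  rw [huniv]
  simp [messageCount]

variable [MeasurableSpace 𝒳] [MeasurableSpace 𝒴₁] [MeasurableSpace 𝒴₂] [Fintype 𝒴₁] [Fintype 𝒴₂]
  (κ : Kernel 𝒳 (𝒴₁ × 𝒴₂)) (C : Code 𝒳 𝒴₁ 𝒴₂ n M₀ M₁ M₂)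

lemma Code.entropy_mono {A A' : Finset Label} {p p' q q' : ℕ} (hA : A ⊆ A') (hp : p ≤ p')
    (hq : q' ≤ q) : C.entropy κ A p q ≤ C.entropy κ A' p' q' :=
  jointEntropy_mono (C.weight_nonneg κ) (coords_mono hA hp hq)

variable [MeasurableSingletonClass 𝒴₁] [MeasurableSingletonClass 𝒴₂] [IsMarkovKernel κ]

/-- The messages are independent and uniform. -/
lemma Code.entropy_messages [NeZero M₀] [NeZero M₁] [NeZero M₂] (A : Finset Label) :
    C.entropy κ A 0 n = ∑ l ∈ A, Real.log (messageCount M₀ M₁ M₂ l) := by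
  classical
  have hpos : ∀ l, (0 : ℝ) < messageCount M₀ M₁ M₂ l := by
    rintro (_ | _ | _)
    · exact Nat.cast_pos.2 (Nat.pos_of_ne_zero (NeZero.ne M₀))
    · exact Nat.cast_pos.2 (Nat.pos_of_ne_zero (NeZero.ne M₁))
    · exact Nat.cast_pos.2 (Nat.pos_of_ne_zero (NeZero.ne M₂))
  have huniv : (Finset.univ : Finset Label) = {.t, .u, .v} := by
    ext (_ | _ | _) <;> simp
  have hM : (M₀ : ℝ) * M₁ * M₂ = ∏ l, (messageCount M₀ M₁ M₂ l : ℝ) := by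
    rw [huniv]
    simp [messageCount, mul_assoc]
  have hmass : ∀ ω, agreeMass (C.weight κ) codeCoord (coords n A 0 n) ω =
      ∏ l, if l ∈ A then (messageCount M₀ M₁ M₂ l : ℝ)⁻¹ else 1 := by
    intro ω
    have hfilter : agreeMass (C.weight κ) codeCoord (coords n A 0 n) ω =
        ∑ ω' ∈ (Finset.univ.filter fun m' : Fin M₀ × Fin M₁ × Fin M₂ =>
          ∀ l ∈ A, message m' l = message ω.1 l) ×ˢ Finset.univ, C.weight κ ω' := by
      refine Finset.sum_congr ?_ fun _ _ => rfl
      ext ω'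
      simp only [Finset.mem_filter, Finset.mem_univ, true_and, and_true, Finset.mem_product,
        agree_coords_iff]
      exact ⟨fun h => h.1, fun h => ⟨h, fun j hj => absurd hj (by simp),
        fun j hj => absurd j.2 hj.not_gt⟩⟩
    rw [hfilter, Finset.sum_product]
    simp only [C.sum_weight_fst κ]
    rw [Finset.sum_const, card_message_eq, nsmul_eq_mul, hM, mul_one_div, Nat.cast_prod,
      ← Finset.prod_div_distrib]
    refine Finset.prod_congr rfl fun l _ => ?_
    split_ifs
    · simp
    · exact div_self (hpos l).ne'
  unfold Code.entropy jointEntropy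
  simp only [hmass]
  rw [← Finset.sum_mul, C.sum_weight κ, one_mul, Real.log_prod]
  · rw [← Finset.sum_neg_distrib, ← Finset.sum_filter_add_sum_filter_not Finset.univ (· ∈ A)]
    rw [Finset.sum_congr rfl (g := fun l => Real.log (messageCount M₀ M₁ M₂ l))]
    · rw [Finset.sum_eq_zero (s := Finset.univ.filter fun l => ¬ l ∈ A), add_zero]
      · congr 1
        ext
        simp
      · intro l hl
        simp [(Finset.mem_filter.1 hl).2]
    · intro l hl
      simp [(Finset.mem_filter.1 hl).2]
  · intro l _
    have := hpos l
    split_ifs <;> positivity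

open Classical in
lemma Code.sum_errorSet_weight :
    ∑ ω, (if ω.2 ∈ C.errorSet ω.1 then C.weight κ ω else 0) = C.errorProb κ := by
  rw [Fintype.sum_prod_type, Code.errorProb, Finset.sum_div]
  refine Finset.sum_congr rfl fun m _ => ?_
  rw [← Finset.sum_filter]
  simp only [Code.weight]
  rw [← Finset.sum_div]
  congr 1
  have h1 : ∀ y : Fin n → 𝒴₁ × 𝒴₂, ∏ i, (κ (C.enc m i)).real {y i} =
      (Measure.pi fun i => κ (C.enc m i)).real {y} := by
    intro y
    rw [measureReal_def, Measure.pi_singleton, ENNReal.toReal_prod]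
    rfl
  simp only [h1]
  rw [sum_measureReal_singleton]
  congr 1
  ext y
  simp

open Classical in
lemma Code.sum_error₁_weight_le :
    ∑ ω, (if ((ω.1.1, ω.1.2.1) : Fin M₀ × Fin M₁) = C.dec₁ fun i => (ω.2 i).1 then 0
      else C.weight κ ω) ≤ C.errorProb κ := by
  rw [← C.sum_errorSet_weight κ]
  refine Finset.sum_le_sum fun ω _ => ?_
  split_ifs with h1 h2 h2
  · exact C.weight_nonneg κ ω
  · exact le_rfl
  · exact le_rfl
  · exact absurd (Or.inl (Ne.symm h1)) h2

open Classical in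
lemma Code.sum_error₂_weight_le :
    ∑ ω, (if ((ω.1.1, ω.1.2.2) : Fin M₀ × Fin M₂) = C.dec₂ fun i => (ω.2 i).2 then 0
      else C.weight κ ω) ≤ C.errorProb κ := by
  rw [← C.sum_errorSet_weight κ]
  refine Finset.sum_le_sum fun ω _ => ?_
  split_ifs with h1 h2 h2
  · exact C.weight_nonneg κ ω
  · exact le_rfl
  · exact le_rfl
  · exact absurd (Or.inr (Ne.symm h1)) h2

variable [NeZero M₀] [NeZero M₁] [NeZero M₂]

/-- Receiver 1 decodes from its own block alone, so Fano's inequality applies whatever messages `A`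
are known in addition. -/
lemma Code.entropy_union_sub_le₁ (A : Finset Label) :
    C.entropy κ (A ∪ {.t, .u}) n n - C.entropy κ A n n ≤
      Real.log 2 + C.errorProb κ * (Real.log M₀ + Real.log M₁) := by
  classical
  have h := jointEntropy_union_sub_le_fano (C.weight_nonneg κ) (C.sum_weight κ)
    (c := codeCoord) (S := coords n A n n) (L := Sum.inl '' (({.t, .u} : Finset Label) : Set Label))
    (fun ω => ((ω.1.1, ω.1.2.1) : Fin M₀ × Fin M₁)) (fun ω => C.dec₁ fun i => (ω.2 i).1)
    (fun ω ω' => by simp [codeCoord, message, Fin.ext_iff, or_imp, forall_and])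
    (fun ω ω' h => congrArg C.dec₁ (funext fun i => (agree_coords_iff.1 h).2.1 i i.2))
    (ε := C.errorProb κ) (by convert C.sum_error₁_weight_le κ)
  rw [coords_union_labels] at h
  rw [← Real.log_mul (by simp [NeZero.ne]) (by simp [NeZero.ne])]
  simpa [Code.entropy] using h

lemma Code.entropy_union_sub_le₂ (A : Finset Label) :
    C.entropy κ (A ∪ {.t, .v}) 0 0 - C.entropy κ A 0 0 ≤
      Real.log 2 + C.errorProb κ * (Real.log M₀ + Real.log M₂) := by
  classical
  have h := jointEntropy_union_sub_le_fano (C.weight_nonneg κ) (C.sum_weight κ)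
    (c := codeCoord) (S := coords n A 0 0) (L := Sum.inl '' (({.t, .v} : Finset Label) : Set Label))
    (fun ω => ((ω.1.1, ω.1.2.2) : Fin M₀ × Fin M₂)) (fun ω => C.dec₂ fun i => (ω.2 i).2)
    (fun ω ω' => by simp [codeCoord, message, Fin.ext_iff, or_imp, forall_and])
    (fun ω ω' h => congrArg C.dec₂ (funext fun i => (agree_coords_iff.1 h).2.2 i (Nat.zero_le _)))
    (ε := C.errorProb κ) (by convert C.sum_error₂_weight_le κ)
  rw [coords_union_labels] at h
  rw [← Real.log_mul (by simp [NeZero.ne]) (by simp [NeZero.ne])]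
  simpa [Code.entropy] using h

lemma Code.entropy_output_le₁ [Nonempty 𝒴₁] :
    C.entropy κ ∅ n n ≤ n * Real.log (Fintype.card 𝒴₁) := by
  have h := jointEntropy_union_sub_le_log_card (C.weight_nonneg κ) (C.sum_weight κ)
    (c := codeCoord) (S := coords n ∅ 0 n) (L := Set.range fun i => .inr (.inl i))
    (fun ω i => (ω.2 i).1) (fun ω ω' => by simp [codeCoord, funext_iff])
  have h2 : coords n ∅ 0 n ∪ (Set.range fun i => .inr (.inl i)) = coords n ∅ n n := by
    ext (l | j | j) <;> simp [coords]
  have h3 := C.entropy_messages κ ∅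
  rw [Finset.sum_empty, Code.entropy] at h3
  rw [h2, h3, sub_zero] at h
  simpa [Code.entropy] using h

lemma Code.entropy_output_le₂ [Nonempty 𝒴₂] :
    C.entropy κ ∅ 0 0 ≤ n * Real.log (Fintype.card 𝒴₂) := by
  have h := jointEntropy_union_sub_le_log_card (C.weight_nonneg κ) (C.sum_weight κ)
    (c := codeCoord) (S := coords n ∅ 0 n) (L := Set.range fun i => .inr (.inr i))
    (fun ω i => (ω.2 i).2) (fun ω ω' => by simp [codeCoord, funext_iff])
  have h2 : coords n ∅ 0 n ∪ (Set.range fun i => .inr (.inr i)) = coords n ∅ 0 0 := by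
    ext (l | j | j) <;> simp [coords]
  have h3 := C.entropy_messages κ ∅
  rw [Finset.sum_empty, Code.entropy] at h3
  rw [h2, h3, sub_zero] at h
  simpa [Code.entropy] using h

/-- Achievability bounds the message counts only from below. With error at most 1/2, Fano's
inequality bounds half of the logarithm by the output entropy plus log 2, so the Fano term is at
most linear in `n`. -/
lemma Code.log_add_log_le₁ [Nonempty 𝒴₁] (hε : C.errorProb κ ≤ 1 / 2) :
    Real.log M₀ + Real.log M₁ ≤ 2 * (n * Real.log (Fintype.card 𝒴₁) + Real.log 2) := by
  have h1 := C.entropy_union_sub_le₁ κ ∅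
  have h2 := C.entropy_output_le₁ κ
  have h3 := C.entropy_mono κ (Finset.empty_union ({.t, .u} : Finset Label)).ge (Nat.zero_le n)
    (le_refl n)
  rw [C.entropy_messages κ, Finset.sum_pair (by decide)] at h3
  simp only [messageCount] at h3
  have h4 : 0 ≤ Real.log M₀ + Real.log M₁ :=
    add_nonneg (Real.log_natCast_nonneg _) (Real.log_natCast_nonneg _)
  have h5 := mul_le_mul_of_nonneg_right hε h4
  linarith

lemma Code.log_add_log_le₂ [Nonempty 𝒴₂] (hε : C.errorProb κ ≤ 1 / 2) :
    Real.log M₀ + Real.log M₂ ≤ 2 * (n * Real.log (Fintype.card 𝒴₂) + Real.log 2) := by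
  have h1 := C.entropy_union_sub_le₂ κ ∅
  have h2 := C.entropy_output_le₂ κ
  have h3 := C.entropy_mono κ (Finset.empty_union ({.t, .v} : Finset Label)).ge (le_refl 0)
    (Nat.zero_le n)
  rw [C.entropy_messages κ, Finset.sum_pair (by decide)] at h3
  simp only [messageCount] at h3
  have h4 : 0 ≤ Real.log M₀ + Real.log M₂ :=
    add_nonneg (Real.log_natCast_nonneg _) (Real.log_natCast_nonneg _)
  have h5 := mul_le_mul_of_nonneg_right hε h4
  linarith

end CodeEntropy

/-! ### Codes of small error probability have almost admissible profiles -/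

/-- The equations of `EntropyEquations` up to an error of `δ`. -/
structure ApproxEntropyEquations (H₁ H₂ : Finset Label → Side → ℝ) (c₀ c₁ c₂ δ : ℝ) : Prop where
  t_one : ∀ A, Label.t ∉ A → |H₁ A .one - H₁ (insert Label.t A) .one - c₀| ≤ δ
  t_two : ∀ A, Label.t ∉ A → |H₂ A .two - H₂ (insert Label.t A) .two - c₀| ≤ δ
  u_one : ∀ A, Label.u ∉ A → |H₁ A .one - H₁ (insert Label.u A) .one - c₁| ≤ δ
  v_two : ∀ A, Label.v ∉ A → |H₂ A .two - H₂ (insert Label.v A) .two - c₂| ≤ δ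
  sides : ∀ A, H₁ A .one - H₁ A .both = H₂ A .two - H₂ A .both
  sub_sub : ∀ A B₁ B₂ : Finset Label,
    B₁ ⊆ {Label.t, Label.u} → B₂ ⊆ {Label.t, Label.v} →
    |(H₁ (A ∪ B₂) .both - H₁ (A ∪ B₂ ∪ B₁) .both) + (H₂ A .both - H₂ (A ∪ B₁) .both) -
    ((H₂ (A ∪ B₂) .both - H₂ (A ∪ B₂ ∪ B₁) .both) + (H₁ A .both - H₁ (A ∪ B₁) .both))| ≤ δ

section CodeEquations

variable {𝒳 𝒴₁ 𝒴₂ : Type*} [MeasurableSpace 𝒳]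
  [Fintype 𝒴₁] [MeasurableSpace 𝒴₁] [MeasurableSingletonClass 𝒴₁]
  [Fintype 𝒴₂] [MeasurableSpace 𝒴₂] [MeasurableSingletonClass 𝒴₂]
  {N a b n M₀ M₁ M₂ : ℕ}
  (κ : Kernel 𝒳 (𝒴₁ × 𝒴₂)) [IsMarkovKernel κ] (C : Code 𝒳 𝒴₁ 𝒴₂ n M₀ M₁ M₂)
  [NeZero M₀] [NeZero M₁] [NeZero M₂]

/-- After telescoping, the deviation in each equation for a single message is one Fano term over
`n`. In `sub_sub` the second difference of H(·,Y₁ⁿ) - H(·,Y₂ⁿ) consists of two Fano terms for each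
receiver. Each of the four lies in `[0, δ]`, and their signs leave at most `2 * δ`. -/
lemma Code.approxEntropyEquations_profile (eX : Fin N ≃ 𝒳) (e₁ : Fin a ≃ 𝒴₁) (e₂ : Fin b ≃ 𝒴₂)
    {δ : ℝ} (hδ₁ : ∀ A, C.entropy κ (A ∪ {.t, .u}) n n - C.entropy κ A n n ≤ δ)
    (hδ₂ : ∀ A, C.entropy κ (A ∪ {.t, .v}) 0 0 - C.entropy κ A 0 0 ≤ δ) :
    ApproxEntropyEquations (profileEntropy₁ (C.profile κ eX e₁ e₂))
      (profileEntropy₂ (C.profile κ eX e₁ e₂)) (Real.log M₀ / n) (Real.log M₁ / n)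
      (Real.log M₂ / n) (2 * δ / n) := by
  have h₁ : ∀ A B : Finset Label, B ⊆ {.t, .u} →
      0 ≤ C.entropy κ (A ∪ B) n n - C.entropy κ A n n ∧
        C.entropy κ (A ∪ B) n n - C.entropy κ A n n ≤ δ := fun A B hB =>
    ⟨sub_nonneg.2 (C.entropy_mono κ Finset.subset_union_left le_rfl le_rfl),
      (sub_le_sub_right (C.entropy_mono κ (Finset.union_subset_union_right hB) le_rfl le_rfl)
        _).trans (hδ₁ A)⟩
  have h₂ : ∀ A B : Finset Label, B ⊆ {.t, .v} →
      0 ≤ C.entropy κ (A ∪ B) 0 0 - C.entropy κ A 0 0 ∧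
        C.entropy κ (A ∪ B) 0 0 - C.entropy κ A 0 0 ≤ δ := fun A B hB =>
    ⟨sub_nonneg.2 (C.entropy_mono κ Finset.subset_union_left le_rfl le_rfl),
      (sub_le_sub_right (C.entropy_mono κ (Finset.union_subset_union_right hB) le_rfl le_rfl)
        _).trans (hδ₂ A)⟩
  have hδ : 0 ≤ δ := by linarith [(h₁ ∅ ∅ (by simp)).1, (h₁ ∅ ∅ (by simp)).2]
  have hdiv : ∀ x : ℝ, |x| ≤ 2 * δ → |x / n| ≤ 2 * δ / n := fun x hx => by
    rw [abs_div, Nat.abs_cast]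
    gcongr
  have hmsg : ∀ A l, l ∉ A → C.entropy κ (insert l A) 0 n - C.entropy κ A 0 n =
      Real.log (messageCount M₀ M₁ M₂ l) := fun A l hl => by
    rw [C.entropy_messages κ, C.entropy_messages κ, Finset.sum_insert hl, add_sub_cancel_right]
  have hone : ∀ A l, l ∉ A → l ∈ ({.t, .u} : Finset Label) →
      |profileEntropy₁ (C.profile κ eX e₁ e₂) A .one -
        profileEntropy₁ (C.profile κ eX e₁ e₂) (insert l A) .one -
          Real.log (messageCount M₀ M₁ M₂ l) / n| ≤ 2 * δ / n := by
    intro A l hl hB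
    have h := h₁ A {l} (Finset.singleton_subset_iff.2 hB)
    rw [Finset.union_comm, ← Finset.insert_eq] at h
    rw [C.profileEntropy₁_one, C.profileEntropy₁_one, ← hmsg A l hl, ← sub_div, ← sub_div]
    refine hdiv _ (abs_le.2 ⟨?_, ?_⟩) <;> linarith
  have htwo : ∀ A l, l ∉ A → l ∈ ({.t, .v} : Finset Label) →
      |profileEntropy₂ (C.profile κ eX e₁ e₂) A .two -
        profileEntropy₂ (C.profile κ eX e₁ e₂) (insert l A) .two -
          Real.log (messageCount M₀ M₁ M₂ l) / n| ≤ 2 * δ / n := by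
    intro A l hl hB
    have h := h₂ A {l} (Finset.singleton_subset_iff.2 hB)
    rw [Finset.union_comm, ← Finset.insert_eq] at h
    rw [C.profileEntropy₂_two, C.profileEntropy₂_two, ← hmsg A l hl, ← sub_div, ← sub_div]
    refine hdiv _ (abs_le.2 ⟨?_, ?_⟩) <;> linarith
  refine ⟨fun A hA => hone A _ hA (by simp), fun A hA => htwo A _ hA (by simp),
    fun A hA => hone A _ hA (by simp), fun A hA => htwo A _ hA (by simp), fun A => ?_,
    fun A B₁ B₂ hB₁ hB₂ => ?_⟩
  · have h := C.profileEntropy_both κ eX e₁ e₂ A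
    rw [C.profileEntropy₁_one, C.profileEntropy₂_two]
    have h2 : (C.entropy κ A n n - C.entropy κ A 0 n) / n -
        (C.entropy κ A 0 0 - C.entropy κ A 0 n) / n =
        (C.entropy κ A n n - C.entropy κ A 0 0) / n := by ring
    linarith
  · have e1 := C.profileEntropy_both κ eX e₁ e₂ A
    have e2 := C.profileEntropy_both κ eX e₁ e₂ (A ∪ B₂)
    have e3 := C.profileEntropy_both κ eX e₁ e₂ (A ∪ B₂ ∪ B₁)
    have e4 := C.profileEntropy_both κ eX e₁ e₂ (A ∪ B₁)
    have i1 := h₁ (A ∪ B₂) B₁ hB₁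
    have i2 := h₁ A B₁ hB₁
    have i3 := h₂ (A ∪ B₁) B₂ hB₂
    have i4 := h₂ A B₂ hB₂
    rw [Finset.union_right_comm] at i3
    -- Entropies with the first output are paired by adjoining `B₁`, those with the second by
    -- adjoining `B₂`.
    have key := hdiv ((C.entropy κ (A ∪ B₂) n n - C.entropy κ (A ∪ B₂) 0 0) -
      (C.entropy κ (A ∪ B₂ ∪ B₁) n n - C.entropy κ (A ∪ B₂ ∪ B₁) 0 0) -
      (C.entropy κ A n n - C.entropy κ A 0 0) +
      (C.entropy κ (A ∪ B₁) n n - C.entropy κ (A ∪ B₁) 0 0))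
      (abs_le.2 ⟨by linarith, by linarith⟩)
    rw [add_div, sub_div, sub_div, ← e1, ← e2, ← e3, ← e4] at key
    convert key using 2
    ring

end CodeEquations

/-! ### Compactness of profiles and passage to the limit. -/

section Limit

variable {𝒳 𝒴₁ 𝒴₂ : Type*} [MeasurableSpace 𝒳]
  [Fintype 𝒴₁] [Nonempty 𝒴₁] [MeasurableSpace 𝒴₁] [MeasurableSingletonClass 𝒴₁]
  [Fintype 𝒴₂] [Nonempty 𝒴₂] [MeasurableSpace 𝒴₂] [MeasurableSingletonClass 𝒴₂]
  {N a b : ℕ} [NeZero N]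

lemma le_log_div {n M : ℕ} [NeZero n] {r : ℝ} (h : Real.exp (n * r) ≤ M) : r ≤ Real.log M / n := by
  have hn : (0 : ℝ) < n := Nat.cast_pos.2 (Nat.pos_of_ne_zero (NeZero.ne n))
  rw [le_div_iff₀ hn, mul_comm]
  exact (Real.le_log_iff_exp_le ((Real.exp_pos _).trans_le h)).2 h

lemma neZero_of_exp_le {M : ℕ} {r : ℝ} (h : Real.exp r ≤ M) : NeZero M :=
  ⟨fun h0 => by
    rw [h0, Nat.cast_zero] at h
    exact absurd (Real.exp_pos r) h.not_gt⟩

/-- An achievable triple has profiles which satisfy the equations of the outer bound up to any given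
error. -/
lemma Achievable.exists_profile {κ : Kernel 𝒳 (𝒴₁ × 𝒴₂)} [IsMarkovKernel κ] (eX : Fin N ≃ 𝒳)
    (e₁ : Fin a ≃ 𝒴₁) (e₂ : Fin b ≃ 𝒴₂) {R : ℝ × ℝ × ℝ} (hR : Achievable κ R) {η : ℝ}
    (hη : 0 < η) :
    ∃ (P : ProbabilityMeasure (ProfileSpace N a b)) (c₀ c₁ c₂ : ℝ),
      IsProfile (outputProb κ eX e₁ e₂) (P : Measure (ProfileSpace N a b)) ∧
      ApproxEntropyEquations (profileEntropy₁ (P : Measure (ProfileSpace N a b)))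
        (profileEntropy₂ (P : Measure (ProfileSpace N a b))) c₀ c₁ c₂ η ∧
      R.1 ≤ c₀ ∧ R.2.1 ≤ c₁ ∧ R.2.2 ≤ c₂ := by
  set K : ℝ := Real.log (Fintype.card 𝒴₁) + Real.log (Fintype.card 𝒴₂) + Real.log 2 with hK
  have hl1 : 0 ≤ Real.log (Fintype.card 𝒴₁) := Real.log_natCast_nonneg _
  have hl2 : 0 ≤ Real.log (Fintype.card 𝒴₂) := Real.log_natCast_nonneg _
  have hlog2 : 0 < Real.log 2 := Real.log_pos (by norm_num)
  have hKpos : 0 < K := by linarith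
  -- The final error is `2 * δ / n = 2 * log 2 / n + 4 * ε * K`. This choice of `ε` bounds the
  -- second term by `η / 2`, and `n ≥ 4 * log 2 / η` does so for the first. The bound 1/2 is what
  -- the estimate of the message counts needs.
  set ε : ℝ := min (1 / 2) (η / (8 * K)) with hε
  have hε0 : 0 < ε := lt_min (by norm_num) (by positivity)
  obtain ⟨n₀, hn₀⟩ := hR.2.2.2 ε hε0
  obtain ⟨n₁, hn₁⟩ := exists_nat_ge (4 * Real.log 2 / η)
  set n : ℕ := max n₀ (max n₁ 1) with hn
  obtain ⟨M₀, M₁, M₂, C, hM₀, hM₁, hM₂, hC⟩ := hn₀ n (le_max_left _ _)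
  have : NeZero M₀ := neZero_of_exp_le hM₀
  have : NeZero M₁ := neZero_of_exp_le hM₁
  have : NeZero M₂ := neZero_of_exp_le hM₂
  have hn1 : 1 ≤ n := (le_max_right _ _).trans (le_max_right _ _)
  have : NeZero n := ⟨by omega⟩
  have hn1' : (1 : ℝ) ≤ n := by exact_mod_cast hn1
  have hnη : 4 * Real.log 2 / η ≤ n :=
    hn₁.trans (by exact_mod_cast (le_max_left n₁ 1).trans (le_max_right _ _))
  have hC2 : C.errorProb κ ≤ 1 / 2 := hC.trans (min_le_left _ _)
  set δ : ℝ := Real.log 2 + ε * (2 * (n * K)) with hδ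
  have hbound : ∀ x y : ℝ, 0 ≤ x → x ≤ 2 * (n * y + Real.log 2) → y + Real.log 2 ≤ K →
      C.errorProb κ * x ≤ ε * (2 * (n * K)) := by
    intro x y hx hxy hy
    have h1 : x ≤ 2 * (n * K) := by
      have h2 : (n : ℝ) * (y + Real.log 2) ≤ n * K := by gcongr
      have h3 : Real.log 2 ≤ n * Real.log 2 := le_mul_of_one_le_left hlog2.le hn1'
      linarith
    calc C.errorProb κ * x ≤ ε * x := by gcongr
      _ ≤ _ := by gcongr
  have hδ₁ : ∀ A, C.entropy κ (A ∪ {.t, .u}) n n - C.entropy κ A n n ≤ δ := fun A =>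
    (C.entropy_union_sub_le₁ κ A).trans (add_le_add_right (hbound _ _
      (add_nonneg (Real.log_natCast_nonneg _) (Real.log_natCast_nonneg _))
      (C.log_add_log_le₁ κ hC2) (by linarith)) _)
  have hδ₂ : ∀ A, C.entropy κ (A ∪ {.t, .v}) 0 0 - C.entropy κ A 0 0 ≤ δ := fun A =>
    (C.entropy_union_sub_le₂ κ A).trans (add_le_add_right (hbound _ _
      (add_nonneg (Real.log_natCast_nonneg _) (Real.log_natCast_nonneg _))
      (C.log_add_log_le₂ κ hC2) (by linarith)) _)
  have happrox := C.approxEntropyEquations_profile κ eX e₁ e₂ hδ₁ hδ₂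
  have hδη : 2 * δ / n ≤ η := by
    rw [div_le_iff₀ (by linarith)]
    have h1 : 4 * Real.log 2 ≤ n * η := (div_le_iff₀ hη).1 hnη
    have h2 : ε * (8 * K) ≤ η := (le_div_iff₀ (by positivity)).1 (min_le_right _ _)
    have h3 : (n : ℝ) * (ε * (8 * K)) ≤ n * η := by gcongr
    rw [hδ]
    linarith
  refine ⟨⟨C.profile κ eX e₁ e₂, C.isProbabilityMeasure_profile κ eX e₁ e₂⟩, _, _, _,
    C.isProfile_profile κ eX e₁ e₂, ?_, le_log_div hM₀, le_log_div hM₁, le_log_div hM₂⟩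
  exact ⟨fun A hA => (happrox.t_one A hA).trans hδη, fun A hA => (happrox.t_two A hA).trans hδη,
    fun A hA => (happrox.u_one A hA).trans hδη, fun A hA => (happrox.v_two A hA).trans hδη,
    happrox.sides, fun A B₁ B₂ h₁ h₂ => (happrox.sub_sub A B₁ B₂ h₁ h₂).trans hδη⟩

lemma tendsto_of_abs_sub_le {ι : Type*} {l : Filter ι} {f c η : ι → ℝ} {F : ℝ}
    (hf : Filter.Tendsto f l (nhds F)) (h : ∀ i, |f i - c i| ≤ η i)
    (hη : Filter.Tendsto η l (nhds 0)) : Filter.Tendsto c l (nhds F) := by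
  have h1 : Filter.Tendsto (fun i => f i - c i) l (nhds 0) := squeeze_zero_norm h hη
  simpa using hf.sub h1

lemma tendsto_integral_of_continuous {E ι : Type*} [TopologicalSpace E] [CompactSpace E]
    [MeasurableSpace E] [OpensMeasurableSpace E] {l : Filter ι} {P : ι → ProbabilityMeasure E}
    {Q : ProbabilityMeasure E} (hP : Filter.Tendsto P l (nhds Q)) {g : E → ℝ} (hg : Continuous g) :
    Filter.Tendsto (fun i => ∫ e, g e ∂(P i : Measure E)) l (nhds (∫ e, g e ∂(Q : Measure E))) :=
  ProbabilityMeasure.tendsto_iff_forall_integral_tendsto.1 hP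
    (BoundedContinuousFunction.mkOfCompact ⟨g, hg⟩)

lemma tendsto_profileEntropy₁ {ι : Type*} {l : Filter ι}
    {P : ι → ProbabilityMeasure (ProfileSpace N a b)}
    {Q : ProbabilityMeasure (ProfileSpace N a b)} (hP : Filter.Tendsto P l (nhds Q))
    (A : Finset Label) (s : Side) :
    Filter.Tendsto (fun i => profileEntropy₁ (P i : Measure (ProfileSpace N a b)) A s) l
      (nhds (profileEntropy₁ (Q : Measure (ProfileSpace N a b)) A s)) :=
  tendsto_integral_of_continuous hP (continuous_finsetSum Finset.univ fun y _ =>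
    Real.continuous_negMulLog.comp
      (show Continuous fun k : ProfileSpace N a b => (k.2 (A, s) (.inl y) : ℝ) by fun_prop))

lemma tendsto_profileEntropy₂ {ι : Type*} {l : Filter ι}
    {P : ι → ProbabilityMeasure (ProfileSpace N a b)}
    {Q : ProbabilityMeasure (ProfileSpace N a b)} (hP : Filter.Tendsto P l (nhds Q))
    (A : Finset Label) (s : Side) :
    Filter.Tendsto (fun i => profileEntropy₂ (P i : Measure (ProfileSpace N a b)) A s) l
      (nhds (profileEntropy₂ (Q : Measure (ProfileSpace N a b)) A s)) :=
  tendsto_integral_of_continuous hP (continuous_finsetSum Finset.univ fun y _ =>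
    Real.continuous_negMulLog.comp
      (show Continuous fun k : ProfileSpace N a b => (k.2 (A, s) (.inr y) : ℝ) by fun_prop))

lemma isProfile_of_tendsto {ι : Type*} {l : Filter ι} [l.NeBot]
    {q : Fin N → (Fin a ⊕ Fin b) → ℝ} {P : ι → ProbabilityMeasure (ProfileSpace N a b)}
    {Q : ProbabilityMeasure (ProfileSpace N a b)} (hP : Filter.Tendsto P l (nhds Q))
    (h : ∀ i, IsProfile q (P i : Measure (ProfileSpace N a b))) :
    IsProfile q (Q : Measure (ProfileSpace N a b)) := by
  intro S j g
  have hmask := continuous_mask (N := N) (a := a) (b := b) S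
  have hq : Continuous fun k : ProfileSpace N a b => q k.1 j :=
    (continuous_of_discreteTopology (f := fun x : Fin N => q x j)).comp continuous_fst
  have h1 := tendsto_integral_of_continuous hP (hq.mul (g.continuous.comp hmask))
  have h2 := tendsto_integral_of_continuous hP
    ((show Continuous fun k : ProfileSpace N a b => (k.2 S j : ℝ) by fun_prop).mul
      (g.continuous.comp hmask))
  exact tendsto_nhds_unique h1 (h2.congr fun i => (h i S j g).symm)

/-- The rates need no compactness of their own: the approximate equations with `A = ∅` force them to
converge together with the entropies. -/
lemma exists_entropyEquations_of_tendsto {ι : Type*} {l : Filter ι} [l.NeBot]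
    {H₁ H₂ : ι → Finset Label → Side → ℝ} {G₁ G₂ : Finset Label → Side → ℝ} {c₀ c₁ c₂ η : ι → ℝ}
    (hH₁ : ∀ A s, Filter.Tendsto (fun i => H₁ i A s) l (nhds (G₁ A s)))
    (hH₂ : ∀ A s, Filter.Tendsto (fun i => H₂ i A s) l (nhds (G₂ A s)))
    (happ : ∀ i, ApproxEntropyEquations (H₁ i) (H₂ i) (c₀ i) (c₁ i) (c₂ i) (η i))
    (hη : Filter.Tendsto η l (nhds 0)) :
    ∃ d₀ d₁ d₂, Filter.Tendsto c₀ l (nhds d₀) ∧ Filter.Tendsto c₁ l (nhds d₁) ∧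
      Filter.Tendsto c₂ l (nhds d₂) ∧ EntropyEquations G₁ G₂ d₀ d₁ d₂ := by
  have ht₀ := tendsto_of_abs_sub_le ((hH₁ ∅ .one).sub (hH₁ {.t} .one))
    (fun k => (happ k).t_one ∅ (by simp)) hη
  have ht₁ := tendsto_of_abs_sub_le ((hH₁ ∅ .one).sub (hH₁ {.u} .one))
    (fun k => (happ k).u_one ∅ (by simp)) hη
  have ht₂ := tendsto_of_abs_sub_le ((hH₂ ∅ .two).sub (hH₂ {.v} .two))
    (fun k => (happ k).v_two ∅ (by simp)) hη
  refine ⟨_, _, _, ht₀, ht₁, ht₂, ?_, ?_, ?_, ?_, ?_, ?_⟩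
  · exact fun A hA => tendsto_nhds_unique (tendsto_of_abs_sub_le ((hH₁ A .one).sub (hH₁ _ .one))
      (fun k => (happ k).t_one A hA) hη) ht₀
  · exact fun A hA => tendsto_nhds_unique (tendsto_of_abs_sub_le ((hH₂ A .two).sub (hH₂ _ .two))
      (fun k => (happ k).t_two A hA) hη) ht₀
  · exact fun A hA => tendsto_nhds_unique (tendsto_of_abs_sub_le ((hH₁ A .one).sub (hH₁ _ .one))
      (fun k => (happ k).u_one A hA) hη) ht₁
  · exact fun A hA => tendsto_nhds_unique (tendsto_of_abs_sub_le ((hH₂ A .two).sub (hH₂ _ .two))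
      (fun k => (happ k).v_two A hA) hη) ht₂
  · exact fun A => tendsto_nhds_unique ((hH₁ A .one).sub (hH₁ A .both))
      (((hH₂ A .two).sub (hH₂ A .both)).congr fun k => ((happ k).sides A).symm)
  · intro A B₁ B₂ hB₁ hB₂
    refine tendsto_nhds_unique (tendsto_of_abs_sub_le
      (((hH₁ (A ∪ B₂) .both).sub (hH₁ (A ∪ B₂ ∪ B₁) .both)).add
        ((hH₂ A .both).sub (hH₂ (A ∪ B₁) .both)))
      (fun k => (happ k).sub_sub A B₁ B₂ hB₁ hB₂) hη)
      (((hH₂ (A ∪ B₂) .both).sub (hH₂ (A ∪ B₂ ∪ B₁) .both)).add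
        ((hH₁ A .both).sub (hH₁ (A ∪ B₁) .both)))

theorem capacityRegion_subset_restrictedOuterRegion [Fintype 𝒳] [MeasurableSingletonClass 𝒳]
    (κ : Kernel 𝒳 (𝒴₁ × 𝒴₂)) [IsMarkovKernel κ] (eX : Fin N ≃ 𝒳) (e₁ : Fin a ≃ 𝒴₁)
    (e₂ : Fin b ≃ 𝒴₂) : capacityRegion κ ⊆ restrictedOuterRegion κ := by
  intro R hR
  obtain ⟨r, hr, hrR⟩ := mem_closure_iff_seq_limit.1 hR
  -- Along an ultrafilter every sequence in a compact space converges, so no subsequences have to be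
  -- extracted. The error `η k` shrinks while `r k` tends to `R`, which handles the closure and the
  -- block length in one limit.
  let l : Filter ℕ := (Filter.hyperfilter ℕ : Filter ℕ)
  have hl : l ≤ Filter.atTop := Nat.hyperfilter_le_atTop
  let η : ℕ → ℝ := fun k => 1 / ((k : ℝ) + 1)
  have hη : Filter.Tendsto η l (nhds 0) := tendsto_one_div_add_atTop_nhds_zero_nat.mono_left hl
  have hrl : Filter.Tendsto r l (nhds R) := hrR.mono_left hl
  have hpos : ∀ k, 0 < η k := fun k => by positivity
  choose P c₀ c₁ c₂ hprof happ h₀ h₁ h₂ using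
    fun k => Achievable.exists_profile eX e₁ e₂ (hr k) (hpos k)
  -- The probability measures on the compact metrizable space of profile points form a compact
  -- space.
  obtain ⟨Q, hQ⟩ : ∃ Q, Filter.Tendsto P l (nhds Q) :=
    ⟨_, (Ultrafilter.map P (Filter.hyperfilter ℕ)).le_nhds_lim⟩
  obtain ⟨d₀, d₁, d₂, ht₀, ht₁, ht₂, hE⟩ := exists_entropyEquations_of_tendsto
    (tendsto_profileEntropy₁ hQ) (tendsto_profileEntropy₂ hQ) happ hη
  have hr₀ : Filter.Tendsto (fun k => (r k).1) l (nhds R.1) :=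
    (continuous_fst.tendsto R).comp hrl
  have hr₁ : Filter.Tendsto (fun k => (r k).2.1) l (nhds R.2.1) :=
    ((continuous_fst.comp continuous_snd).tendsto R).comp hrl
  have hr₂ : Filter.Tendsto (fun k => (r k).2.2) l (nhds R.2.2) :=
    ((continuous_snd.comp continuous_snd).tendsto R).comp hrl
  exact mem_restrictedOuterRegion_of_isProfile κ eX e₁ e₂ _
    (isProfile_of_tendsto hQ hprof) hE R
    (ge_of_tendsto' hr₀ fun k => (hr k).1) (ge_of_tendsto' hr₁ fun k => (hr k).2.1)
    (ge_of_tendsto' hr₂ fun k => (hr k).2.2.1)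
    (le_of_tendsto_of_tendsto' hr₀ ht₀ h₀) (le_of_tendsto_of_tendsto' hr₁ ht₁ h₁)
    (le_of_tendsto_of_tendsto' hr₂ ht₂ h₂)

end Limit

lemma restrictedOuterRegion_subset_outerRegion {𝒳 𝒴₁ 𝒴₂ : Type*}
    [Fintype 𝒳] [MeasurableSpace 𝒳] [MeasurableSingletonClass 𝒳]
    [Fintype 𝒴₁] [Nonempty 𝒴₁] [MeasurableSpace 𝒴₁] [MeasurableSingletonClass 𝒴₁]
    [Fintype 𝒴₂] [Nonempty 𝒴₂] [MeasurableSpace 𝒴₂] [MeasurableSingletonClass 𝒴₂]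
    (κ : Kernel 𝒳 (𝒴₁ × 𝒴₂)) : restrictedOuterRegion κ ⊆ outerRegion κ :=
  fun _ ⟨Ω, mΩ, μ, hμ, T, U, V, W₁, W₂, X, Y₁, Y₂, hA, hR, _⟩ =>
    ⟨Ω, mΩ, μ, hμ, T, U, V, W₁, W₂, X, Y₁, Y₂, hA, hR⟩

end

end BroadcastOuter

theorem lemma2 {𝒳 𝒴₁ 𝒴₂ : Type*}
    [Fintype 𝒳] [Nonempty 𝒳] [MeasurableSpace 𝒳] [MeasurableSingletonClass 𝒳]
    [Fintype 𝒴₁] [Nonempty 𝒴₁] [MeasurableSpace 𝒴₁] [MeasurableSingletonClass 𝒴₁]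
    [Fintype 𝒴₂] [Nonempty 𝒴₂] [MeasurableSpace 𝒴₂] [MeasurableSingletonClass 𝒴₂]
    (κ : ProbabilityTheory.Kernel 𝒳 (𝒴₁ × 𝒴₂)) [ProbabilityTheory.IsMarkovKernel κ] :
    BroadcastOuter.capacityRegion κ ⊆ BroadcastOuter.outerRegion κ ∧
      BroadcastOuter.capacityRegion κ ⊆ BroadcastOuter.restrictedOuterRegion κ := by
  have : NeZero (Fintype.card 𝒳) := ⟨Fintype.card_ne_zero⟩
  -- Numbering the letters places the constructed sample space in `Type`, as the outer region
  -- demands, whatever the universes of the alphabets.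
  have h := BroadcastOuter.capacityRegion_subset_restrictedOuterRegion κ
    (Fintype.equivFin 𝒳).symm (Fintype.equivFin 𝒴₁).symm (Fintype.equivFin 𝒴₂).symm
  exact ⟨h.trans (BroadcastOuter.restrictedOuterRegion_subset_outerRegion κ), h⟩
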